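/- Let $d\ge 1$ and $0<s<\frac12$. Let $\Omega\subset\mathbb R^d$ be a bounded open set with $C^2$ boundary, i.e. near each boundary point, after a rotation of coordinates, $\Omega$ is the region strictly above the graph of a $C^2$ function of $d-1$ variables. Let $V$ be a bounded open set with $\overline\Omega\subset V$. For open $U\subseteq\mathbb R^d$ and a vector field $g$ on $U$ put $$\|g\|_{H^s(U)}=\Bigl(\int_U\int_U\frac{|g(x)-g(y)|^2}{|x-y|^{d+2s}}\,dx\,dy\Bigr)^{1/2}+\|g\|_{L^2(U)} ,$$ let $H^{1+s}(U)$ be the space of real-valued $f\in L^2(U)$ with a weak gradient $\partial f\in L^2(U)$ and $\|\partial f\|_{H^s(U)}<\infty$, with norm $\|f\|_{H^{1+s}(U)}=\|f\|_{L^2(U)}+\|\partial f\|_{H^s(U)}$, and let $\|f\|_{H^1(U)}=\|f\|_{L^2(U)}+\|\partial f\|_{L^2(U)}$. Then there exist a linear operator $E:H^{1+s}(\Omega)\to H^{1+s}(\mathbb R^d)$ and a constant $C$ such that for every $f\in H^{1+s}(\Omega)$: 1. $\|Ef\|_{H^{1+s}(\mathbb R^d)}\le C\|f\|_{H^{1+s}(\Omega)}$;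 2. $Ef=f$ a.e. in $\Omega$; 3. the support of $Ef$ is a compact subset of $V$; 4. $\|Ef\|_{H^1(\mathbb R^d)}\le C\|f\|_{H^1(\Omega)}$; 5. $\|\partial Ef\|_{H^s(\mathbb R^d)}\le C\bigl(\|f\|_{L^2(\Omega)}+\|\partial f\|_{H^s(\Omega)}\bigr)$; 6. if $\Omega$ is connected and $\int_\Omega f\,dx=0$, then $\|\partial Ef\|_{H^s(\mathbb R^d)}\le C\|\partial f\|_{H^s(\Omega)}$. -/

import Mathlib

open MeasureTheory Set Metric
open scoped ENNReal NNReal ContDiff RealInnerProductSpace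

noncomputable section

namespace FracExt

/-- Euclidean space `ℝ^d`. -/
abbrev Eu (d : ℕ) : Type := EuclideanSpace ℝ (Fin d)

/-- `L²(Ω)`, real-valued. -/
abbrev L2 {d : ℕ} (Ω : Set (Eu d)) : Type := Lp ℝ 2 (volume.restrict Ω)

/-- `Ω` has `C²` boundary: near each boundary point there are a unit vector `ν` and a `C²` function
`γ` on the hyperplane `ν^⊥` (a copy of `ℝ^{d-1}`) such that `Ω` is, in a ball around the point, the
strict epigraph of `γ` in the direction `ν`. -/
def HasC2Boundary {d : ℕ} (Ω : Set (Eu d)) : Prop :=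
  ∀ x₀ ∈ frontier Ω, ∃ r : ℝ, 0 < r ∧ ∃ ν : Eu d, ‖ν‖ = 1 ∧
    ∃ γ : ((ℝ ∙ ν)ᗮ : Submodule ℝ (Eu d)) → ℝ, ContDiff ℝ 2 γ ∧
      ∀ x ∈ ball x₀ r, x ∈ Ω ↔ γ (((ℝ ∙ ν)ᗮ : Submodule ℝ (Eu d)).orthogonalProjectionOnto x) < ⟪ν, x⟫

/-- `g ∈ L²(Ω; ℝ^d)` is the weak (distributional) gradient of `f` on the open set `Ω`. -/
def IsWeakGradient {d : ℕ} (Ω : Set (Eu d)) (f : L2 Ω) (g : Eu d → Eu d) : Prop :=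
  MemLp g 2 (volume.restrict Ω) ∧
    ∀ φ : Eu d → ℝ, ContDiff ℝ ∞ φ → HasCompactSupport φ → tsupport φ ⊆ Ω → ∀ i : Fin d,
      ∫ x in Ω, f x * fderiv ℝ φ x (EuclideanSpace.single i 1) = - ∫ x in Ω, g x i * φ x

open Classical in
/-- The weak gradient `∂f` of `f` on `Ω` (zero if there is none); for open `Ω` it is determined up
to equality a.e. in `Ω`, see `IsWeakGradient.ae_eq`. -/
def weakGrad {d : ℕ} (Ω : Set (Eu d)) (f : L2 Ω) : Eu d → Eu d :=
  if h : ∃ g, IsWeakGradient Ω f g then h.choose else 0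

/-- The squared Gagliardo seminorm
`∬_{Ω×Ω} |g(x) - g(y)|² / |x - y|^{d+2s} dx dy`. -/
def gagliardoSq {d : ℕ} (s : ℝ) (Ω : Set (Eu d)) (g : Eu d → Eu d) : ℝ≥0∞ :=
  ∫⁻ x in Ω, ∫⁻ y in Ω, ‖g x - g y‖ₑ ^ 2 / ‖x - y‖ₑ ^ ((d : ℝ) + 2 * s)

/-- `‖g‖_{H^s(Ω)} = ‖g‖_{Ḣ^s(Ω)} + ‖g‖_{L²(Ω)}` for a vector field `g`. -/
def hsNorm {d : ℕ} (s : ℝ) (Ω : Set (Eu d)) (g : Eu d → Eu d) : ℝ≥0∞ :=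
  gagliardoSq s Ω g ^ (1 / 2 : ℝ) + eLpNorm g 2 (volume.restrict Ω)

/-- `‖f‖_{H^1(Ω)} = ‖f‖_{L²(Ω)} + ‖∂f‖_{L²(Ω)}`. -/
def h1Norm {d : ℕ} (Ω : Set (Eu d)) (f : L2 Ω) : ℝ≥0∞ :=
  eLpNorm f 2 (volume.restrict Ω) + eLpNorm (weakGrad Ω f) 2 (volume.restrict Ω)

/-- `‖f‖_{H^{1+s}(Ω)} = ‖f‖_{L²(Ω)} + ‖∂f‖_{H^s(Ω)}`. -/
def h1sNorm {d : ℕ} (s : ℝ) (Ω : Set (Eu d)) (f : L2 Ω) : ℝ≥0∞ :=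
  eLpNorm f 2 (volume.restrict Ω) + hsNorm s Ω (weakGrad Ω f)

theorem integrable_mul_test {d : ℕ} {Ω : Set (Eu d)} {u ψ : Eu d → ℝ}
    (hu : MemLp u 2 (volume.restrict Ω)) (hc : Continuous ψ) (hs : HasCompactSupport ψ) :
    Integrable (fun x => u x * ψ x) (volume.restrict Ω) :=
  MemLp.integrable_mul hu (hc.memLp_of_hasCompactSupport (p := 2) hs)

theorem memLp_coord {d : ℕ} {Ω : Set (Eu d)} {g : Eu d → Eu d}
    (hg : MemLp g 2 (volume.restrict Ω)) (i : Fin d) :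
    MemLp (fun x => g x i) 2 (volume.restrict Ω) :=
  (EuclideanSpace.proj (𝕜 := ℝ) i).comp_memLp' hg

theorem continuous_test_deriv {d : ℕ} {φ : Eu d → ℝ} (h : ContDiff ℝ ∞ φ) (v : Eu d) :
    Continuous (fun x => fderiv ℝ φ x v) :=
  (h.continuous_fderiv (by simp)).clm_apply continuous_const

theorem hasCompactSupport_test_deriv {d : ℕ} {φ : Eu d → ℝ} (h : HasCompactSupport φ)
    (v : Eu d) : HasCompactSupport (fun x => fderiv ℝ φ x v) :=
  h.fderiv_apply (𝕜 := ℝ) v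

theorem IsWeakGradient.add {d : ℕ} {Ω : Set (Eu d)} {f₁ f₂ : L2 Ω} {g₁ g₂ : Eu d → Eu d}
    (h₁ : IsWeakGradient Ω f₁ g₁) (h₂ : IsWeakGradient Ω f₂ g₂) :
    IsWeakGradient Ω (f₁ + f₂) (g₁ + g₂) := by
  refine ⟨h₁.1.add h₂.1, fun φ hφ hc hs i => ?_⟩
  have hd := continuous_test_deriv hφ (EuclideanSpace.single i 1)
  have hdc := hasCompactSupport_test_deriv hc (EuclideanSpace.single i (1 : ℝ))
  have e : ∫ x in Ω, (f₁ + f₂ : L2 Ω) x * fderiv ℝ φ x (EuclideanSpace.single i 1)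
      = ∫ x in Ω, (f₁ x * fderiv ℝ φ x (EuclideanSpace.single i 1)
        + f₂ x * fderiv ℝ φ x (EuclideanSpace.single i 1)) := by
    refine integral_congr_ae ?_
    filter_upwards [Lp.coeFn_add f₁ f₂] with x hx
    rw [hx, Pi.add_apply, add_mul]
  rw [e, integral_add (integrable_mul_test (Lp.memLp f₁) hd hdc)
    (integrable_mul_test (Lp.memLp f₂) hd hdc), h₁.2 φ hφ hc hs i, h₂.2 φ hφ hc hs i]
  simp only [Pi.add_apply, PiLp.add_apply, add_mul]
  rw [integral_add (integrable_mul_test (memLp_coord h₁.1 i) hφ.continuous hc)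
    (integrable_mul_test (memLp_coord h₂.1 i) hφ.continuous hc)]
  ring

theorem IsWeakGradient.smul {d : ℕ} {Ω : Set (Eu d)} {f : L2 Ω} {g : Eu d → Eu d} (c : ℝ)
    (h : IsWeakGradient Ω f g) : IsWeakGradient Ω (c • f) (c • g) := by
  refine ⟨h.1.const_smul c, fun φ hφ hc hs i => ?_⟩
  have e : ∫ x in Ω, (c • f : L2 Ω) x * fderiv ℝ φ x (EuclideanSpace.single i 1)
      = ∫ x in Ω, c * (f x * fderiv ℝ φ x (EuclideanSpace.single i 1)) := by
    refine integral_congr_ae ?_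
    filter_upwards [Lp.coeFn_smul c f] with x hx
    rw [hx, Pi.smul_apply, smul_eq_mul, mul_assoc]
  rw [e, integral_const_mul, h.2 φ hφ hc hs i]
  simp only [Pi.smul_apply, PiLp.smul_apply, smul_eq_mul, mul_assoc]
  rw [integral_const_mul]
  ring

theorem IsWeakGradient.zero {d : ℕ} (Ω : Set (Eu d)) : IsWeakGradient Ω 0 0 := by
  refine ⟨MemLp.zero, fun φ hφ hc hs i => ?_⟩
  have e : ∫ x in Ω, (0 : L2 Ω) x * fderiv ℝ φ x (EuclideanSpace.single i 1) = ∫ x in Ω, (0 : ℝ) := by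
    refine integral_congr_ae ?_
    filter_upwards [Lp.coeFn_zero ℝ 2 (volume.restrict Ω)] with x hx
    rw [hx, Pi.zero_apply, zero_mul]
  rw [e]
  simp

/-- The weak gradient is unique up to equality a.e. -/
theorem IsWeakGradient.ae_eq {d : ℕ} {Ω : Set (Eu d)} (hΩ : IsOpen Ω) {f : L2 Ω}
    {g₁ g₂ : Eu d → Eu d} (h₁ : IsWeakGradient Ω f g₁) (h₂ : IsWeakGradient Ω f g₂) :
    g₁ =ᵐ[volume.restrict Ω] g₂ := by
  have key : ∀ i : Fin d, ∀ᵐ x ∂(volume.restrict Ω), g₁ x i - g₂ x i = 0 := by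
    intro i
    have m : MemLp (fun x => g₁ x i - g₂ x i) 2 (volume.restrict Ω) :=
      (memLp_coord h₁.1 i).sub (memLp_coord h₂.1 i)
    rw [ae_restrict_iff' hΩ.measurableSet]
    refine hΩ.ae_eq_zero_of_integral_contDiff_smul_eq_zero ?_ ?_
    · rw [locallyIntegrableOn_iff hΩ.isLocallyClosed]
      intro k hk hkc
      have m' : MemLp (fun x => g₁ x i - g₂ x i) 2 (volume.restrict k) :=
        m.mono_measure (Measure.restrict_mono hk le_rfl)
      have : IsFiniteMeasure (volume.restrict k) := ⟨by simpa using hkc.measure_lt_top⟩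
      exact m'.integrable (by norm_num)
    · intro φ hφ hc hs
      have a := h₁.2 φ hφ hc hs i
      have b := h₂.2 φ hφ hc hs i
      have t : ∫ x in Ω, (g₁ x i * φ x - g₂ x i * φ x) = 0 := by
        rw [integral_sub (integrable_mul_test (memLp_coord h₁.1 i) hφ.continuous hc)
          (integrable_mul_test (memLp_coord h₂.1 i) hφ.continuous hc)]
        linarith
      rw [← t, ← setIntegral_eq_integral_of_forall_compl_eq_zero (s := Ω)]
      · refine integral_congr_ae (Filter.Eventually.of_forall fun x => ?_)
        simp only [smul_eq_mul]
        ring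
      · intro x hx
        have : φ x = 0 := by
          by_contra hne
          exact hx (hs (subset_tsupport φ hne))
        simp [this]
  filter_upwards [ae_all_iff.2 key] with x hx
  ext i
  exact sub_eq_zero.1 (hx i)

theorem gagliardoSq_zero {d : ℕ} (s : ℝ) (Ω : Set (Eu d)) : gagliardoSq s Ω 0 = 0 := by
  simp [gagliardoSq]

theorem gagliardoSq_smul {d : ℕ} (s : ℝ) (Ω : Set (Eu d)) (c : ℝ) (g : Eu d → Eu d) :
    gagliardoSq s Ω (c • g) = ‖c‖ₑ ^ 2 * gagliardoSq s Ω g := by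
  have hc : ‖c‖ₑ ^ 2 ≠ ⊤ := by finiteness
  unfold gagliardoSq
  rw [← lintegral_const_mul' _ _ hc]
  refine lintegral_congr fun x => ?_
  rw [← lintegral_const_mul' _ _ hc]
  refine lintegral_congr fun y => ?_
  rw [Pi.smul_apply, Pi.smul_apply, ← smul_sub, enorm_smul, mul_pow, mul_div_assoc]

theorem aemeasurable_gagliardo {d : ℕ} (s : ℝ) {Ω : Set (Eu d)} {g : Eu d → Eu d}
    (hg : AEStronglyMeasurable g (volume.restrict Ω)) :
    AEMeasurable (fun p : Eu d × Eu d => ‖g p.1 - g p.2‖ₑ ^ 2 / ‖p.1 - p.2‖ₑ ^ ((d : ℝ) + 2 * s))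
      ((volume.restrict Ω).prod (volume.restrict Ω)) := by
  have h := (hg.comp_fst (ν := volume.restrict Ω)).sub (hg.comp_snd (μ := volume.restrict Ω))
  exact (h.enorm.pow_const 2).div (by fun_prop)

theorem gagliardoSq_add_lt_top {d : ℕ} (s : ℝ) {Ω : Set (Eu d)} {g₁ g₂ : Eu d → Eu d}
    (m₁ : AEStronglyMeasurable g₁ (volume.restrict Ω))
    (m₂ : AEStronglyMeasurable g₂ (volume.restrict Ω))
    (h₁ : gagliardoSq s Ω g₁ < ⊤) (h₂ : gagliardoSq s Ω g₂ < ⊤) :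
    gagliardoSq s Ω (g₁ + g₂) < ⊤ := by
  have a₁ := aemeasurable_gagliardo s m₁
  have a₂ := aemeasurable_gagliardo s m₂
  unfold gagliardoSq at *
  rw [lintegral_lintegral a₁] at h₁
  rw [lintegral_lintegral a₂] at h₂
  rw [lintegral_lintegral (aemeasurable_gagliardo s (m₁.add m₂))]
  refine lt_of_le_of_lt (lintegral_mono (g := fun p : Eu d × Eu d =>
    2 * (‖g₁ p.1 - g₁ p.2‖ₑ ^ 2 / ‖p.1 - p.2‖ₑ ^ ((d : ℝ) + 2 * s)
      + ‖g₂ p.1 - g₂ p.2‖ₑ ^ 2 / ‖p.1 - p.2‖ₑ ^ ((d : ℝ) + 2 * s))) fun p => ?_) ?_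
  · dsimp only
    rw [← ENNReal.add_div, ← mul_div_assoc]
    refine ENNReal.div_le_div_right ?_ _
    have e : (g₁ + g₂) p.1 - (g₁ + g₂) p.2 = (g₁ p.1 - g₁ p.2) + (g₂ p.1 - g₂ p.2) := by
      simp only [Pi.add_apply]; abel
    rw [e]
    refine (pow_le_pow_left' (enorm_add_le _ _) 2).trans ?_
    have := ENNReal.rpow_add_le_mul_rpow_add_rpow ‖g₁ p.1 - g₁ p.2‖ₑ ‖g₂ p.1 - g₂ p.2‖ₑ
      (p := 2) (by norm_num)
    norm_num at this
    exact this
  · rw [lintegral_const_mul' _ _ (by norm_num), lintegral_add_left' a₁]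
    exact ENNReal.mul_lt_top (by norm_num) (ENNReal.add_lt_top.2 ⟨h₁, h₂⟩)

/-- `H^{1+s}(Ω)`: the functions in `L²(Ω)` with a weak gradient in `L²(Ω)` whose Gagliardo
seminorm of order `s` is finite. -/
def H1s {d : ℕ} (s : ℝ) (Ω : Set (Eu d)) : Submodule ℝ (L2 Ω) where
  carrier := {f | ∃ g, IsWeakGradient Ω f g ∧ gagliardoSq s Ω g < ⊤}
  add_mem' := by
    rintro f₁ f₂ ⟨g₁, w₁, h₁⟩ ⟨g₂, w₂, h₂⟩
    exact ⟨g₁ + g₂, w₁.add w₂, gagliardoSq_add_lt_top s w₁.1.1 w₂.1.1 h₁ h₂⟩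
  zero_mem' := ⟨0, IsWeakGradient.zero Ω, by simp [gagliardoSq_zero]⟩
  smul_mem' := by
    rintro c f ⟨g, w, h⟩
    refine ⟨c • g, w.smul c, ?_⟩
    rw [gagliardoSq_smul]
    exact ENNReal.mul_lt_top (by finiteness) h

end FracExt

end

/-! The extension is a second-order reflection across the boundary, localized by a partition of
unity. In a boundary chart `Ω` is the sublevel set `{δ < 0}` with `δ = γ ∘ P - ⟪ν, ·⟫`, where `P` is
the projection onto `ν^⊥`. The shear `S_c x = x + c δ(x) ν` multiplies the height `δ` by `1 - c`, so
for `c ≥ 2` it carries the outside of `Ω` into `Ω`. Its Jacobian is the constant `1 - c`, so it does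
not contract volume. Outside `Ω` put `f(S₂ x)` and `f(S₃ x)` together with weights `3` and `-2`.

The weights satisfy `3 - 2 = 1` and `3·2 - 2·3 = 0`, so both values and gradients match on the
graph. With `a = g(S₂ x)` and `b = g(S₃ x)`, the reflected gradient is `3a - 2b + 6⟪ν, a - b⟫ ∇δ`,
the map `comb`, which is linear in `(a, b)` and returns `a` when `a = b` (`comb_self`). This
identity is what makes the Gagliardo estimate work. For `x` inside and `y` outside, the difference
of the gradients is `comb` of the differences `g(x) - g(S_c y)`, and `|x - S_c y| ≤ K|x - y|`, so a
change of variables bounds the cross term by the seminorm on `Ω` (`EpiChart.gagOn_cross_le`). No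
weight singular at the boundary, and hence no Hardy inequality, appears. For two outside points the
only new term is the variation of `∇δ`. Since `δ` is `C²`, it gains a factor `|x - y|`, which leaves
the integrable kernel `min(1, |z|²)/|z|^{d+2s}` acting on the `L²` norm (`EpiChart.gagOn_outer_le`).

That the reflected gradient is the weak gradient is clear for functions differentiable up to the
graph. The general case follows by mollifying with bumps displaced along the axis of the chart and
using the `L²` bounds (`EpiChart.wg_refl`). Cutting off costs lower-order terms: the cutoff itself
acts on `H^s`, and `f ∇χ` lies in `H¹(ℝ^d)`, which embeds in `H^s(ℝ^d)` (`WG.cutoff_gagOn_le`). The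
pieces add up to an operator on functions (`exists_bddOp`), which its `L²` bound lets descend to
classes.

The bound for mean zero needs in addition the Poincaré inequality `‖f‖ ≤ C‖∂f‖` on connected `Ω`. It
is local near every point of the closure, because the local extension and the translation estimate
control `f(x) - f(y)`, and it becomes global by chaining overlapping open sets. -/

noncomputable section
namespace FracExt
open Filter Topology

/-! ### `L²` tools and mollification. -/

variable {d : ℕ} {F : Type*} [NormedAddCommGroup F]

/-- The squared `L²` norm on `U`. -/
def l2Sq (U : Set (Eu d)) (f : Eu d → F) : ℝ≥0∞ := ∫⁻ x in U, ‖f x‖ₑ ^ 2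

theorem eLpNorm_two_sq {α G : Type*} [MeasurableSpace α] [NormedAddCommGroup G] (f : α → G)
    (μ : Measure α) : eLpNorm f 2 μ ^ 2 = ∫⁻ x, ‖f x‖ₑ ^ 2 ∂μ := by
  have h := eLpNorm_nnreal_pow_eq_lintegral (f := f) (μ := μ) (p := 2) (by norm_num)
  have e : ((2 : ℝ≥0) : ℝ) = ((2 : ℕ) : ℝ) := by norm_num
  simp only [e, ENNReal.rpow_natCast] at h
  exact_mod_cast h

theorem l2Sq_eq (U : Set (Eu d)) (f : Eu d → F) :
    l2Sq U f = eLpNorm f 2 (volume.restrict U) ^ 2 :=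
  (eLpNorm_two_sq f _).symm

theorem enorm_sub_sq_le (a b : F) : ‖a - b‖ₑ ^ 2 ≤ 2 * (‖a‖ₑ ^ 2 + ‖b‖ₑ ^ 2) := by
  refine (pow_le_pow_left' (enorm_sub_le (a := a) (b := b)) 2).trans ?_
  have := ENNReal.rpow_add_le_mul_rpow_add_rpow ‖a‖ₑ ‖b‖ₑ (p := 2) (by norm_num)
  norm_num at this
  exact this

theorem enorm_add_sq_le (a b : F) : ‖a + b‖ₑ ^ 2 ≤ 2 * (‖a‖ₑ ^ 2 + ‖b‖ₑ ^ 2) := by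
  simpa using enorm_sub_sq_le a (-b)

/-- Translations are continuous in `L²`. -/
theorem exists_translation_lt {f : Eu d → F} (hf : MemLp f 2 volume) {ε : ℝ≥0∞}
    (hε : 0 < ε) : ∃ η : ℝ, 0 < η ∧ ∀ z : Eu d, ‖z‖ ≤ η →
      ∫⁻ x, ‖f (x - z) - f x‖ₑ ^ 2 ≤ ε := by
  have : Fact ((2 : ℝ≥0∞) ≠ ⊤) := ⟨by norm_num⟩
  -- The translate `x ↦ f (x - z)` is the action of `-z` on `L²` through the domain. This action is
  -- continuous because the exponent is finite.
  have hc : Continuous fun z : Eu d => DomAddAct.mk (-z) +ᵥ (hf.toLp f) := by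
    have h1 : Continuous fun z : Eu d => DomAddAct.mk (-z) :=
      DomAddAct.continuous_mk.comp continuous_neg
    exact h1.vadd continuous_const
  have ht : Tendsto (fun z : Eu d => eLpNorm (fun x => f (x - z) - f x) 2 volume ^ 2)
      (𝓝 0) (𝓝 0) := by
    have h0 := (hc.tendsto 0)
    rw [neg_zero, DomAddAct.mk_zero, zero_vadd, tendsto_iff_edist_tendsto_0] at h0
    have h2 := (ENNReal.continuous_pow 2).continuousAt.tendsto.comp h0
    simp only [ne_eq, OfNat.ofNat_ne_zero, not_false_eq_true, zero_pow] at h2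
    refine h2.congr fun z => ?_
    simp only [Function.comp]
    rw [DomAddAct.mk_vadd_toLp, Lp.edist_toLp_toLp]
    congr 2
    ext x
    simp [sub_eq_neg_add]
  have h3 := (ENNReal.tendsto_nhds_zero.1 ht) ε hε
  obtain ⟨η, hη, h⟩ := Metric.eventually_nhds_iff.1 h3
  refine ⟨η / 2, by positivity, fun z hz => ?_⟩
  have := h (y := z) (by rw [dist_zero_right]; linarith)
  rwa [eLpNorm_two_sq] at this

theorem memLp_indicator {U : Set (Eu d)} (hU : MeasurableSet U) {f : Eu d → F}
    (hf : MemLp f 2 (volume.restrict U)) : MemLp (U.indicator f) 2 volume :=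
  (memLp_indicator_iff_restrict hU).2 hf

variable [NormedSpace ℝ F]

/-- A mollifier: smooth, nonnegative, of integral one, compactly supported. -/
structure IsMollifier (ρ : Eu d → ℝ) : Prop where
  contDiff : ContDiff ℝ ∞ ρ
  nonneg : ∀ x, 0 ≤ ρ x
  integral_eq : ∫ x, ρ x = 1
  compact : HasCompactSupport ρ

/-- Mollification. -/
def mol (ρ : Eu d → ℝ) (f : Eu d → F) (x : Eu d) : F := ∫ z, ρ z • f (x - z)

theorem mol_eq_convolution (ρ : Eu d → ℝ) (f : Eu d → F) :
    mol ρ f = convolution f ρ (ContinuousLinearMap.lsmul ℝ ℝ : ℝ →L[ℝ] F →L[ℝ] F).flip volume := by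
  ext x
  rw [convolution_eq_swap]
  rfl

theorem mol_eq (ρ : Eu d → ℝ) (f : Eu d → F) (x : Eu d) : mol ρ f x = ∫ z, ρ (x - z) • f z := by
  rw [mol_eq_convolution, convolution_def]
  rfl

theorem IsMollifier.continuous_mol {ρ : Eu d → ℝ} (hρ : IsMollifier ρ) {f : Eu d → F}
    (hf : LocallyIntegrable f volume) : Continuous (mol ρ f) := by
  rw [mol_eq_convolution]
  exact hρ.compact.continuous_convolution_right _ hf hρ.contDiff.continuous

theorem IsMollifier.integrable_smul {ρ : Eu d → ℝ} (hρ : IsMollifier ρ) {f : Eu d → F}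
    (hf : LocallyIntegrable f volume) (x : Eu d) : Integrable (fun z => ρ z • f (x - z)) := by
  have := (hρ.compact.convolutionExists_right
    (ContinuousLinearMap.lsmul ℝ ℝ : ℝ →L[ℝ] F →L[ℝ] F).flip hf hρ.contDiff.continuous x)
  exact this.integrable_swap

theorem IsMollifier.lintegral_eq {ρ : Eu d → ℝ} (hρ : IsMollifier ρ) :
    ∫⁻ z, ‖ρ z‖ₑ = 1 := by
  have hi : Integrable ρ := hρ.contDiff.continuous.integrable_of_hasCompactSupport hρ.compact
  have := ofReal_integral_eq_lintegral_ofReal hi (Eventually.of_forall hρ.nonneg)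
  rw [hρ.integral_eq] at this
  simp only [ENNReal.ofReal_one] at this
  rw [this]
  refine lintegral_congr fun z => ?_
  rw [Real.enorm_of_nonneg (hρ.nonneg z)]

/-- Jensen's inequality for the probability weight `w`: Cauchy–Schwarz applied to `w^{1/2}` and
`w^{1/2} h`. -/
theorem lintegral_mul_sq_le {α : Type*} [MeasurableSpace α] {μ : Measure α} {w h : α → ℝ≥0∞}
    (hw : AEMeasurable w μ) (hh : AEMeasurable h μ) (h1 : ∫⁻ z, w z ∂μ = 1) :
    (∫⁻ z, w z * h z ∂μ) ^ 2 ≤ ∫⁻ z, w z * h z ^ 2 ∂μ := by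
  have hH := ENNReal.lintegral_mul_le_Lp_mul_Lq μ Real.HolderConjugate.two_two
    (hw.pow_const (1 / 2 : ℝ)) ((hw.pow_const (1 / 2 : ℝ)).mul hh)
  have e1 : ∀ z, (w z ^ (1 / 2 : ℝ)) * (w z ^ (1 / 2 : ℝ)) = w z := fun z => by
    rw [← ENNReal.rpow_add_of_nonneg _ _ (by norm_num) (by norm_num)]; norm_num
  have e2 : ∀ z, (w z ^ (1 / 2 : ℝ)) ^ (2 : ℝ) = w z := fun z => by
    rw [← ENNReal.rpow_mul]; norm_num
  have e3 : ∀ z, (w z ^ (1 / 2 : ℝ) * h z) ^ (2 : ℝ) = w z * h z ^ 2 := fun z => by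
    rw [ENNReal.mul_rpow_of_nonneg _ _ (by norm_num), e2]; norm_num
  simp only [Pi.mul_apply, ← mul_assoc, e1, e2, e3, h1, ENNReal.one_rpow, one_mul] at hH
  calc _ ≤ ((∫⁻ z, w z * h z ^ 2 ∂μ) ^ (1 / 2 : ℝ)) ^ 2 := pow_le_pow_left' hH 2
    _ = _ := by
      rw [← ENNReal.rpow_natCast, ← ENNReal.rpow_mul]; norm_num

/-- As `ρ` has integral one, the error is the `ρ`-average of `f (x - z) - f x`, and Jensen's
inequality applies. -/
theorem IsMollifier.enorm_mol_sub_sq_le [CompleteSpace F] {ρ : Eu d → ℝ} (hρ : IsMollifier ρ)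
    {f : Eu d → F} (hf : MemLp f 2 volume) (x : Eu d) :
    ‖mol ρ f x - f x‖ₑ ^ 2 ≤ ∫⁻ z, ‖ρ z‖ₑ * ‖f (x - z) - f x‖ₑ ^ 2 := by
  have hl : LocallyIntegrable f volume := hf.locallyIntegrable (by norm_num)
  have hi : Integrable ρ := hρ.contDiff.continuous.integrable_of_hasCompactSupport hρ.compact
  have e : mol ρ f x - f x = ∫ z, ρ z • (f (x - z) - f x) := by
    simp only [smul_sub]
    rw [integral_sub (hρ.integrable_smul hl x) (hi.smul_const _), integral_smul_const,
      hρ.integral_eq, one_smul, mol]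
  rw [e]
  refine (pow_le_pow_left' (enorm_integral_le_lintegral_enorm _) 2).trans ?_
  simp only [enorm_smul]
  refine lintegral_mul_sq_le hρ.contDiff.continuous.enorm.aemeasurable ?_ hρ.lintegral_eq
  have hm : AEStronglyMeasurable (fun z => f (x - z)) volume :=
    hf.1.comp_quasiMeasurePreserving (quasiMeasurePreserving_sub_left _ x)
  exact (hm.sub aestronglyMeasurable_const).enorm

/-- Mollification with shrinking supports converges in `L²`. -/
theorem tendsto_mol [CompleteSpace F] {ρ : ℕ → Eu d → ℝ} (hρ : ∀ n, IsMollifier (ρ n))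
    {δ : ℕ → ℝ} (hδ : Tendsto δ atTop (𝓝 0)) (hs : ∀ n z, ρ n z ≠ 0 → ‖z‖ ≤ δ n)
    {f : Eu d → F} (hf : MemLp f 2 volume) :
    Tendsto (fun n => l2Sq univ (fun x => mol (ρ n) f x - f x)) atTop (𝓝 0) := by
  -- Only the size of `z` on the support enters, not any symmetry about the origin. Bumps with
  -- displaced centres are therefore admissible, as `EpiChart.wg_refl` requires.
  rw [ENNReal.tendsto_nhds_zero]
  intro ε hε
  obtain ⟨η, hη, h⟩ := exists_translation_lt hf hε
  filter_upwards [hδ.eventually_lt_const hη] with n hn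
  have hm : AEMeasurable (fun p : Eu d × Eu d => ‖ρ n p.2‖ₑ * ‖f (p.1 - p.2) - f p.1‖ₑ ^ 2)
      (volume.prod volume) := by
    have h1 : AEStronglyMeasurable (fun p : Eu d × Eu d => f (p.1 - p.2)) (volume.prod volume) :=
      hf.1.comp_quasiMeasurePreserving (quasiMeasurePreserving_sub _ _)
    have h2 := (h1.sub hf.1.comp_fst).enorm.pow_const 2
    exact (((hρ n).contDiff.continuous.comp continuous_snd).enorm.aemeasurable).mul h2
  calc l2Sq univ (fun x => mol (ρ n) f x - f x)
      ≤ ∫⁻ x, ∫⁻ z, ‖ρ n z‖ₑ * ‖f (x - z) - f x‖ₑ ^ 2 := by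
        rw [l2Sq, Measure.restrict_univ]
        exact lintegral_mono fun x => (hρ n).enorm_mol_sub_sq_le hf x
    _ = ∫⁻ z, ∫⁻ x, ‖ρ n z‖ₑ * ‖f (x - z) - f x‖ₑ ^ 2 := lintegral_lintegral_swap hm
    _ ≤ ∫⁻ z, ‖ρ n z‖ₑ * ε := by
        refine lintegral_mono fun z => ?_
        by_cases hz : ρ n z = 0
        · simp [hz]
        · rw [lintegral_const_mul' _ _ enorm_ne_top]
          gcongr
          exact h z ((hs n z hz).trans hn.le)
    _ = ε := by
        rw [lintegral_mul_const _ (hρ n).contDiff.continuous.enorm.measurable,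
          (hρ n).lintegral_eq, one_mul]

/-! ### Weak gradients under mollification. -/

/-- `g` is the weak gradient of `f` on `U`, for functions instead of classes. -/
def WG (U : Set (Eu d)) (f : Eu d → ℝ) (g : Eu d → Eu d) : Prop :=
  ∀ φ : Eu d → ℝ, ContDiff ℝ ∞ φ → HasCompactSupport φ → tsupport φ ⊆ U → ∀ i : Fin d,
    ∫ x in U, f x * fderiv ℝ φ x (EuclideanSpace.single i 1) = - ∫ x in U, g x i * φ x

theorem mol_apply {ρ : Eu d → ℝ} (hρ : IsMollifier ρ) {g : Eu d → Eu d}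
    (hg : LocallyIntegrable g volume) (x : Eu d) (i : Fin d) :
    mol ρ g x i = ∫ z, ρ (x - z) * g z i := by
  have h1 : Integrable (fun z => ρ (x - z) • g z) := by
    have := hρ.compact.convolutionExists_right
      (ContinuousLinearMap.lsmul ℝ ℝ : ℝ →L[ℝ] Eu d →L[ℝ] Eu d).flip hg hρ.contDiff.continuous x
    exact this.integrable
  rw [mol_eq]
  have := (EuclideanSpace.proj (𝕜 := ℝ) i : Eu d →L[ℝ] ℝ).integral_comp_comm h1
  simpa using this.symm

/-- Where the shifted support of the mollifier stays inside `U`, the mollification is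
differentiable and its gradient is the mollification of the weak gradient. -/
theorem WG.hasFDerivAt_mol {U : Set (Eu d)} (hU : MeasurableSet U) {f : Eu d → ℝ} {g : Eu d → Eu d}
    (hf : MemLp f 2 (volume.restrict U)) (hg : MemLp g 2 (volume.restrict U)) (h : WG U f g)
    {ρ : Eu d → ℝ} (hρ : IsMollifier ρ) {x : Eu d} (hx : ∀ z ∈ tsupport ρ, x - z ∈ U) :
    HasFDerivAt (mol ρ (U.indicator f)) (innerSL ℝ (mol ρ (U.indicator g) x)) x := by
  have hl : LocallyIntegrable (U.indicator f) volume :=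
    (memLp_indicator hU hf).locallyIntegrable (by norm_num)
  have hlg : LocallyIntegrable (U.indicator g) volume :=
    (memLp_indicator hU hg).locallyIntegrable (by norm_num)
  have key := hρ.compact.hasFDerivAt_convolution_right
    (ContinuousLinearMap.lsmul ℝ ℝ : ℝ →L[ℝ] ℝ →L[ℝ] ℝ).flip hl (hρ.contDiff.of_le (by simp)) x
  rw [← mol_eq_convolution] at key
  have hcf : Continuous (fderiv ℝ ρ) := hρ.contDiff.continuous_fderiv (by simp)
  have hL : innerSL ℝ (mol ρ (U.indicator g) x) = convolution (U.indicator f) (fderiv ℝ ρ)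
      (ContinuousLinearMap.precompR (Eu d)
        (ContinuousLinearMap.lsmul ℝ ℝ : ℝ →L[ℝ] ℝ →L[ℝ] ℝ).flip) volume x := by
    refine ContinuousLinearMap.coe_injective
      ((EuclideanSpace.basisFun (Fin d) ℝ).toBasis.ext fun i => ?_)
    -- The weak gradient is tested with `z ↦ ρ (x - z)`, supported in `U` by `hx`. The inner
    -- reflection gives the minus sign that cancels the one in the definition of `WG`.
    have hφ : ContDiff ℝ ∞ fun z => ρ (x - z) := hρ.contDiff.comp (contDiff_const.sub contDiff_id)
    have hφc : HasCompactSupport fun z => ρ (x - z) :=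
      hρ.compact.comp_homeomorph (Homeomorph.subLeft x)
    have hφs : tsupport (fun z => ρ (x - z)) ⊆ U := by
      intro z hz
      have : x - z ∈ tsupport ρ :=
        tsupport_comp_subset_preimage ρ (f := fun z => x - z) (by fun_prop) hz
      simpa using hx _ this
    have hd : ∀ z, fderiv ℝ (fun z => ρ (x - z)) z (EuclideanSpace.single i 1)
        = - fderiv ℝ ρ (x - z) (EuclideanSpace.single i 1) := fun z => by
      have h1 : HasFDerivAt ρ (fderiv ℝ ρ (x - z)) (x - z) :=
        (hρ.contDiff.differentiable (by simp) _).hasFDerivAt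
      have : HasFDerivAt (fun z => ρ (x - z)) _ z := h1.comp z ((hasFDerivAt_id z).const_sub x)
      rw [this.fderiv]
      simp
    have := h _ hφ hφc hφs i
    simp only [hd, mul_neg, integral_neg, neg_inj] at this
    simp only [OrthonormalBasis.coe_toBasis, EuclideanSpace.basisFun_apply,
      ContinuousLinearMap.coe_coe, innerSL_apply_apply]
    rw [convolution_precompR_apply _ hl (hρ.compact.fderiv ℝ) hcf, convolution_def,
      EuclideanSpace.inner_single_right]
    simp only [conj_trivial, one_mul, ContinuousLinearMap.flip_apply,
      ContinuousLinearMap.lsmul_apply, smul_eq_mul]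
    rw [mol_apply hρ hlg]
    have e1 : ∀ z, ρ (x - z) * U.indicator g z i = U.indicator (fun z => g z i * ρ (x - z)) z := by
      intro z
      by_cases hz : z ∈ U <;> simp [hz, mul_comm]
    have e2 : ∀ z, fderiv ℝ ρ (x - z) (EuclideanSpace.single i 1) * U.indicator f z
        = U.indicator (fun z => f z * fderiv ℝ ρ (x - z) (EuclideanSpace.single i 1)) z := by
      intro z
      by_cases hz : z ∈ U <;> simp [hz, mul_comm]
    simp only [e1, e2]
    rw [integral_indicator hU, integral_indicator hU, this]
  rwa [hL]

end FracExt
end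
-- The translation estimate and the integrable kernel.
noncomputable section
namespace FracExt
open Filter Topology

variable {d : ℕ}

theorem exists_mollifier (c : Eu d) {ε : ℝ} (hε : 0 < ε) :
    ∃ ρ : Eu d → ℝ, IsMollifier ρ ∧ tsupport ρ ⊆ closedBall c ε := by
  let b : ContDiffBump c := ⟨ε / 2, ε, by positivity, by linarith⟩
  exact ⟨b.normed volume, ⟨b.contDiff_normed, b.nonneg_normed, b.integral_normed,
    b.hasCompactSupport_normed⟩, b.tsupport_normed_eq.subset⟩

theorem l2Sq_univ {F : Type*} [NormedAddCommGroup F] (f : Eu d → F) :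
    l2Sq univ f = ∫⁻ x, ‖f x‖ₑ ^ 2 := by
  rw [l2Sq, Measure.restrict_univ]

theorem l2Sq_indicator {F : Type*} [NormedAddCommGroup F] {U : Set (Eu d)} (hU : MeasurableSet U)
    (f : Eu d → F) : l2Sq univ (U.indicator f) = l2Sq U f := by
  rw [l2Sq_univ, l2Sq, ← lintegral_indicator hU]
  refine lintegral_congr fun x => ?_
  by_cases hx : x ∈ U <;> simp [hx]

/-- The fundamental theorem of calculus along the segment, followed by Cauchy–Schwarz in the
parameter `t`. -/
theorem enorm_sub_sq_le_lintegral_segment {u : Eu d → ℝ} {w : Eu d → Eu d} {x v : Eu d}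
    (hw : Continuous w)
    (hu : ∀ t ∈ Icc (0 : ℝ) 1, HasFDerivAt u (innerSL ℝ (w (x + t • v))) (x + t • v)) :
    ‖u (x + v) - u x‖ₑ ^ 2 ≤ ‖v‖ₑ ^ 2 * ∫⁻ t in Ioc (0 : ℝ) 1, ‖w (x + t • v)‖ₑ ^ 2 := by
  have hd : ∀ t ∈ uIcc (0 : ℝ) 1,
      HasDerivAt (fun t : ℝ => u (x + t • v)) ⟪w (x + t • v), v⟫ t := by
    intro t ht
    rw [uIcc_of_le zero_le_one] at ht
    have h1 : HasDerivAt (fun t : ℝ => x + t • v) v t := by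
      simpa using ((hasDerivAt_id t).smul_const v).const_add x
    exact (hu t ht).comp_hasDerivAt t h1
  have hc : Continuous fun t : ℝ => ⟪w (x + t • v), v⟫ := by fun_prop
  have hi := intervalIntegral.integral_eq_sub_of_hasDerivAt hd (hc.intervalIntegrable 0 1)
  simp only [one_smul, zero_smul, add_zero] at hi
  rw [← hi, intervalIntegral.integral_of_le zero_le_one]
  refine (pow_le_pow_left' (enorm_integral_le_lintegral_enorm _) 2).trans ?_
  have h2 : (∫⁻ t in Ioc (0 : ℝ) 1, ‖⟪w (x + t • v), v⟫‖ₑ) ^ 2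
      ≤ ∫⁻ t in Ioc (0 : ℝ) 1, ‖⟪w (x + t • v), v⟫‖ₑ ^ 2 := by
    have := lintegral_mul_sq_le (μ := volume.restrict (Ioc (0 : ℝ) 1)) (w := fun _ => 1)
      (h := fun t => ‖⟪w (x + t • v), v⟫‖ₑ) aemeasurable_const hc.enorm.aemeasurable (by simp)
    simpa using this
  refine h2.trans ?_
  rw [← lintegral_const_mul' _ _ (by finiteness)]
  refine lintegral_mono fun t => ?_
  rw [← mul_pow]
  refine pow_le_pow_left' ?_ 2
  rw [← ofReal_norm, ← ofReal_norm, ← ofReal_norm, ← ENNReal.ofReal_mul (norm_nonneg _), mul_comm]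
  exact ENNReal.ofReal_le_ofReal (norm_inner_le_norm _ _)

/-- After integrating in `x` and exchanging the order, each `t` contributes a translate of `w`,
whose integral over the whole space does not depend on `t`. Differentiability of `u` is needed only
on the segments issuing from `B`, so local information suffices. -/
theorem lintegral_translation_le {B : Set (Eu d)} (hB : MeasurableSet B) {u : Eu d → ℝ}
    {w : Eu d → Eu d} {v : Eu d} (hw : Continuous w)
    (hu : ∀ x ∈ B, ∀ t ∈ Icc (0 : ℝ) 1,
      HasFDerivAt u (innerSL ℝ (w (x + t • v))) (x + t • v)) :
    l2Sq B (fun x => u (x + v) - u x) ≤ ‖v‖ₑ ^ 2 * l2Sq univ w := by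
  calc l2Sq B (fun x => u (x + v) - u x)
      ≤ ∫⁻ x in B, ‖v‖ₑ ^ 2 * ∫⁻ t in Ioc (0 : ℝ) 1, ‖w (x + t • v)‖ₑ ^ 2 :=
        setLIntegral_mono' hB fun x hx => enorm_sub_sq_le_lintegral_segment hw (hu x hx)
    _ ≤ ∫⁻ x, ‖v‖ₑ ^ 2 * ∫⁻ t in Ioc (0 : ℝ) 1, ‖w (x + t • v)‖ₑ ^ 2 :=
        setLIntegral_le_lintegral _ _
    _ = ‖v‖ₑ ^ 2 * ∫⁻ t in Ioc (0 : ℝ) 1, ∫⁻ x, ‖w (x + t • v)‖ₑ ^ 2 := by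
        rw [lintegral_const_mul' _ _ (by finiteness), lintegral_lintegral_swap]
        have : Continuous fun p : Eu d × ℝ => ‖w (p.1 + p.2 • v)‖ₑ ^ 2 := by fun_prop
        exact this.measurable.aemeasurable
    _ = _ := by
        congr 1
        have : ∀ t : ℝ, ∫⁻ x, ‖w (x + t • v)‖ₑ ^ 2 = l2Sq univ w := fun t => by
          rw [l2Sq_univ, lintegral_add_right_eq_self (fun x => ‖w x‖ₑ ^ 2)]
        simp [this]

theorem eLpNorm_eq_rpow_l2Sq {F : Type*} [NormedAddCommGroup F] (U : Set (Eu d)) (f : Eu d → F) :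
    eLpNorm f 2 (volume.restrict U) = l2Sq U f ^ (1 / 2 : ℝ) := by
  rw [l2Sq_eq, ← ENNReal.rpow_natCast, ← ENNReal.rpow_mul]; norm_num

/-- A function with weak gradient `g ∈ L²(U)` satisfies the translation estimate. -/
theorem WG.translation_le {U B : Set (Eu d)} (hU : IsOpen U) (hB : MeasurableSet B) {f : Eu d → ℝ}
    {g : Eu d → Eu d} (hf : MemLp f 2 (volume.restrict U)) (hg : MemLp g 2 (volume.restrict U))
    (h : WG U f g) {η : ℝ} (hη : 0 < η) {v : Eu d}
    (hx : ∀ x ∈ B, ∀ t ∈ Icc (0 : ℝ) 1, closedBall (x + t • v) η ⊆ U) :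
    l2Sq B (fun x => f (x + v) - f x) ≤ ‖v‖ₑ ^ 2 * l2Sq U g := by
  -- The supports have radius at most `η`, so by `hx` the mollifications are differentiable along
  -- every segment issuing from `B`.
  have hpos : ∀ n : ℕ, 0 < η / (n + 1) := fun n => by positivity
  choose ρ hρ hρs using fun n : ℕ => exists_mollifier (0 : Eu d) (hpos n)
  have hle : ∀ n z, z ∈ tsupport (ρ n) → ‖z‖ ≤ η / (n + 1) := fun n z hz => by
    simpa using hρs n hz
  have hδ : Tendsto (fun n : ℕ => η / ((n : ℝ) + 1)) atTop (𝓝 0) := by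
    have := (tendsto_one_div_add_atTop_nhds_zero_nat (𝕜 := ℝ)).const_mul η
    rw [mul_zero] at this
    exact this.congr fun n => by ring
  have hF := memLp_indicator hU.measurableSet hf
  have hG := memLp_indicator hU.measurableSet hg
  have hlg : LocallyIntegrable (U.indicator g) volume := hG.locallyIntegrable (by norm_num)
  have hlf : LocallyIntegrable (U.indicator f) volume := hF.locallyIntegrable (by norm_num)
  have ta := tendsto_mol hρ hδ (fun n z hz => hle n z (subset_tsupport _ hz)) hF
  have tb := tendsto_mol hρ hδ (fun n z hz => hle n z (subset_tsupport _ hz)) hG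
  set a : ℕ → ℝ≥0∞ := fun n => eLpNorm (fun x => mol (ρ n) (U.indicator f) x - U.indicator f x) 2
    volume with ha
  set b : ℕ → ℝ≥0∞ := fun n => eLpNorm (fun x => mol (ρ n) (U.indicator g) x - U.indicator g x) 2
    volume with hb
  have ta' : Tendsto a atTop (𝓝 0) := by
    have := (ENNReal.continuous_rpow_const (y := (1 / 2 : ℝ))).tendsto 0 |>.comp ta
    rw [ENNReal.zero_rpow_of_pos (by norm_num)] at this
    refine this.congr fun n => ?_
    simp only [Function.comp, ← eLpNorm_eq_rpow_l2Sq, Measure.restrict_univ, ha]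
  have tb' : Tendsto b atTop (𝓝 0) := by
    have := (ENNReal.continuous_rpow_const (y := (1 / 2 : ℝ))).tendsto 0 |>.comp tb
    rw [ENNReal.zero_rpow_of_pos (by norm_num)] at this
    refine this.congr fun n => ?_
    simp only [Function.comp, ← eLpNorm_eq_rpow_l2Sq, Measure.restrict_univ, hb]
  -- Replacing `f` by its mollification at the two endpoints costs `a n` twice. The mollified
  -- gradient exceeds `g` in norm by at most `b n`. Both errors vanish in the limit.
  have key : ∀ n, eLpNorm (fun x => f (x + v) - f x) 2 (volume.restrict B)
      ≤ (a n + ‖v‖ₑ * (b n + eLpNorm (U.indicator g) 2 volume)) + a n := by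
    intro n
    have hin : ∀ x ∈ B, ∀ t ∈ Icc (0 : ℝ) 1, ∀ z ∈ tsupport (ρ n), x + t • v - z ∈ U := by
      intro x hxB t ht z hz
      refine hx x hxB t ht ?_
      rw [mem_closedBall, dist_eq_norm]
      have h1 := hle n z hz
      have h2 : η / ((n : ℝ) + 1) ≤ η := div_le_self hη.le (by linarith [n.cast_nonneg (α := ℝ)])
      have : x + t • v - z - (x + t • v) = -z := by abel
      rw [this, norm_neg]
      linarith
    have hcf := (hρ n).continuous_mol hlf
    have hcg := (hρ n).continuous_mol hlg
    set u := mol (ρ n) (U.indicator f)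
    set w := mol (ρ n) (U.indicator g)
    have hs : l2Sq B (fun x => u (x + v) - u x) ≤ ‖v‖ₑ ^ 2 * l2Sq univ w :=
      lintegral_translation_le hB hcg fun x hxB t ht =>
        h.hasFDerivAt_mol hU.measurableSet hf hg (hρ n) (hin x hxB t ht)
    have hs' : eLpNorm (fun x => u (x + v) - u x) 2 (volume.restrict B)
        ≤ ‖v‖ₑ * eLpNorm w 2 volume := by
      have := ENNReal.rpow_le_rpow hs (z := 1 / 2) (by norm_num)
      rw [← eLpNorm_eq_rpow_l2Sq, ENNReal.mul_rpow_of_nonneg _ _ (by norm_num),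
        ← eLpNorm_eq_rpow_l2Sq, ← ENNReal.rpow_natCast, ← ENNReal.rpow_mul,
        Measure.restrict_univ] at this
      norm_num at this
      exact this
    have hw : eLpNorm w 2 volume ≤ b n + eLpNorm (U.indicator g) 2 volume := by
      have e : w = (fun x => w x - U.indicator g x) + U.indicator g := by ext1 x; simp
      conv_lhs => rw [e]
      exact eLpNorm_add_le (hcg.aestronglyMeasurable.sub hG.1) hG.1 (by norm_num)
    have hinU : ∀ x ∈ B, x ∈ U ∧ x + v ∈ U := fun x hxB =>
      ⟨hx x hxB 0 (by simp) (by simp [hη.le]),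
        hx x hxB 1 (by simp) (by simp [hη.le])⟩
    have hUf : ∀ x ∈ B, f (x + v) - f x
        = ((U.indicator f (x + v) - u (x + v)) + (u (x + v) - u x)) + (u x - U.indicator f x) := by
      intro x hxB
      rw [indicator_of_mem (hinU x hxB).1, indicator_of_mem (hinU x hxB).2]; ring
    have m1 : AEStronglyMeasurable (fun x => U.indicator f (x + v) - u (x + v)) volume :=
      (hF.1.sub hcf.aestronglyMeasurable).comp_measurePreserving (measurePreserving_add_right _ v)
    have m2 : AEStronglyMeasurable (fun x => u (x + v) - u x) volume := by fun_prop
    have m3 : AEStronglyMeasurable (fun x => u x - U.indicator f x) volume :=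
      hcf.aestronglyMeasurable.sub hF.1
    have c1 : eLpNorm (fun x => U.indicator f (x + v) - u (x + v)) 2 volume = a n := by
      rw [ha]
      have := eLpNorm_comp_measurePreserving (p := 2) (hF.1.sub hcf.aestronglyMeasurable)
        (measurePreserving_add_right volume v)
      refine this.trans ?_
      exact eLpNorm_sub_comm _ _ _ _
    calc eLpNorm (fun x => f (x + v) - f x) 2 (volume.restrict B)
        = eLpNorm (((fun x => U.indicator f (x + v) - u (x + v)) + (fun x => u (x + v) - u x))
            + (fun x => u x - U.indicator f x)) 2 (volume.restrict B) :=
          eLpNorm_congr_ae ((ae_restrict_iff' hB).2 (Eventually.of_forall hUf))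
      _ ≤ (eLpNorm (fun x => U.indicator f (x + v) - u (x + v)) 2 (volume.restrict B)
          + eLpNorm (fun x => u (x + v) - u x) 2 (volume.restrict B))
          + eLpNorm (fun x => u x - U.indicator f x) 2 (volume.restrict B) := by
          refine (eLpNorm_add_le (m1.add m2).restrict m3.restrict (by norm_num)).trans ?_
          gcongr
          exact eLpNorm_add_le m1.restrict m2.restrict (by norm_num)
      _ ≤ _ := by
          gcongr
          · exact (eLpNorm_mono_measure _ Measure.restrict_le_self).trans c1.le
          · exact hs'.trans (by gcongr)
          · exact eLpNorm_mono_measure _ Measure.restrict_le_self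
  have hlim : Tendsto (fun n => (a n + ‖v‖ₑ * (b n + eLpNorm (U.indicator g) 2 volume)) + a n)
      atTop (𝓝 ((0 + ‖v‖ₑ * (0 + eLpNorm (U.indicator g) 2 volume)) + 0)) :=
    (ta'.add (ENNReal.Tendsto.const_mul (tb'.add tendsto_const_nhds) (.inr enorm_ne_top))).add ta'
  have := ge_of_tendsto' hlim key
  rw [zero_add, zero_add, add_zero] at this
  rw [l2Sq_eq, ← l2Sq_indicator hU.measurableSet, l2Sq_eq, ← mul_pow, Measure.restrict_univ]
  exact pow_le_pow_left' this 2

/-- In polar coordinates the radial integrand is `r^{1-2s}` on `(0, 1]`, integrable because `s < 1`,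
and `r^{-1-2s}` beyond, integrable because `s > 0`. -/
theorem lintegral_kernel_lt_top (hd : 1 ≤ d) {s : ℝ} (hs0 : 0 < s) (hs1 : s < 1) :
    ∫⁻ z : Eu d, min 1 (‖z‖ₑ ^ 2) / ‖z‖ₑ ^ ((d : ℝ) + 2 * s) < ⊤ := by
  have : Nontrivial (Eu d) := by
    have : Nonempty (Fin d) := ⟨⟨0, hd⟩⟩
    infer_instance
  let k : ℝ → ℝ := fun r => min 1 (r ^ 2) * r ^ (-((d : ℝ) + 2 * s))
  have hI : Integrable (fun z : Eu d => k ‖z‖) volume := by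
    rw [integrable_fun_norm_addHaar, finrank_euclideanSpace_fin]
    have hpw : ∀ r : ℝ, 0 < r → r ^ (d - 1) = r ^ ((d : ℝ) - 1) := fun r hr => by
      rw [← Real.rpow_natCast, Nat.cast_sub hd, Nat.cast_one]
    rw [← Ioc_union_Ioi_eq_Ioi (zero_le_one (α := ℝ)), integrableOn_union]
    constructor
    · have h1 : IntegrableOn (fun r : ℝ => r ^ (1 - 2 * s)) (Ioc 0 1) := by
        rw [← intervalIntegrable_iff_integrableOn_Ioc_of_le zero_le_one]
        exact intervalIntegral.intervalIntegrable_rpow' (by linarith)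
      refine h1.congr_fun (fun r hr => ?_) measurableSet_Ioc
      have hr2 : r ^ 2 ≤ 1 := pow_le_one₀ hr.1.le hr.2
      simp only [k, min_eq_right hr2, smul_eq_mul]
      rw [hpw r hr.1, ← Real.rpow_natCast r 2, ← Real.rpow_add hr.1, ← Real.rpow_add hr.1]
      congr 1; push_cast; ring
    · have h1 : IntegrableOn (fun r : ℝ => r ^ (-1 - 2 * s)) (Ioi 1) :=
        integrableOn_Ioi_rpow_of_lt (by linarith) one_pos
      refine h1.congr_fun (fun r hr => ?_) measurableSet_Ioi
      have hr0 : (0 : ℝ) < r := one_pos.trans hr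
      have hr2 : 1 ≤ r ^ 2 := one_le_pow₀ (le_of_lt hr)
      simp only [k, min_eq_left hr2, smul_eq_mul, one_mul]
      rw [hpw r hr0, ← Real.rpow_add hr0]
      congr 1; ring
  refine lt_of_le_of_lt (lintegral_mono fun z => ?_) hI.2
  by_cases hz : z = 0
  · simp [hz]
  have hz0 : 0 < ‖z‖ := norm_pos_iff.2 hz
  have e : ENNReal.ofReal (k ‖z‖) = ‖k ‖z‖‖ₑ := by
    rw [Real.enorm_of_nonneg]
    positivity
  rw [← e]
  simp only [k]
  rw [ENNReal.ofReal_mul (by positivity), Real.rpow_neg hz0.le,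
    ENNReal.ofReal_inv_of_pos (by positivity), ← ENNReal.ofReal_rpow_of_pos hz0, ofReal_norm,
    ENNReal.ofReal_min, ENNReal.ofReal_pow hz0.le, ofReal_norm, ENNReal.ofReal_one, div_eq_mul_inv]

end FracExt
end
-- The embedding of `H¹` into `H^s` and multiplication by a scalar function.
noncomputable section
namespace FracExt
open Filter Topology

variable {d : ℕ} {F : Type*} [NormedAddCommGroup F]

/-- The Gagliardo integral over `A × B`. -/
def gagOn (s : ℝ) (A B : Set (Eu d)) (g : Eu d → F) : ℝ≥0∞ :=
  ∫⁻ x in A, ∫⁻ y in B, ‖g x - g y‖ₑ ^ 2 / ‖x - y‖ₑ ^ ((d : ℝ) + 2 * s)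

/-- The truncated singular kernel. -/
def kern (s : ℝ) (z : Eu d) : ℝ≥0∞ := min 1 (‖z‖ₑ ^ 2) / ‖z‖ₑ ^ ((d : ℝ) + 2 * s)

theorem measurable_kern (s : ℝ) : Measurable (kern (d := d) s) := by
  unfold kern; fun_prop

theorem aestronglyMeasurable_comp_add {w : Eu d → F} (hw : AEStronglyMeasurable w volume) :
    AEStronglyMeasurable (fun p : Eu d × Eu d => w (p.1 + p.2)) (volume.prod volume) :=
  hw.comp_quasiMeasurePreserving (quasiMeasurePreserving_add _ _)

/-- `H¹(ℝ^d)` embeds into `H^s(ℝ^d)`. -/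
theorem WG.gagOn_le (s : ℝ) {w : Eu d → ℝ} {v : Eu d → Eu d}
    (hw : MemLp w 2 (volume.restrict univ)) (hv : MemLp v 2 (volume.restrict univ))
    (h : WG univ w v) :
    gagOn s univ univ w
      ≤ (∫⁻ z : Eu d, kern s z) * (4 * l2Sq univ w + l2Sq univ v) := by
  have hw' : AEStronglyMeasurable w volume := by simpa using hw.1
  have hm : AEMeasurable (fun p : Eu d × Eu d =>
      ‖w p.1 - w (p.1 + p.2)‖ₑ ^ 2 / ‖p.2‖ₑ ^ ((d : ℝ) + 2 * s)) (volume.prod volume) :=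
    (((hw'.comp_fst).sub (aestronglyMeasurable_comp_add hw')).enorm.pow_const 2).div (by fun_prop)
  -- Large translations are bounded by the triangle inequality, small ones by the translation
  -- estimate. The better of the two produces the truncation in `kern`.
  have hb : ∀ z : Eu d, l2Sq univ (fun x => w x - w (x + z))
      ≤ min 1 (‖z‖ₑ ^ 2) * (4 * l2Sq univ w + l2Sq univ v) := by
    intro z
    have h1 : l2Sq univ (fun x => w x - w (x + z)) ≤ ‖z‖ₑ ^ 2 * l2Sq univ v := by
      have := h.translation_le isOpen_univ MeasurableSet.univ hw hv one_pos (v := z)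
        (fun _ _ _ _ => subset_univ _)
      refine le_trans (le_of_eq ?_) this
      simp only [l2Sq, enorm_sub_rev]
    have h2 : l2Sq univ (fun x => w x - w (x + z)) ≤ 4 * l2Sq univ w := by
      have : l2Sq univ (fun x => w (x + z)) = l2Sq univ w := by
        rw [l2Sq_univ, l2Sq_univ, lintegral_add_right_eq_self (fun x => ‖w x‖ₑ ^ 2)]
      calc l2Sq univ (fun x => w x - w (x + z))
          ≤ ∫⁻ x, 2 * (‖w x‖ₑ ^ 2 + ‖w (x + z)‖ₑ ^ 2) := by
            rw [l2Sq_univ]; exact lintegral_mono fun x => enorm_sub_sq_le _ _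
        _ = 2 * (l2Sq univ w + l2Sq univ w) := by
            rw [lintegral_const_mul' _ _ (by norm_num),
              lintegral_add_left' (hw'.enorm.pow_const 2), ← l2Sq_univ,
              ← l2Sq_univ (fun x => w (x + z)), this]
        _ = 4 * l2Sq univ w := by ring
    rcases le_total 1 (‖z‖ₑ ^ 2) with hz | hz
    · rw [min_eq_left hz, one_mul]
      exact h2.trans le_self_add
    · rw [min_eq_right hz]
      exact h1.trans (by gcongr; exact le_add_self)
  calc gagOn s univ univ w
      = ∫⁻ x, ∫⁻ z, ‖w x - w (x + z)‖ₑ ^ 2 / ‖z‖ₑ ^ ((d : ℝ) + 2 * s) := by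
        rw [gagOn, Measure.restrict_univ]
        refine lintegral_congr fun x => ?_
        rw [← lintegral_add_left_eq_self _ x]
        simp
    _ = ∫⁻ z, ∫⁻ x, ‖w x - w (x + z)‖ₑ ^ 2 / ‖z‖ₑ ^ ((d : ℝ) + 2 * s) :=
        lintegral_lintegral_swap hm
    _ = ∫⁻ z, l2Sq univ (fun x => w x - w (x + z)) / ‖z‖ₑ ^ ((d : ℝ) + 2 * s) := by
        refine lintegral_congr fun z => ?_
        have m : AEMeasurable (fun x => ‖w x - w (x + z)‖ₑ ^ 2) volume :=
          ((hw'.sub (hw'.comp_measurePreserving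
            (measurePreserving_add_right _ z))).enorm.pow_const 2)
        simp only [div_eq_mul_inv]
        rw [lintegral_mul_const'' _ m, ← l2Sq_univ]
    _ ≤ ∫⁻ z : Eu d, kern s z * (4 * l2Sq univ w + l2Sq univ v) := by
        refine lintegral_mono fun z => ?_
        rw [kern, ← ENNReal.mul_div_right_comm]
        exact ENNReal.div_le_div_right (hb z) _
    _ = _ := lintegral_mul_const _ (measurable_kern s)

theorem memLp_univ_of_bound {G : Type*} [NormedAddCommGroup G] {U : Set (Eu d)}
    (hU : MeasurableSet U) {u : Eu d → G} {h : Eu d → F} {M : ℝ≥0}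
    (hu : MemLp u 2 (volume.restrict U)) (hm : AEStronglyMeasurable h (volume.restrict U))
    (hb : ∀ x, ‖h x‖ ≤ M * ‖u x‖) (h0 : ∀ x ∉ U, h x = 0) :
    MemLp h 2 (volume.restrict univ) ∧ l2Sq univ h ≤ (M ^ 2 : ℝ≥0) * l2Sq U u := by
  have e : U.indicator h = h := by
    ext x; by_cases hx : x ∈ U <;> simp [hx, h0]
  constructor
  · rw [Measure.restrict_univ, ← e]
    exact memLp_indicator hU (hu.of_le_mul hm (Eventually.of_forall hb))
  · rw [← e, l2Sq_indicator hU, l2Sq, l2Sq, ← lintegral_const_mul' _ _ ENNReal.coe_ne_top]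
    refine lintegral_mono fun x => ?_
    rw [ENNReal.coe_pow, ← mul_pow]
    refine pow_le_pow_left' ?_ 2
    have h1 : ‖h x‖₊ ≤ M * ‖u x‖₊ := hb x
    rw [enorm_eq_nnnorm, enorm_eq_nnnorm, ← ENNReal.coe_mul]
    exact ENNReal.coe_le_coe.2 h1

variable [NormedSpace ℝ F]

/-- For two points of `U` the difference is `χ y • (v x - v y) + (χ x - χ y) • v x`. If one point
lies outside `U`, then `χ` vanishes there and only a term of the second kind is left. The first kind
is the seminorm on `U`; in the second, the bound on `χ x - χ y` turns the singular kernel into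
`kern`, which integrates out in one variable. -/
theorem gagOn_smul_le (s : ℝ) {U : Set (Eu d)} (hU : MeasurableSet U) {χ : Eu d → ℝ} {v : Eu d → F}
    {M : ℝ≥0} (hv : AEStronglyMeasurable v (volume.restrict U))
    (h0 : ∀ x ∉ U, χ x = 0) (hM : ∀ x, ‖χ x‖ₑ ≤ M)
    (hL : ∀ x y, ‖χ x - χ y‖ₑ ^ 2 ≤ M * min 1 (‖x - y‖ₑ ^ 2)) :
    gagOn s univ univ (fun x => χ x • v x)
      ≤ 2 * M ^ 2 * gagOn s U U v + 4 * M * (∫⁻ z : Eu d, kern s z) * l2Sq U v := by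
  set p : ℝ := (d : ℝ) + 2 * s with hp
  set V := U.indicator v with hV
  have hVm : AEStronglyMeasurable V volume := (aestronglyMeasurable_indicator_iff hU).2 hv
  have e : ∀ x, χ x • v x = χ x • V x := fun x => by
    by_cases hx : x ∈ U <;> simp [hV, hx, h0]
  -- `A` is the contribution of pairs in `U × U`, extended by zero. The two kernel terms of `hpt`
  -- are symmetric and cover the pairs with one point outside `U`.
  let A : Eu d → Eu d → ℝ≥0∞ := fun x y => U.indicator (fun x => U.indicator
    (fun y => 2 * M ^ 2 * (‖v x - v y‖ₑ ^ 2 / ‖x - y‖ₑ ^ p)) y) x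
  have hpt : ∀ x y, ‖χ x • v x - χ y • v y‖ₑ ^ 2 / ‖x - y‖ₑ ^ p
      ≤ A x y + (2 * M * kern s (x - y) * ‖V x‖ₑ ^ 2 + 2 * M * kern s (x - y) * ‖V y‖ₑ ^ 2) := by
    intro x y
    have hgen : ∀ a : F, ‖(χ x - χ y) • a‖ₑ ^ 2 / ‖x - y‖ₑ ^ p ≤ M * kern s (x - y) * ‖a‖ₑ ^ 2 := by
      intro a
      rw [enorm_smul, mul_pow, kern, ← hp, mul_right_comm, ← mul_div_assoc]
      gcongr ?_ / _
      calc _ ≤ (M * min 1 (‖x - y‖ₑ ^ 2)) * ‖a‖ₑ ^ 2 := by gcongr; exact hL x y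
        _ = _ := by ring
    by_cases hx : x ∈ U
    · have hVx : V x = v x := indicator_of_mem hx v
      refine le_trans ?_ (add_le_add_right le_self_add _)
      by_cases hy : y ∈ U
      · have hA : A x y = 2 * M ^ 2 * (‖v x - v y‖ₑ ^ 2 / ‖x - y‖ₑ ^ p) := by simp [A, hx, hy]
        have e1 : χ x • v x - χ y • v y = χ y • (v x - v y) + (χ x - χ y) • v x := by
          simp only [smul_sub, sub_smul]; abel
        have h1 : ‖χ y • (v x - v y)‖ₑ ^ 2 ≤ M ^ 2 * ‖v x - v y‖ₑ ^ 2 := by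
          rw [enorm_smul, mul_pow]; gcongr; exact hM y
        rw [e1, hA, hVx]
        calc _ ≤ (2 * (‖χ y • (v x - v y)‖ₑ ^ 2 + ‖(χ x - χ y) • v x‖ₑ ^ 2)) / ‖x - y‖ₑ ^ p :=
              ENNReal.div_le_div_right (enorm_add_sq_le _ _) _
          _ = 2 * (‖χ y • (v x - v y)‖ₑ ^ 2 / ‖x - y‖ₑ ^ p)
              + 2 * (‖(χ x - χ y) • v x‖ₑ ^ 2 / ‖x - y‖ₑ ^ p) := by
              rw [mul_add, ENNReal.add_div, mul_div_assoc, mul_div_assoc]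
          _ ≤ 2 * ((M ^ 2 * ‖v x - v y‖ₑ ^ 2) / ‖x - y‖ₑ ^ p)
              + 2 * (M * kern s (x - y) * ‖v x‖ₑ ^ 2) := by
              refine add_le_add ?_ ?_
              · gcongr
              · gcongr 2 * ?_
                exact hgen _
          _ = _ := by rw [mul_div_assoc]; ring
      · have e1 : χ x • v x - χ y • v y = (χ x - χ y) • v x := by simp [h0 y hy]
        rw [e1, hVx]
        refine (hgen _).trans (le_trans ?_ le_add_self)
        rw [mul_assoc 2, mul_assoc 2]
        exact le_mul_of_one_le_left' (by norm_num)
    · have hA : A x y = 0 := by simp [A, hx]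
      have hVx : V x = 0 := indicator_of_notMem hx v
      have e1 : χ x • v x - χ y • v y = (χ x - χ y) • V y := by
        rw [e, e, hVx, sub_smul, h0 x hx]; simp
      rw [e1, hA, hVx]
      refine (hgen _).trans ?_
      simp only [enorm_zero, ne_eq, OfNat.ofNat_ne_zero, not_false_eq_true, zero_pow, mul_zero,
        zero_add]
      rw [mul_assoc 2, mul_assoc 2]
      exact le_mul_of_one_le_left' (by norm_num)
  have mk : Measurable fun q : Eu d × Eu d => 2 * (M : ℝ≥0∞) * kern s (q.1 - q.2) :=
    ((measurable_kern s).comp (measurable_fst.sub measurable_snd)).const_mul _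
  have mB : AEMeasurable (fun q : Eu d × Eu d => 2 * (M : ℝ≥0∞) * kern s (q.1 - q.2) * ‖V q.1‖ₑ ^ 2)
      (volume.prod volume) := mk.aemeasurable.mul (hVm.comp_fst.enorm.pow_const 2)
  have mC : AEMeasurable (fun q : Eu d × Eu d => 2 * (M : ℝ≥0∞) * kern s (q.1 - q.2) * ‖V q.2‖ₑ ^ 2)
      (volume.prod volume) := mk.aemeasurable.mul (hVm.comp_snd.enorm.pow_const 2)
  have hV2 : l2Sq univ V = l2Sq U v := l2Sq_indicator hU v
  have iB : ∫⁻ x, ∫⁻ y, 2 * (M : ℝ≥0∞) * kern s (x - y) * ‖V x‖ₑ ^ 2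
      = 2 * M * (∫⁻ z : Eu d, kern s z) * l2Sq U v := by
    have : ∀ x : Eu d, ∫⁻ y, 2 * (M : ℝ≥0∞) * kern s (x - y) * ‖V x‖ₑ ^ 2
        = (2 * M * ∫⁻ z : Eu d, kern s z) * ‖V x‖ₑ ^ 2 := fun x => by
      rw [lintegral_mul_const' _ _ (by finiteness), lintegral_const_mul' _ _ (by finiteness),
        lintegral_sub_left_eq_self (fun z => kern s z) x]
    simp only [this]
    rw [lintegral_const_mul'' _ (hVm.enorm.pow_const 2), ← l2Sq_univ, hV2]
  have iC : ∫⁻ x, ∫⁻ y, 2 * (M : ℝ≥0∞) * kern s (x - y) * ‖V y‖ₑ ^ 2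
      = 2 * M * (∫⁻ z : Eu d, kern s z) * l2Sq U v := by
    rw [lintegral_lintegral_swap mC, ← iB]
    refine lintegral_congr fun x => lintegral_congr fun y => ?_
    congr 2
    simp only [kern, enorm_sub_rev]
  have iA : ∫⁻ x, ∫⁻ y, A x y = 2 * M ^ 2 * gagOn s U U v := by
    rw [gagOn, ← lintegral_const_mul' _ _ (by finiteness), ← lintegral_indicator hU]
    refine lintegral_congr fun x => ?_
    by_cases hx : x ∈ U
    · simp only [A, hx, indicator_of_mem]
      rw [lintegral_indicator hU, lintegral_const_mul' _ _ (by finiteness)]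
    · simp [A, hx]
  -- Additivity of the lower integral needs measurability of one summand only, so it is enough to
  -- treat the kernel terms and leave `A` aside.
  have mk1 : ∀ x : Eu d, Measurable fun y => 2 * (M : ℝ≥0∞) * kern s (x - y) := fun x =>
    ((measurable_kern s).comp (measurable_const.sub measurable_id)).const_mul _
  have mB1 : ∀ x : Eu d, AEMeasurable
      (fun y => 2 * (M : ℝ≥0∞) * kern s (x - y) * ‖V x‖ₑ ^ 2) volume := fun x =>
    (mk1 x).aemeasurable.mul aemeasurable_const
  have mC1 : ∀ x : Eu d, AEMeasurable
      (fun y => 2 * (M : ℝ≥0∞) * kern s (x - y) * ‖V y‖ₑ ^ 2) volume := fun x =>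
    (mk1 x).aemeasurable.mul (hVm.enorm.pow_const 2)
  calc gagOn s univ univ (fun x => χ x • v x)
      ≤ ∫⁻ x, ∫⁻ y, (A x y + (2 * M * kern s (x - y) * ‖V x‖ₑ ^ 2
          + 2 * M * kern s (x - y) * ‖V y‖ₑ ^ 2)) := by
        rw [gagOn, Measure.restrict_univ]
        exact lintegral_mono fun x => lintegral_mono fun y => hpt x y
    _ = ∫⁻ x, ((∫⁻ y, A x y) + ((∫⁻ y, 2 * M * kern s (x - y) * ‖V x‖ₑ ^ 2)
          + ∫⁻ y, 2 * M * kern s (x - y) * ‖V y‖ₑ ^ 2)) := by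
        refine lintegral_congr fun x => ?_
        rw [← lintegral_add_left' (mB1 x)]
        exact lintegral_add_right' _ ((mB1 x).add (mC1 x))
    _ = _ := by
        have := lintegral_add_right' (μ := volume) (fun x => ∫⁻ y, A x y)
          (mB.lintegral_prod_right'.add mC.lintegral_prod_right')
        refine this.trans ?_
        have h2 := lintegral_add_left' (μ := volume) mB.lintegral_prod_right'
          (fun x => ∫⁻ y, 2 * (M : ℝ≥0∞) * kern s (x - y) * ‖V y‖ₑ ^ 2)
        refine (congrArg _ h2).trans ?_
        simp only [iA, iB, iC]
        ring

end FracExt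
end
-- Products with smooth cutoff functions.
noncomputable section
namespace FracExt
open Filter Topology

variable {d : ℕ}

theorem exists_cutoff_bounds {χ : Eu d → ℝ} (hχ : ContDiff ℝ ∞ χ) (hc : HasCompactSupport χ) :
    ∃ M : ℝ≥0, (∀ x, ‖χ x‖ₑ ≤ M) ∧ ∀ x y, ‖χ x - χ y‖ₑ ^ 2 ≤ M * min 1 (‖x - y‖ₑ ^ 2) := by
  obtain ⟨K, hK⟩ := ContDiff.lipschitzWith_of_hasCompactSupport hc hχ (by simp)
  obtain ⟨C, hC⟩ := hc.exists_bound_of_continuous hχ.continuous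
  have hC0 : 0 ≤ C := (norm_nonneg _).trans (hC 0)
  lift C to ℝ≥0 using hC0
  have hCe : ∀ x, ‖χ x‖ₑ ≤ C := fun x => by
    rw [enorm_eq_nnnorm]; exact ENNReal.coe_le_coe.2 (hC x)
  -- The three summands serve the sup bound, the difference of distant points (`2(C² + C²)`), and
  -- the Lipschitz bound for near points.
  refine ⟨C + (4 * C ^ 2 + K ^ 2), fun x => (hCe x).trans ?_, fun x y => ?_⟩
  · exact ENNReal.coe_le_coe.2 le_self_add
  rcases le_total 1 (‖x - y‖ₑ ^ 2) with h | h
  · rw [min_eq_left h, mul_one]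
    calc ‖χ x - χ y‖ₑ ^ 2 ≤ 2 * (‖χ x‖ₑ ^ 2 + ‖χ y‖ₑ ^ 2) := enorm_sub_sq_le _ _
      _ ≤ 2 * ((C : ℝ≥0∞) ^ 2 + (C : ℝ≥0∞) ^ 2) := by gcongr <;> exact hCe _
      _ = ((4 * C ^ 2 : ℝ≥0) : ℝ≥0∞) := by push_cast; ring
      _ ≤ _ := ENNReal.coe_le_coe.2 (le_self_add.trans le_add_self)
  · rw [min_eq_right h]
    have h1 : ‖χ x - χ y‖ₑ ≤ K * ‖x - y‖ₑ := by
      rw [← edist_eq_enorm_sub, ← edist_eq_enorm_sub]; exact hK x y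
    calc ‖χ x - χ y‖ₑ ^ 2 ≤ (K * ‖x - y‖ₑ) ^ 2 := pow_le_pow_left' h1 2
      _ = ((K ^ 2 : ℝ≥0) : ℝ≥0∞) * ‖x - y‖ₑ ^ 2 := by push_cast; ring
      _ ≤ _ := by
        gcongr
        exact le_add_self.trans le_add_self

theorem gradient_apply (χ : Eu d → ℝ) (x : Eu d) (i : Fin d) :
    gradient χ x i = fderiv ℝ χ x (EuclideanSpace.single i 1) := by
  have : ⟪gradient χ x, EuclideanSpace.single i 1⟫ = fderiv ℝ χ x (EuclideanSpace.single i 1) := by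
    simp [gradient]
  rw [← this, EuclideanSpace.inner_single_right]; simp

theorem continuous_gradient {χ : Eu d → ℝ} (hχ : ContDiff ℝ 1 χ) : Continuous (gradient χ) :=
  (InnerProductSpace.toDual ℝ (Eu d)).symm.continuous.comp (hχ.continuous_fderiv (by simp))

theorem gradient_eq_zero {χ : Eu d → ℝ} {x : Eu d} (hx : x ∉ tsupport χ) : gradient χ x = 0 := by
  have : fderiv ℝ χ x = 0 := by
    by_contra h
    exact hx (support_fderiv_subset ℝ h)
  simp [gradient, this]

theorem hasCompactSupport_gradient {χ : Eu d → ℝ} (hc : HasCompactSupport χ) :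
    HasCompactSupport (gradient χ) :=
  HasCompactSupport.intro hc fun _ hx => gradient_eq_zero hx

theorem enorm_sq_eq_sum (a : Eu d) : ‖a‖ₑ ^ 2 = ∑ i, ‖a i‖ₑ ^ 2 := by
  have h : ‖a‖ ^ 2 = ∑ i, ‖a i‖ ^ 2 := EuclideanSpace.norm_sq_eq a
  have := congrArg ENNReal.ofReal h
  rw [ENNReal.ofReal_pow (norm_nonneg _), ENNReal.ofReal_sum_of_nonneg (fun i _ => by positivity)]
    at this
  simp only [ENNReal.ofReal_pow (norm_nonneg _), ofReal_norm] at this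
  exact this

theorem aemeasurable_gagOn {F : Type*} [NormedAddCommGroup F] (s : ℝ) {A B : Set (Eu d)}
    {g : Eu d → F} (hA : AEStronglyMeasurable g (volume.restrict A))
    (hB : AEStronglyMeasurable g (volume.restrict B)) :
    AEMeasurable (fun p : Eu d × Eu d => ‖g p.1 - g p.2‖ₑ ^ 2 / ‖p.1 - p.2‖ₑ ^ ((d : ℝ) + 2 * s))
      ((volume.restrict A).prod (volume.restrict B)) := by
  have h := (hA.comp_fst (ν := volume.restrict B)).sub (hB.comp_snd (μ := volume.restrict A))
  exact (h.enorm.pow_const 2).div (by fun_prop)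

/-- The Gagliardo seminorm of a vector field is the sum over its components. -/
theorem gagOn_eq_sum (s : ℝ) {A B : Set (Eu d)} {g : Eu d → Eu d}
    (hA : AEStronglyMeasurable g (volume.restrict A))
    (hB : AEStronglyMeasurable g (volume.restrict B)) :
    gagOn s A B g = ∑ i, gagOn s A B (fun x => g x i) := by
  have hcoord : ∀ (i : Fin d) (S : Set (Eu d)), AEStronglyMeasurable g (volume.restrict S) →
      AEStronglyMeasurable (fun x => g x i) (volume.restrict S) := fun i S h =>
    (EuclideanSpace.proj (𝕜 := ℝ) i : Eu d →L[ℝ] ℝ).continuous.comp_aestronglyMeasurable h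
  have hm := fun i => aemeasurable_gagOn s (hcoord i A hA) (hcoord i B hB)
  unfold gagOn
  rw [lintegral_lintegral (aemeasurable_gagOn s hA hB)]
  have e : ∀ i, ∫⁻ x in A, ∫⁻ y in B, ‖g x i - g y i‖ₑ ^ 2 / ‖x - y‖ₑ ^ ((d : ℝ) + 2 * s)
      = ∫⁻ p : Eu d × Eu d, ‖g p.1 i - g p.2 i‖ₑ ^ 2 / ‖p.1 - p.2‖ₑ ^ ((d : ℝ) + 2 * s)
        ∂((volume.restrict A).prod (volume.restrict B)) := fun i =>
    lintegral_lintegral (hm i)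
  simp only [e]
  rw [← lintegral_finsetSum' _ fun i _ => hm i]
  refine lintegral_congr fun p => ?_
  simp only [enorm_sq_eq_sum (g p.1 - g p.2), PiLp.sub_apply, div_eq_mul_inv, Finset.sum_mul]

theorem gagOn_add_le (s : ℝ) {A B : Set (Eu d)} {F : Type*} [NormedAddCommGroup F]
    {g₁ g₂ : Eu d → F} (hA : AEStronglyMeasurable g₁ (volume.restrict A))
    (hB : AEStronglyMeasurable g₁ (volume.restrict B)) :
    gagOn s A B (fun x => g₁ x + g₂ x) ≤ 2 * (gagOn s A B g₁ + gagOn s A B g₂) := by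
  have m := aemeasurable_gagOn s hA hB
  calc gagOn s A B (fun x => g₁ x + g₂ x)
      ≤ ∫⁻ x in A, ∫⁻ y in B, 2 * (‖g₁ x - g₁ y‖ₑ ^ 2 / ‖x - y‖ₑ ^ ((d : ℝ) + 2 * s)
          + ‖g₂ x - g₂ y‖ₑ ^ 2 / ‖x - y‖ₑ ^ ((d : ℝ) + 2 * s)) := by
        refine lintegral_mono fun x => lintegral_mono fun y => ?_
        rw [← ENNReal.add_div, ← mul_div_assoc]
        refine ENNReal.div_le_div_right ?_ _
        rw [add_sub_add_comm]
        exact enorm_add_sq_le _ _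
    _ = 2 * ∫⁻ x in A, ((∫⁻ y in B, ‖g₁ x - g₁ y‖ₑ ^ 2 / ‖x - y‖ₑ ^ ((d : ℝ) + 2 * s))
          + ∫⁻ y in B, ‖g₂ x - g₂ y‖ₑ ^ 2 / ‖x - y‖ₑ ^ ((d : ℝ) + 2 * s)) := by
        rw [← lintegral_const_mul' _ _ (by norm_num)]
        refine lintegral_congr fun x => ?_
        have m' : AEMeasurable (fun y => ‖g₁ x - g₁ y‖ₑ ^ 2 / ‖x - y‖ₑ ^ ((d : ℝ) + 2 * s))
            (volume.restrict B) :=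
          ((aestronglyMeasurable_const.sub hB).enorm.pow_const 2).div (by fun_prop)
        rw [lintegral_const_mul' _ _ (by norm_num), lintegral_add_left' m']
    _ = _ := by
        rw [lintegral_add_left' m.lintegral_prod_right']
        rfl

/-- For any test function `φ` on the whole space, `χ φ` is admissible in `U`. The product rule for
`χ φ` yields the additional term `u ∇χ`. -/
theorem WG.cutoff {U : Set (Eu d)} {χ : Eu d → ℝ} (hχ : ContDiff ℝ ∞ χ)
    (hs : tsupport χ ⊆ U) {u : Eu d → ℝ} {v : Eu d → Eu d}
    (hu : MemLp u 2 (volume.restrict U)) (hv : MemLp v 2 (volume.restrict U)) (h : WG U u v) :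
    WG univ (fun x => χ x * u x) (fun x => χ x • v x + u x • gradient χ x) := by
  intro φ hφ hφc _ i
  have h0 : ∀ x ∉ U, χ x = 0 := fun x hx => by
    by_contra hne; exact hx (hs (subset_tsupport χ hne))
  have hg0 : ∀ x ∉ U, gradient χ x = 0 := fun x hx => gradient_eq_zero fun hx' => hx (hs hx')
  have hχφ : ContDiff ℝ ∞ fun x => χ x * φ x := hχ.mul hφ
  have hcχφ : HasCompactSupport fun x => χ x * φ x := hφc.mul_left
  have hsχφ : tsupport (fun x => χ x * φ x) ⊆ U := (tsupport_mul_subset_left).trans hs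
  have key := h _ hχφ hcχφ hsχφ i
  have hd : ∀ x, fderiv ℝ (fun x => χ x * φ x) x (EuclideanSpace.single i 1)
      = χ x * fderiv ℝ φ x (EuclideanSpace.single i 1) + φ x * gradient χ x i := fun x => by
    rw [fderiv_fun_mul (hχ.differentiable (by simp) x) (hφ.differentiable (by simp) x),
      gradient_apply]
    simp
  have cφ' := continuous_test_deriv hφ (EuclideanSpace.single i (1 : ℝ))
  have cφ's := hasCompactSupport_test_deriv hφc (EuclideanSpace.single i (1 : ℝ))
  have cg : Continuous fun x => gradient χ x i :=
    (EuclideanSpace.proj (𝕜 := ℝ) i : Eu d →L[ℝ] ℝ).continuous.comp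
      (continuous_gradient (hχ.of_le (by simp)))
  have i1 : Integrable (fun x => u x * (χ x * fderiv ℝ φ x (EuclideanSpace.single i 1)))
      (volume.restrict U) := integrable_mul_test hu (hχ.continuous.mul cφ') cφ's.mul_left
  have i2 : Integrable (fun x => u x * (φ x * gradient χ x i)) (volume.restrict U) :=
    integrable_mul_test hu (hφ.continuous.mul cg) hφc.mul_right
  have i3 : Integrable (fun x => v x i * (χ x * φ x)) (volume.restrict U) :=
    integrable_mul_test (memLp_coord hv i) (hχ.continuous.mul hφ.continuous) hφc.mul_left
  simp only [hd, mul_add] at key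
  rw [integral_add i1 i2] at key
  have e1 : ∫ x in univ, χ x * u x * fderiv ℝ φ x (EuclideanSpace.single i 1)
      = ∫ x in U, u x * (χ x * fderiv ℝ φ x (EuclideanSpace.single i 1)) := by
    rw [setIntegral_univ, ← setIntegral_eq_integral_of_forall_compl_eq_zero (s := U)]
    · congr 1; ext x; ring
    · intro x hx; simp [h0 x hx]
  have e2 : ∫ x in univ, (χ x • v x + u x • gradient χ x) i * φ x
      = ∫ x in U, (v x i * (χ x * φ x) + u x * (φ x * gradient χ x i)) := by
    rw [setIntegral_univ, ← setIntegral_eq_integral_of_forall_compl_eq_zero (s := U)]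
    · congr 1; ext x
      simp only [PiLp.add_apply, PiLp.smul_apply, smul_eq_mul]; ring
    · intro x hx; simp [h0 x hx, hg0 x hx]
  rw [e1, e2, integral_add i3 i2]
  linarith

/-- `H¹`-bounds for the product with a cutoff function. -/
theorem cutoff_bounds {U : Set (Eu d)} (hU : IsOpen U) {χ : Eu d → ℝ} (hχ : ContDiff ℝ ∞ χ)
    (hc : HasCompactSupport χ) (hs : tsupport χ ⊆ U) :
    ∃ C : ℝ≥0, ∀ (u : Eu d → ℝ) (v : Eu d → Eu d), MemLp u 2 (volume.restrict U) →
      MemLp v 2 (volume.restrict U) →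
      MemLp (fun x => χ x * u x) 2 (volume.restrict univ) ∧
      MemLp (fun x => χ x • v x + u x • gradient χ x) 2 (volume.restrict univ) ∧
      l2Sq univ (fun x => χ x * u x) ≤ C * l2Sq U u ∧
      l2Sq univ (fun x => χ x • v x + u x • gradient χ x) ≤ C * (l2Sq U u + l2Sq U v) := by
  have h0 : ∀ x ∉ U, χ x = 0 := fun x hx => by
    by_contra hne; exact hx (hs (subset_tsupport χ hne))
  have hg0 : ∀ x ∉ U, gradient χ x = 0 := fun x hx => gradient_eq_zero fun hx' => hx (hs hx')
  have cg := continuous_gradient (hχ.of_le (m := 1) (by simp))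
  obtain ⟨A, hA⟩ := hc.exists_bound_of_continuous hχ.continuous
  obtain ⟨B, hB⟩ := (hasCompactSupport_gradient hc).exists_bound_of_continuous cg
  lift A to ℝ≥0 using (norm_nonneg _).trans (hA 0)
  lift B to ℝ≥0 using (norm_nonneg _).trans (hB 0)
  refine ⟨A ^ 2 + 2 * (A ^ 2 + B ^ 2), fun u v hu hv => ?_⟩
  obtain ⟨m1, b1⟩ := memLp_univ_of_bound (h := fun x => χ x * u x) (M := A) hU.measurableSet hu
    (hχ.continuous.aestronglyMeasurable.mul hu.1)
    (fun x => by rw [norm_mul]; gcongr; exact hA x) (fun x hx => by simp [h0 x hx])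
  obtain ⟨m2, b2⟩ := memLp_univ_of_bound (h := fun x => χ x • v x) (M := A) hU.measurableSet hv
    (hχ.continuous.aestronglyMeasurable.smul hv.1)
    (fun x => by rw [norm_smul]; gcongr; exact hA x) (fun x hx => by simp [h0 x hx])
  obtain ⟨m3, b3⟩ := memLp_univ_of_bound (h := fun x => u x • gradient χ x) (M := B)
    hU.measurableSet hu (hu.1.smul cg.aestronglyMeasurable)
    (fun x => by rw [norm_smul, mul_comm]; gcongr; exact hB x) (fun x hx => by simp [hg0 x hx])
  refine ⟨m1, m2.add m3, b1.trans ?_, ?_⟩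
  · gcongr
    exact le_self_add
  calc l2Sq univ (fun x => χ x • v x + u x • gradient χ x)
      ≤ ∫⁻ x in univ, 2 * (‖χ x • v x‖ₑ ^ 2 + ‖u x • gradient χ x‖ₑ ^ 2) :=
        lintegral_mono fun x => enorm_add_sq_le _ _
    _ = 2 * (l2Sq univ (fun x => χ x • v x) + l2Sq univ (fun x => u x • gradient χ x)) := by
        rw [lintegral_const_mul' _ _ (by norm_num), lintegral_add_left' (m2.1.enorm.pow_const 2)]
        rfl
    _ ≤ 2 * ((A ^ 2 : ℝ≥0) * l2Sq U v + (B ^ 2 : ℝ≥0) * l2Sq U u) := by gcongr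
    _ ≤ 2 * ((A ^ 2 + B ^ 2 : ℝ≥0) * l2Sq U v + (A ^ 2 + B ^ 2 : ℝ≥0) * l2Sq U u) := by
        gcongr
        · exact le_self_add
        · exact le_add_self
    _ = ((2 * (A ^ 2 + B ^ 2) : ℝ≥0) : ℝ≥0∞) * (l2Sq U u + l2Sq U v) := by push_cast; ring
    _ ≤ _ := by
        gcongr
        exact le_add_self

/-- The Gagliardo bound for the gradient of the product with a cutoff function. -/
theorem WG.cutoff_gagOn_le (hd : 1 ≤ d) {s : ℝ} (hs0 : 0 < s) (hs1 : s < 1) {U : Set (Eu d)}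
    (hU : IsOpen U) {χ : Eu d → ℝ} (hχ : ContDiff ℝ ∞ χ) (hc : HasCompactSupport χ)
    (hs : tsupport χ ⊆ U) :
    ∃ C : ℝ≥0, ∀ (u : Eu d → ℝ) (v : Eu d → Eu d), MemLp u 2 (volume.restrict U) →
      MemLp v 2 (volume.restrict U) → WG U u v →
      gagOn s univ univ (fun x => χ x • v x + u x • gradient χ x)
        ≤ C * (l2Sq U u + l2Sq U v + gagOn s U U v) := by
  have h0 : ∀ x ∉ U, χ x = 0 := fun x hx => by
    by_contra hne; exact hx (hs (subset_tsupport χ hne))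
  have hker := (lintegral_kernel_lt_top hd hs0 hs1).ne
  obtain ⟨K, hK'⟩ : ∃ K : ℝ≥0, ∫⁻ z : Eu d, kern s z = K :=
    ⟨_, (ENNReal.coe_toNNReal hker).symm⟩
  obtain ⟨M, hM, hL⟩ := exists_cutoff_bounds hχ hc
  -- Each component `∂ᵢχ` is again a cutoff function supported in `U`. Hence `∂ᵢχ · u` has a weak
  -- gradient in `L²` on the whole space, and the embedding of `H¹` into `H^s` controls its
  -- seminorm.
  have hχi : ∀ i : Fin d, ContDiff ℝ ∞ fun x => gradient χ x i := fun i => by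
    simp only [gradient_apply]
    exact (hχ.fderiv_right (m := ∞) (by simp)).clm_apply contDiff_const
  have hci : ∀ i : Fin d, HasCompactSupport fun x => gradient χ x i := fun i => by
    simp only [gradient_apply]
    exact hasCompactSupport_test_deriv hc _
  have hsi : ∀ i : Fin d, tsupport (fun x => gradient χ x i) ⊆ U := fun i => by
    refine (closure_minimal (fun x hx => ?_) (isClosed_tsupport χ)).trans hs
    by_contra hne
    exact hx (by simp [gradient_eq_zero hne])
  choose D hD using fun i => cutoff_bounds hU (hχi i) (hci i) (hsi i)
  refine ⟨2 * ((2 * M ^ 2 + 4 * M * K) + ∑ i, K * (4 * D i + D i)), fun u v hu hv h => ?_⟩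
  obtain ⟨E, hE⟩ := cutoff_bounds hU hχ hc hs
  have cg := continuous_gradient (hχ.of_le (m := 1) (by simp))
  -- Setting `u = 0`, and below `v = 0`, in `cutoff_bounds` isolates the two summands of the
  -- gradient.
  have m1 : AEStronglyMeasurable (fun x => χ x • v x) (volume.restrict univ) := by
    have := (hE 0 v MemLp.zero hv).2.1.1
    simpa using this
  have m2 : AEStronglyMeasurable (fun x => u x • gradient χ x) (volume.restrict univ) := by
    have := (hE u 0 hu MemLp.zero).2.1.1
    simpa using this
  set R := l2Sq U u + l2Sq U v + gagOn s U U v with hR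
  have g1 : gagOn s univ univ (fun x => χ x • v x) ≤ ((2 * M ^ 2 + 4 * M * K : ℝ≥0) : ℝ≥0∞) * R := by
    refine (gagOn_smul_le s hU.measurableSet hv.1 h0 hM hL).trans ?_
    rw [hK']
    push_cast
    rw [add_mul]
    gcongr
    · exact le_add_self
    · exact le_add_self.trans le_self_add
  have g2 : ∀ i, gagOn s univ univ (fun x => (u x • gradient χ x) i)
      ≤ ((K * (4 * D i + D i) : ℝ≥0) : ℝ≥0∞) * R := by
    intro i
    obtain ⟨n1, n2, n3, n4⟩ := hD i u v hu hv
    have w := h.cutoff (hχi i) (hsi i) hu hv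
    have := w.gagOn_le s n1 n2
    have e : (fun x => (u x • gradient χ x) i) = fun x => gradient χ x i * u x := by
      ext x; simp [mul_comm]
    rw [e]
    refine this.trans ?_
    rw [hK']
    calc (K : ℝ≥0∞) * (4 * l2Sq univ (fun x => gradient χ x i * u x) + l2Sq univ
            (fun x => gradient χ x i • v x + u x • gradient (fun x => gradient χ x i) x))
        ≤ K * (4 * (D i * R) + D i * R) := by
          gcongr
          · exact n3.trans (by gcongr; exact le_self_add.trans le_self_add)
          · exact n4.trans (by gcongr; exact le_self_add)
      _ = _ := by push_cast; ring
  calc gagOn s univ univ (fun x => χ x • v x + u x • gradient χ x)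
      ≤ 2 * (gagOn s univ univ (fun x => χ x • v x)
          + gagOn s univ univ (fun x => u x • gradient χ x)) := gagOn_add_le s m1 m1
    _ ≤ 2 * (((2 * M ^ 2 + 4 * M * K : ℝ≥0) : ℝ≥0∞) * R
          + ∑ i, ((K * (4 * D i + D i) : ℝ≥0) : ℝ≥0∞) * R) := by
        rw [gagOn_eq_sum s m2 m2]
        gcongr with i
        exact g2 i
    _ = _ := by
        rw [← Finset.sum_mul]
        push_cast
        ring

end FracExt
end
-- Boundary charts and the shear map.
noncomputable section
namespace FracExt
open Filter Topology

variable {d : ℕ}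

/-- The map moving `x` along `ν` by `c` times its height below the graph `{δ = 0}`. -/
def shear (δ : Eu d → ℝ) (ν : Eu d) (c : ℝ) (x : Eu d) : Eu d := x + (c * δ x) • ν

/-- Near `x₀`, the set `Ω` is the sublevel set `{δ < 0}` of a `C²` function with `∂_ν δ = -1`. -/
structure EpiChart (Ω : Set (Eu d)) (x₀ ν : Eu d) (r : ℝ) (L : ℝ≥0) (δ : Eu d → ℝ) : Prop where
  isOpen : IsOpen Ω
  pos : 0 < r
  le_one : r ≤ 1
  norm_eq : ‖ν‖ = 1
  contDiff : ContDiff ℝ 2 δ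
  shift : ∀ x (t : ℝ), δ (x + t • ν) = δ x - t
  mem_iff : ∀ x ∈ ball x₀ r, x ∈ Ω ↔ δ x < 0
  base : δ x₀ = 0
  lip : ∀ x ∈ ball x₀ r, ∀ y ∈ ball x₀ r, ‖δ x - δ y‖ ≤ L * ‖x - y‖
  lip_grad : ∀ x ∈ ball x₀ r, ∀ y ∈ ball x₀ r, ‖gradient δ x - gradient δ y‖ ≤ L * ‖x - y‖
  bound_grad : ∀ x ∈ ball x₀ r, ‖gradient δ x‖ ≤ L

/-- The function is `δ = γ ∘ P - ⟪ν, ·⟫`. Since `P ν = 0` and `‖ν‖ = 1`, moving by `t ν` lowers it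
by exactly `t`. The Lipschitz and sup bounds come from compactness and convexity of the closed ball.
-/
theorem exists_epiChart {Ω : Set (Eu d)} (hΩ : IsOpen Ω) (hΩ2 : HasC2Boundary Ω) {x₀ : Eu d}
    (hx₀ : x₀ ∈ frontier Ω) : ∃ ν r L δ, EpiChart Ω x₀ ν r L δ := by
  obtain ⟨r, hr, ν, hν, γ, hγ, h⟩ := hΩ2 x₀ hx₀
  set P := ((ℝ ∙ ν)ᗮ : Submodule ℝ (Eu d)).orthogonalProjectionOnto with hP
  let δ : Eu d → ℝ := fun x => γ (P x) - ⟪ν, x⟫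
  have hδ : ContDiff ℝ 2 δ := (hγ.comp P.contDiff).sub (contDiff_const.inner ℝ contDiff_id)
  have hg : ContDiff ℝ 1 (gradient δ) :=
    (InnerProductSpace.toDual ℝ (Eu d)).symm.contDiff.comp (hδ.fderiv_right (m := 1) (by norm_num))
  obtain ⟨L₁, h₁⟩ := (hδ.contDiffOn (s := closedBall x₀ r)).exists_lipschitzOnWith (by norm_num)
    (convex_closedBall x₀ r) (isCompact_closedBall x₀ r)
  obtain ⟨L₂, h₂⟩ := (hg.contDiffOn (s := closedBall x₀ r)).exists_lipschitzOnWith (by norm_num)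
    (convex_closedBall x₀ r) (isCompact_closedBall x₀ r)
  obtain ⟨L₃, h₃⟩ := (isCompact_closedBall x₀ r).exists_bound_of_continuousOn
    hg.continuous.continuousOn
  have hm : ∀ x ∈ ball x₀ r, x ∈ Ω ↔ δ x < 0 := fun x hx => by
    rw [h x hx]; simp [δ]
  have hsub : ball x₀ (min r 1) ⊆ closedBall x₀ r :=
    (ball_subset_ball (min_le_left _ _)).trans ball_subset_closedBall
  have hmem : x₀ ∈ ball x₀ r := mem_ball_self hr
  -- Capping the radius at `1` later keeps all distances at most `1`, where the truncation in `kern`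
  -- is inactive. The sum `L₁ + L₂ + L₃` serves the three bounds at once.
  refine ⟨ν, min r 1, L₁ + L₂ + L₃.toNNReal, δ, hΩ, lt_min hr one_pos, min_le_right _ _, hν, hδ,
    ?_, fun x hx => hm x (ball_subset_ball (min_le_left _ _) hx), ?_, ?_, ?_, ?_⟩
  · intro x t
    have : P (x + t • ν) = P x := by
      rw [map_add, map_smul]
      have : P ν = 0 := by
        rw [hP, Submodule.orthogonalProjectionOnto_eq_zero_iff]
        exact Submodule.le_orthogonal_orthogonal _ (Submodule.mem_span_singleton_self ν)
      rw [this, smul_zero, add_zero]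
    simp only [δ, this, inner_add_right, inner_smul_right, real_inner_self_eq_norm_sq, hν]
    ring
  -- The boundary point is a limit of points with `δ < 0`, and it is not in the open set `Ω`, so its
  -- height is zero.
  · apply le_antisymm
    · have hcl : x₀ ∈ closure (Ω ∩ ball x₀ r) := by
        rw [mem_closure_iff_nhds]
        intro t ht
        obtain ⟨y, hy⟩ := mem_closure_iff_nhds.1 (frontier_subset_closure hx₀) _
          (inter_mem ht (isOpen_ball.mem_nhds hmem))
        exact ⟨y, hy.1.1, hy.2, hy.1.2⟩
      have : closure (Ω ∩ ball x₀ r) ⊆ {x | δ x ≤ 0} :=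
        closure_minimal (fun x hx => ((hm x hx.2).1 hx.1).le)
          (isClosed_le hδ.continuous continuous_const)
      exact this hcl
    · have : x₀ ∉ Ω := fun h' => by
        rw [hΩ.frontier_eq] at hx₀
        exact hx₀.2 h'
      rw [hm x₀ hmem] at this
      exact not_lt.1 this
  · intro x hx y hy
    refine (h₁.norm_sub_le (hsub hx) (hsub hy)).trans ?_
    gcongr
    linarith [L₂.coe_nonneg, L₃.toNNReal.coe_nonneg]
  · intro x hx y hy
    refine (h₂.norm_sub_le (hsub hx) (hsub hy)).trans ?_
    gcongr
    linarith [L₁.coe_nonneg, L₃.toNNReal.coe_nonneg]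
  · intro x hx
    refine (h₃ x (hsub hx)).trans ?_
    push_cast
    linarith [L₁.coe_nonneg, L₂.coe_nonneg, Real.le_coe_toNNReal L₃]

namespace EpiChart

variable {Ω : Set (Eu d)} {x₀ ν : Eu d} {r : ℝ} {L : ℝ≥0} {δ : Eu d → ℝ}
  (H : EpiChart Ω x₀ ν r L δ)

include H

theorem differentiable : Differentiable ℝ δ := H.contDiff.differentiable (by norm_num)

/-- The height is multiplied by `1 - c`: for `c ≥ 2` the outside goes inside, and `c = 1` collapses
space onto the graph. -/
theorem apply_shear (c : ℝ) (x : Eu d) : δ (shear δ ν c x) = (1 - c) * δ x := by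
  rw [shear, H.shift]; ring

theorem fderiv_apply_self (x : Eu d) : fderiv ℝ δ x ν = -1 := by
  have h1 : HasDerivAt (fun t : ℝ => x + t • ν) ν 0 := by
    simpa using ((hasDerivAt_id (0 : ℝ)).smul_const ν).const_add x
  have h2 : HasFDerivAt δ (fderiv ℝ δ x) (x + (0 : ℝ) • ν) := by
    simpa using (H.differentiable x).hasFDerivAt
  have h3 := h2.comp_hasDerivAt (0 : ℝ) h1
  have h4 : HasDerivAt (fun t : ℝ => δ (x + t • ν)) (-1) 0 := by
    simp only [H.shift]
    simpa using (hasDerivAt_id (0 : ℝ)).const_sub (δ x)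
  exact h3.unique h4

theorem hasFDerivAt_shear (c : ℝ) (x : Eu d) : HasFDerivAt (shear δ ν c)
    (ContinuousLinearMap.id ℝ (Eu d) + (c • fderiv ℝ δ x).smulRight ν) x :=
  (hasFDerivAt_id x).add (((H.differentiable x).hasFDerivAt.const_mul c).smul_const ν)

theorem continuous_shear (c : ℝ) : Continuous (shear δ ν c) :=
  continuous_iff_continuousAt.2 fun x => (H.hasFDerivAt_shear c x).continuousAt

/-- The derivative is a rank-one perturbation of the identity, with determinant `1 + c · dδ(ν)`, and
`dδ(ν) = -1`. -/
theorem det_shear (c : ℝ) (x : Eu d) :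
    (ContinuousLinearMap.id ℝ (Eu d) + (c • fderiv ℝ δ x).smulRight ν).det = 1 - c := by
  have e : ((ContinuousLinearMap.id ℝ (Eu d) + (c • fderiv ℝ δ x).smulRight ν :
      Eu d →L[ℝ] Eu d) : Eu d →ₗ[ℝ] Eu d)
      = LinearMap.transvection ((c • fderiv ℝ δ x : Eu d →L[ℝ] ℝ) : Eu d →ₗ[ℝ] ℝ) ν := by
    ext v; simp [LinearMap.transvection.apply]
  rw [ContinuousLinearMap.det, e, LinearMap.transvection.det]
  simp [H.fderiv_apply_self, sub_eq_add_neg]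

theorem injective_shear {c : ℝ} (hc : c ≠ 1) : Function.Injective (shear δ ν c) := by
  intro x y hxy
  have h1 := congrArg δ hxy
  rw [H.apply_shear, H.apply_shear] at h1
  have h2 : δ x = δ y := mul_left_cancel₀ (sub_ne_zero.2 hc.symm) h1
  simpa [shear, h2] using hxy

/-- For `c ≥ 2` the Jacobian satisfies `|1 - c| ≥ 1`, so volume is not contracted. With the factors
`2` and `3` the changes of variables cost no constant. -/
theorem volume_preimage_shear_le {c : ℝ} (hc : 2 ≤ c) {T : Set (Eu d)} (hT : MeasurableSet T) :
    volume (shear δ ν c ⁻¹' T) ≤ volume T := by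
  have h1 := lintegral_abs_det_fderiv_eq_addHaar_image volume
    ((H.continuous_shear c).measurable hT)
    (fun x _ => (H.hasFDerivAt_shear c x).hasFDerivWithinAt)
    (H.injective_shear (by linarith : c ≠ 1)).injOn
  simp only [H.det_shear, setLIntegral_const] at h1
  calc volume (shear δ ν c ⁻¹' T)
      ≤ ENNReal.ofReal |1 - c| * volume (shear δ ν c ⁻¹' T) := by
        refine le_mul_of_one_le_left' ?_
        rw [ENNReal.one_le_ofReal, abs_of_nonpos (by linarith)]
        linarith
    _ = volume (shear δ ν c '' (shear δ ν c ⁻¹' T)) := h1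
    _ ≤ volume T := measure_mono (image_preimage_subset _ _)

/-- The shear with `c = 1` fixes the graph pointwise and has zero Jacobian, so the image of the
graph, which is the graph itself, is null. -/
theorem volume_graph : volume {x | δ x = 0} = 0 := by
  have h := addHaar_image_eq_zero_of_det_fderivWithin_eq_zero volume (s := {x | δ x = 0})
    (fun x _ => (H.hasFDerivAt_shear 1 x).hasFDerivWithinAt) (fun x _ => by rw [H.det_shear]; simp)
  have e : shear δ ν 1 '' {x | δ x = 0} = {x | δ x = 0} := by
    have : ∀ x ∈ {x | δ x = 0}, shear δ ν 1 x = x := fun x (hx : δ x = 0) => by simp [shear, hx]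
    rw [image_congr this, image_id']
  rwa [e] at h

theorem nonneg_of_notMem {x : Eu d} (hx : x ∈ ball x₀ r) (h : x ∉ Ω) : 0 ≤ δ x := by
  rw [H.mem_iff x hx] at h; exact not_lt.1 h

theorem norm_shear_sub_le {c : ℝ} (hc : 0 ≤ c) (hc3 : c ≤ 3) {x y : Eu d} (hx : x ∈ ball x₀ r)
    (hy : y ∈ ball x₀ r) : ‖shear δ ν c x - shear δ ν c y‖ ≤ (1 + 3 * L) * ‖x - y‖ := by
  have e : shear δ ν c x - shear δ ν c y = (x - y) + (c * (δ x - δ y)) • ν := by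
    simp only [shear, mul_sub, sub_smul]; abel
  rw [e]
  refine (norm_add_le _ _).trans ?_
  rw [norm_smul, H.norm_eq, mul_one, norm_mul, Real.norm_of_nonneg hc]
  have := H.lip x hx y hy
  have : c * ‖δ x - δ y‖ ≤ 3 * (L * ‖x - y‖) := by gcongr
  linarith

/-- As `δ x < 0 ≤ δ y`, the height of the outside point is at most `|δ x - δ y| ≤ L‖x - y‖`. The
reflected point therefore remains comparably close to every inside point. -/
theorem norm_sub_shear_le {c : ℝ} (hc : 0 ≤ c) (hc3 : c ≤ 3) {x y : Eu d} (hx : x ∈ ball x₀ r)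
    (hy : y ∈ ball x₀ r) (hxΩ : x ∈ Ω) (hyΩ : y ∉ Ω) :
    ‖x - shear δ ν c y‖ ≤ (1 + 3 * L) * ‖x - y‖ := by
  have e : x - shear δ ν c y = (x - y) - (c * δ y) • ν := by
    simp only [shear]; abel
  rw [e]
  refine (norm_sub_le _ _).trans ?_
  rw [norm_smul, H.norm_eq, mul_one, norm_mul, Real.norm_of_nonneg hc]
  have h1 := H.lip x hx y hy
  have h2 : ‖δ y‖ ≤ ‖δ x - δ y‖ := by
    have a := H.nonneg_of_notMem hy hyΩ
    have b := (H.mem_iff x hx).1 hxΩ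
    rw [Real.norm_of_nonneg a, Real.norm_eq_abs, abs_of_nonpos (by linarith)]
    linarith
  have : c * ‖δ y‖ ≤ 3 * (L * ‖x - y‖) := by gcongr; exact h2.trans h1
  linarith

variable {ρ : ℝ} (hρ : 0 < ρ) (hρr : (1 + 3 * L) * ρ ≤ r / 2)

include hρ hρr

theorem ball_subset : ball x₀ ρ ⊆ ball x₀ r := by
  have hr := H.pos
  have : 0 ≤ 3 * L * ρ := by positivity
  exact ball_subset_ball (by linarith)

/-- The centre has height zero and is fixed by every shear, and shears with `0 ≤ c ≤ 3` have
Lipschitz constant at most `1 + 3L`. This explains the condition `(1 + 3L) ρ ≤ r / 2`. -/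
theorem shear_mem {c : ℝ} (hc : 0 ≤ c) (hc3 : c ≤ 3) {x : Eu d} (hx : x ∈ ball x₀ ρ) :
    shear δ ν c x ∈ ball x₀ (r / 2) := by
  have h1 : shear δ ν c x₀ = x₀ := by simp [shear, H.base]
  have := H.norm_shear_sub_le hc hc3 (H.ball_subset hρ hρr hx) (mem_ball_self H.pos)
  rw [h1] at this
  rw [mem_ball, dist_eq_norm] at *
  refine this.trans_lt (lt_of_lt_of_le ?_ hρr)
  gcongr

/-- Outside points of positive height land in `Ω`, and those of height zero form a null set. As an
inequality of measures, the statement transfers both integrals and a.e. measurability. -/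
theorem map_shear_le {c : ℝ} (hc : 2 ≤ c) (hc3 : c ≤ 3) :
    Measure.map (shear δ ν c) (volume.restrict (ball x₀ ρ \ Ω)) ≤ volume.restrict Ω := by
  refine Measure.le_iff.2 fun T hT => ?_
  have hm := (H.continuous_shear c).measurable
  rw [Measure.map_apply hm hT, Measure.restrict_apply (hm hT), Measure.restrict_apply hT]
  calc volume (shear δ ν c ⁻¹' T ∩ (ball x₀ ρ \ Ω))
      ≤ volume (shear δ ν c ⁻¹' (T ∩ Ω) ∪ {x | δ x = 0}) := by
        refine measure_mono fun x hx => ?_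
        by_cases h0 : δ x = 0
        · exact Or.inr h0
        refine Or.inl ⟨hx.1, ?_⟩
        have hpos : 0 < δ x :=
          lt_of_le_of_ne (H.nonneg_of_notMem (H.ball_subset hρ hρr hx.2.1) hx.2.2) (Ne.symm h0)
        rw [H.mem_iff _ (ball_subset_ball (by linarith [H.pos])
          (H.shear_mem hρ hρr (by linarith) hc3 hx.2.1)), H.apply_shear]
        nlinarith
    _ ≤ volume (shear δ ν c ⁻¹' (T ∩ Ω)) + volume {x | δ x = 0} := measure_union_le _ _
    _ ≤ volume (T ∩ Ω) := by
        rw [H.volume_graph, add_zero]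
        exact H.volume_preimage_shear_le hc (hT.inter H.isOpen.measurableSet)

theorem lintegral_shear_le {c : ℝ} (hc : 2 ≤ c) (hc3 : c ≤ 3) {h : Eu d → ℝ≥0∞}
    (hh : AEMeasurable h (volume.restrict Ω)) :
    ∫⁻ x in ball x₀ ρ \ Ω, h (shear δ ν c x) ≤ ∫⁻ x in Ω, h x := by
  have hle := H.map_shear_le hρ hρr hc hc3
  rw [← lintegral_map' (hh.mono_measure hle) (H.continuous_shear c).measurable.aemeasurable]
  exact lintegral_mono' hle le_rfl

theorem aestronglyMeasurable_shear {F : Type*} [NormedAddCommGroup F] {c : ℝ} (hc : 2 ≤ c)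
    (hc3 : c ≤ 3) {g : Eu d → F} (hg : AEStronglyMeasurable g (volume.restrict Ω)) :
    AEStronglyMeasurable (fun x => g (shear δ ν c x)) (volume.restrict (ball x₀ ρ \ Ω)) :=
  (hg.mono_measure (H.map_shear_le hρ hρr hc hc3)).comp_measurable (H.continuous_shear c).measurable

/-- The `L²` bound for functions on `B` dominated by reflections of `g` off `Ω`. -/
theorem l2Sq_le {F G : Type*} [NormedAddCommGroup F] [NormedAddCommGroup G] {g : Eu d → F}
    {h : Eu d → G} {M : ℝ≥0} (hg : AEStronglyMeasurable g (volume.restrict Ω))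
    (h1 : ∀ x ∈ Ω, ‖h x‖ = ‖g x‖)
    (h2 : ∀ x ∈ ball x₀ ρ \ Ω,
      ‖h x‖ ≤ M * (‖g (shear δ ν 2 x)‖ + ‖g (shear δ ν 3 x)‖)) :
    l2Sq (ball x₀ ρ) h ≤ ((1 + 4 * M ^ 2 : ℝ≥0) : ℝ≥0∞) * l2Sq Ω g := by
  have hm : MeasurableSet (ball x₀ ρ \ Ω) := measurableSet_ball.diff H.isOpen.measurableSet
  rw [l2Sq, ← lintegral_inter_add_sdiff _ _ H.isOpen.measurableSet]
  have a1 : ∫⁻ x in ball x₀ ρ ∩ Ω, ‖h x‖ₑ ^ 2 ≤ l2Sq Ω g := by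
    calc _ ≤ ∫⁻ x in Ω, ‖h x‖ₑ ^ 2 := lintegral_mono_set inter_subset_right
      _ = _ := by
        refine setLIntegral_congr_fun H.isOpen.measurableSet fun x hx => ?_
        simp only [← ofReal_norm, h1 x hx]
  -- The constant is `2M²` from squaring the sum, taken once for each of the two reflections.
  have a2 : ∫⁻ x in ball x₀ ρ \ Ω, ‖h x‖ₑ ^ 2 ≤ 4 * M ^ 2 * l2Sq Ω g := by
    have n2 := (hg.enorm.pow_const 2)
    calc _ ≤ ∫⁻ x in ball x₀ ρ \ Ω, 2 * (M : ℝ≥0∞) ^ 2 *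
            (‖g (shear δ ν 2 x)‖ₑ ^ 2 + ‖g (shear δ ν 3 x)‖ₑ ^ 2) := by
          refine setLIntegral_mono' hm fun x hx => ?_
          have h3 : ‖h x‖ₑ ≤ M * (‖g (shear δ ν 2 x)‖ₑ + ‖g (shear δ ν 3 x)‖ₑ) := by
            have h4 : ‖h x‖₊ ≤ M * (‖g (shear δ ν 2 x)‖₊ + ‖g (shear δ ν 3 x)‖₊) := h2 x hx
            simp only [enorm_eq_nnnorm]
            exact_mod_cast ENNReal.coe_le_coe.2 h4
          refine (pow_le_pow_left' h3 2).trans ?_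
          rw [mul_pow, mul_comm 2, mul_assoc]
          gcongr
          have := ENNReal.rpow_add_le_mul_rpow_add_rpow ‖g (shear δ ν 2 x)‖ₑ
            ‖g (shear δ ν 3 x)‖ₑ (p := 2) (by norm_num)
          norm_num at this
          exact this
      _ = 2 * (M : ℝ≥0∞) ^ 2 * ((∫⁻ x in ball x₀ ρ \ Ω, ‖g (shear δ ν 2 x)‖ₑ ^ 2)
            + ∫⁻ x in ball x₀ ρ \ Ω, ‖g (shear δ ν 3 x)‖ₑ ^ 2) := by
          rw [lintegral_const_mul' _ _ (by finiteness), lintegral_add_left']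
          exact (H.aestronglyMeasurable_shear hρ hρr le_rfl (by norm_num) hg).enorm.pow_const 2
      _ ≤ 2 * (M : ℝ≥0∞) ^ 2 * (l2Sq Ω g + l2Sq Ω g) := by
          gcongr
          · exact H.lintegral_shear_le hρ hρr le_rfl (by norm_num) n2
          · exact H.lintegral_shear_le hρ hρr (by norm_num) le_rfl n2
      _ = _ := by ring
  refine (add_le_add a1 a2).trans (le_of_eq ?_)
  push_cast
  ring

end EpiChart

end FracExt
end
-- The second-order reflection and its weak gradient.
noncomputable section
namespace FracExt
open Filter Topology

variable {d : ℕ}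

/-- The transformation of gradients under the second-order reflection. -/
def comb (ν w a b : Eu d) : Eu d := (3 : ℝ) • a - (2 : ℝ) • b + (6 * ⟪ν, a - b⟫) • w

/-- The coefficient of `w` sees only `a - b`, because `3·2 = 2·3`, and `3 - 2 = 1`. This makes the
gradients match on the graph and gives the cancellation behind `EpiChart.gagOn_cross_le`. -/
theorem comb_self (ν w a : Eu d) : comb ν w a a = a := by
  simp only [comb, sub_self, inner_zero_right, mul_zero, zero_smul, add_zero, ← sub_smul]
  norm_num

theorem comb_sub (ν w a b a' b' : Eu d) :
    comb ν w a b - comb ν w a' b' = comb ν w (a - a') (b - b') := by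
  have : a - a' - (b - b') = (a - b) - (a' - b') := by abel
  simp only [comb, this, inner_sub_right ν (a - b), smul_sub, mul_sub, sub_smul]
  abel

theorem norm_comb_le {ν w : Eu d} (a b : Eu d) (hν : ‖ν‖ = 1) {L : ℝ≥0} (hw : ‖w‖ ≤ L) :
    ‖comb ν w a b‖ ≤ (3 + 6 * L : ℝ≥0) * (‖a‖ + ‖b‖) := by
  have h1 : ‖⟪ν, a - b⟫‖ ≤ ‖a‖ + ‖b‖ := by
    refine (norm_inner_le_norm _ _).trans ?_
    rw [hν, one_mul]
    exact norm_sub_le _ _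
  have h2 : ‖(6 * ⟪ν, a - b⟫) • w‖ ≤ 6 * L * (‖a‖ + ‖b‖) := by
    rw [norm_smul, norm_mul, Real.norm_of_nonneg (by norm_num : (0 : ℝ) ≤ 6)]
    calc 6 * ‖⟪ν, a - b⟫‖ * ‖w‖ ≤ 6 * (‖a‖ + ‖b‖) * L := by gcongr
      _ = _ := by ring
  have h3 : ‖(3 : ℝ) • a - (2 : ℝ) • b‖ ≤ 3 * ‖a‖ + 2 * ‖b‖ := by
    refine (norm_sub_le _ _).trans (le_of_eq ?_)
    rw [norm_smul, norm_smul]; norm_num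
  refine (norm_add_le _ _).trans ((add_le_add h3 h2).trans ?_)
  push_cast
  nlinarith [norm_nonneg b]

open Classical in
/-- Second-order reflection of functions across the graph `{δ = 0}`. -/
def refl (Ω : Set (Eu d)) (δ : Eu d → ℝ) (ν : Eu d) (f : Eu d → ℝ) (x : Eu d) : ℝ :=
  if x ∈ Ω then f x else 3 * f (shear δ ν 2 x) - 2 * f (shear δ ν 3 x)

open Classical in
/-- The gradient of the second-order reflection. -/
def reflGrad (Ω : Set (Eu d)) (δ : Eu d → ℝ) (ν : Eu d) (g : Eu d → Eu d) (x : Eu d) : Eu d :=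
  if x ∈ Ω then g x
  else comb ν (gradient δ x) (g (shear δ ν 2 x)) (g (shear δ ν 3 x))

theorem refl_sub (Ω : Set (Eu d)) (δ : Eu d → ℝ) (ν : Eu d) (f₁ f₂ : Eu d → ℝ) (x : Eu d) :
    refl Ω δ ν f₁ x - refl Ω δ ν f₂ x = refl Ω δ ν (fun x => f₁ x - f₂ x) x := by
  unfold refl; split_ifs <;> ring

theorem reflGrad_sub (Ω : Set (Eu d)) (δ : Eu d → ℝ) (ν : Eu d) (g₁ g₂ : Eu d → Eu d) (x : Eu d) :
    reflGrad Ω δ ν g₁ x - reflGrad Ω δ ν g₂ x = reflGrad Ω δ ν (fun x => g₁ x - g₂ x) x := by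
  unfold reflGrad; split_ifs
  · rfl
  · exact comb_sub _ _ _ _ _ _

theorem tendsto_setIntegral_mul {B : Set (Eu d)} {u : ℕ → Eu d → ℝ} {w ψ : Eu d → ℝ}
    (hu : ∀ n, MemLp (u n) 2 (volume.restrict B)) (hw : MemLp w 2 (volume.restrict B))
    (hψ : Continuous ψ) (hc : HasCompactSupport ψ)
    (h : Tendsto (fun n => l2Sq B (fun x => u n x - w x)) atTop (𝓝 0)) :
    Tendsto (fun n => ∫ x in B, u n x * ψ x) atTop (𝓝 (∫ x in B, w x * ψ x)) := by
  have hψm : MemLp ψ 2 (volume.restrict B) := hψ.memLp_of_hasCompactSupport hc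
  refine tendsto_integral_of_L1' _ (integrable_mul_test hw hψ hc).1
    (Eventually.of_forall fun n => integrable_mul_test (hu n) hψ hc) ?_
  have h1 : Tendsto (fun n => l2Sq B (fun x => u n x - w x) ^ (1 / 2 : ℝ)
      * eLpNorm ψ 2 (volume.restrict B)) atTop (𝓝 0) := by
    have := (ENNReal.continuous_rpow_const (y := (1 / 2 : ℝ))).tendsto 0 |>.comp h
    rw [ENNReal.zero_rpow_of_pos (by norm_num)] at this
    simpa using ENNReal.Tendsto.mul_const this (.inr hψm.2.ne)
  refine tendsto_of_tendsto_of_tendsto_of_le_of_le tendsto_const_nhds h1 (fun _ => zero_le)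
    fun n => ?_
  have := eLpNorm_smul_le_mul_eLpNorm (p := 2) (q := 2) (r := 1) (μ := volume.restrict B)
    hψm.1 ((hu n).sub hw).1
  rw [← eLpNorm_eq_rpow_l2Sq]
  refine le_trans (le_of_eq ?_) this
  congr 1
  ext x
  simp [sub_mul]

namespace EpiChart

variable {Ω : Set (Eu d)} {x₀ ν : Eu d} {r : ℝ} {L : ℝ≥0} {δ : Eu d → ℝ}
  (H : EpiChart Ω x₀ ν r L δ) {ρ : ℝ} (hρ : 0 < ρ) (hρr : (1 + 3 * L) * ρ ≤ r / 2)

include H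

theorem continuous_grad : Continuous (gradient δ) :=
  continuous_gradient (H.contDiff.of_le (by norm_num))

include hρ hρr

theorem memLp_refl {f : Eu d → ℝ} (hf : MemLp f 2 (volume.restrict Ω)) :
    MemLp (refl Ω δ ν f) 2 (volume.restrict (ball x₀ ρ)) ∧
      l2Sq (ball x₀ ρ) (refl Ω δ ν f)
        ≤ ((1 + 4 * (3 + 6 * L) ^ 2 : ℝ≥0) : ℝ≥0∞) * l2Sq Ω f := by
  classical
  have hb : l2Sq (ball x₀ ρ) (refl Ω δ ν f)
      ≤ ((1 + 4 * (3 + 6 * L) ^ 2 : ℝ≥0) : ℝ≥0∞) * l2Sq Ω f := by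
    refine H.l2Sq_le hρ hρr hf.1 (fun x hx => by simp [refl, hx]) fun x hx => ?_
    simp only [refl, hx.2, if_false]
    refine (norm_sub_le _ _).trans ?_
    rw [norm_mul, norm_mul, Real.norm_of_nonneg (by norm_num : (0 : ℝ) ≤ 3),
      Real.norm_of_nonneg (by norm_num : (0 : ℝ) ≤ 2)]
    push_cast
    have h1 : 0 ≤ (L : ℝ) * (‖f (shear δ ν 2 x)‖ + ‖f (shear δ ν 3 x)‖) := by positivity
    linarith [norm_nonneg (f (shear δ ν 3 x))]
  refine ⟨⟨?_, ?_⟩, hb⟩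
  · refine AEStronglyMeasurable.piecewise (s := Ω) H.isOpen.measurableSet ?_ ?_ |>.congr
      (Eventually.of_forall fun x => ?_) (f := Ω.piecewise f
        fun x => 3 * f (shear δ ν 2 x) - 2 * f (shear δ ν 3 x))
    · rw [Measure.restrict_restrict H.isOpen.measurableSet]
      exact hf.1.mono_set inter_subset_left
    · rw [Measure.restrict_restrict H.isOpen.measurableSet.compl, inter_comm, ← sdiff_eq]
      exact ((H.aestronglyMeasurable_shear hρ hρr le_rfl (by norm_num) hf.1).const_mul 3).sub
        ((H.aestronglyMeasurable_shear hρ hρr (by norm_num) le_rfl hf.1).const_mul 2)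
    · rfl
  · rw [eLpNorm_eq_rpow_l2Sq]
    refine ENNReal.rpow_lt_top_of_nonneg (by norm_num) (lt_of_le_of_lt hb ?_).ne
    rw [l2Sq_eq]
    exact ENNReal.mul_lt_top ENNReal.coe_lt_top (ENNReal.pow_lt_top hf.2)

theorem memLp_reflGrad {g : Eu d → Eu d} (hg : MemLp g 2 (volume.restrict Ω)) :
    MemLp (reflGrad Ω δ ν g) 2 (volume.restrict (ball x₀ ρ)) ∧
      l2Sq (ball x₀ ρ) (reflGrad Ω δ ν g)
        ≤ ((1 + 4 * (3 + 6 * L) ^ 2 : ℝ≥0) : ℝ≥0∞) * l2Sq Ω g := by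
  classical
  have hb : l2Sq (ball x₀ ρ) (reflGrad Ω δ ν g)
      ≤ ((1 + 4 * (3 + 6 * L) ^ 2 : ℝ≥0) : ℝ≥0∞) * l2Sq Ω g := by
    refine H.l2Sq_le hρ hρr hg.1 (fun x hx => by simp [reflGrad, hx]) fun x hx => ?_
    simp only [reflGrad, hx.2, if_false]
    exact norm_comb_le _ _ H.norm_eq (H.bound_grad x (H.ball_subset hρ hρr hx.1))
  refine ⟨⟨?_, ?_⟩, hb⟩
  · refine AEStronglyMeasurable.piecewise (s := Ω) H.isOpen.measurableSet ?_ ?_ |>.congr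
      (Eventually.of_forall fun x => ?_) (f := Ω.piecewise g
        fun x => comb ν (gradient δ x) (g (shear δ ν 2 x)) (g (shear δ ν 3 x)))
    · rw [Measure.restrict_restrict H.isOpen.measurableSet]
      exact hg.1.mono_set inter_subset_left
    · rw [Measure.restrict_restrict H.isOpen.measurableSet.compl, inter_comm, ← sdiff_eq]
      have m2 := H.aestronglyMeasurable_shear hρ hρr le_rfl (by norm_num) hg.1
      have m3 := H.aestronglyMeasurable_shear hρ hρr (by norm_num : (2 : ℝ) ≤ 3) le_rfl hg.1
      have mi : AEStronglyMeasurable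
          (fun x => ⟪ν, g (shear δ ν 2 x) - g (shear δ ν 3 x)⟫)
          (volume.restrict (ball x₀ ρ \ Ω)) :=
        (innerSL ℝ ν).continuous.comp_aestronglyMeasurable (m2.sub m3)
      exact ((m2.const_smul (3 : ℝ)).sub (m3.const_smul (2 : ℝ))).add
        ((mi.const_mul 6).smul (H.continuous_grad).aestronglyMeasurable)
    · rfl
  · rw [eLpNorm_eq_rpow_l2Sq]
    refine ENNReal.rpow_lt_top_of_nonneg (by norm_num) (lt_of_le_of_lt hb ?_).ne
    rw [l2Sq_eq]
    exact ENNReal.mul_lt_top ENNReal.coe_lt_top (ENNReal.pow_lt_top hg.2)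

/-- If `f` is differentiable with gradient `g` up to the graph, then its second-order reflection is
differentiable on the whole ball. -/
theorem hasFDerivAt_refl {f : Eu d → ℝ} {g : Eu d → Eu d}
    (h : ∀ x ∈ ball x₀ (r / 2), δ x ≤ 0 → HasFDerivAt f (innerSL ℝ (g x)) x) {x : Eu d}
    (hx : x ∈ ball x₀ ρ) : HasFDerivAt (refl Ω δ ν f) (innerSL ℝ (reflGrad Ω δ ν g x)) x := by
  classical
  have hr0 := H.pos
  have hρr2 : ρ ≤ r / 2 := by
    have : 0 ≤ 3 * L * ρ := by positivity
    linarith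
  have hxr := H.ball_subset hρ hρr hx
  by_cases hxΩ : x ∈ Ω
  · have e : refl Ω δ ν f =ᶠ[𝓝 x] f := by
      filter_upwards [H.isOpen.mem_nhds hxΩ] with y hy
      simp [refl, hy]
    rw [reflGrad, if_pos hxΩ]
    exact (h x (ball_subset_ball hρr2 hx) ((H.mem_iff x hxr).1 hxΩ).le).congr_of_eventuallyEq e
  have hδ := H.nonneg_of_notMem hxr hxΩ
  -- By the chain rule the gradient of `f ∘ S_c` is `g(S_c x) + c⟪ν, g(S_c x)⟫ ∇δ(x)`. With weights
  -- `3` and `-2` at `c = 2, 3`, both normal coefficients become `6` up to sign, which is `comb`.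
  have hS : ∀ c : ℝ, 2 ≤ c → c ≤ 3 → HasFDerivAt (fun x => f (shear δ ν c x))
      (innerSL ℝ (g (shear δ ν c x) + (c * ⟪ν, g (shear δ ν c x)⟫) • gradient δ x)) x := by
    intro c hc hc3
    have h1 := h _ (H.shear_mem hρ hρr (by linarith) hc3 hx) (by
      rw [H.apply_shear]; nlinarith)
    have h2 : HasFDerivAt (fun x => f (shear δ ν c x)) _ x := h1.comp x (H.hasFDerivAt_shear c x)
    refine h2.congr_fderiv ?_
    refine ContinuousLinearMap.ext fun v => ?_
    have hgr : ⟪gradient δ x, v⟫ = fderiv ℝ δ x v := by simp [gradient]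
    simp only [innerSL_apply_apply, ContinuousLinearMap.comp_apply, add_apply,
      ContinuousLinearMap.id_apply, ContinuousLinearMap.smulRight_apply, inner_add_left,
      inner_add_right, inner_smul_left, inner_smul_right, hgr, smul_apply,
      conj_trivial, smul_eq_mul]
    rw [real_inner_comm ν]
    ring
  have hh : HasFDerivAt (fun x => 3 * f (shear δ ν 2 x) - 2 * f (shear δ ν 3 x))
      (innerSL ℝ (reflGrad Ω δ ν g x)) x := by
    have := ((hS 2 le_rfl (by norm_num)).const_mul 3).sub
      ((hS 3 (by norm_num) le_rfl).const_mul 2)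
    refine this.congr_fderiv ?_
    refine ContinuousLinearMap.ext fun v => ?_
    simp only [reflGrad, hxΩ, if_false, comb, innerSL_apply_apply, sub_apply,
      smul_apply, inner_add_left, inner_sub_left, inner_smul_left,
      inner_sub_right, conj_trivial, smul_eq_mul]
    ring
  rcases hδ.eq_or_lt with h0 | hpos
  -- On the graph all shears fix `x`, so both branches have the same value and the same gradient.
  -- The derivatives within `Ω` and within its complement coincide and glue.
  · have hfix : ∀ c : ℝ, shear δ ν c x = x := fun c => by simp [shear, ← h0]
    have hG : reflGrad Ω δ ν g x = g x := by
      rw [reflGrad, if_neg hxΩ, hfix, hfix, comb_self]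
    have hF : refl Ω δ ν f x = f x := by
      rw [refl, if_neg hxΩ, hfix, hfix]; ring
    have h1 : HasFDerivWithinAt (refl Ω δ ν f) (innerSL ℝ (reflGrad Ω δ ν g x)) Ω x := by
      rw [hG]
      refine ((h x (ball_subset_ball hρr2 hx) h0.symm.le).hasFDerivWithinAt).congr
        (fun y hy => ?_) hF
      simp [refl, hy]
    have h2 : HasFDerivWithinAt (refl Ω δ ν f) (innerSL ℝ (reflGrad Ω δ ν g x)) Ωᶜ x := by
      refine hh.hasFDerivWithinAt.congr (fun y hy => ?_) ?_
      · simp only [refl, if_neg hy]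
      · simp only [refl, if_neg hxΩ]
    have := h1.union h2
    rwa [union_compl_self, hasFDerivWithinAt_univ] at this
  · have e : refl Ω δ ν f =ᶠ[𝓝 x] fun x => 3 * f (shear δ ν 2 x) - 2 * f (shear δ ν 3 x) := by
      filter_upwards [isOpen_ball.mem_nhds hxr,
        (isOpen_lt continuous_const H.contDiff.continuous).mem_nhds hpos] with y hy hy2
      have : y ∉ Ω := fun hyΩ => lt_asymm ((H.mem_iff y hy).1 hyΩ) hy2
      simp only [refl, if_neg this]
    exact hh.congr_of_eventuallyEq e

/-- Integration by parts for the reflection of a function differentiable up to the graph. -/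
theorem integral_refl_mul {f : Eu d → ℝ} {g : Eu d → Eu d}
    (hf : MemLp f 2 (volume.restrict Ω)) (hg : MemLp g 2 (volume.restrict Ω))
    (h : ∀ x ∈ ball x₀ (r / 2), δ x ≤ 0 → HasFDerivAt f (innerSL ℝ (g x)) x) :
    WG (ball x₀ ρ) (refl Ω δ ν f) (reflGrad Ω δ ν g) := by
  intro φ hφ hφc hφs i
  have m1 := (H.memLp_refl hρ hρr hf).1
  have m2 := (H.memLp_reflGrad hρ hρr hg).1
  have h0 : ∀ x ∉ ball x₀ ρ, φ x = 0 := fun x hx => by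
    by_contra hne; exact hx (hφs (subset_tsupport φ hne))
  have h0' : ∀ x ∉ ball x₀ ρ, fderiv ℝ φ x = 0 := fun x hx => by
    by_contra hne; exact hx (hφs (support_fderiv_subset ℝ hne))
  have toI : ∀ {w : Eu d → ℝ}, (∀ x ∉ ball x₀ ρ, w x = 0) →
      Integrable w (volume.restrict (ball x₀ ρ)) → Integrable w volume := fun {w} hw hI =>
    (integrableOn_iff_integrable_of_support_subset fun x hx => by
      by_contra hne; exact hx (hw x hne)).1 hI
  have cφ' := continuous_test_deriv hφ (EuclideanSpace.single i (1 : ℝ))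
  have cφ's := hasCompactSupport_test_deriv hφc (EuclideanSpace.single i (1 : ℝ))
  have hd : ∀ x ∈ ball x₀ ρ, fderiv ℝ (refl Ω δ ν f) x (EuclideanSpace.single i 1)
      = reflGrad Ω δ ν g x i := fun x hx => by
    rw [(H.hasFDerivAt_refl hρ hρr h hx).fderiv, innerSL_apply_apply,
      EuclideanSpace.inner_single_right]
    simp
  have hd' : ∀ x, fderiv ℝ (refl Ω δ ν f) x (EuclideanSpace.single i 1) * φ x
      = reflGrad Ω δ ν g x i * φ x := fun x => by
    by_cases hx : x ∈ ball x₀ ρ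
    · rw [hd x hx]
    · simp [h0 x hx]
  -- Continuity of the derivative is not required here: differentiability on the support of `φ` and
  -- integrability of the three products suffice.
  have key := integral_mul_fderiv_eq_neg_fderiv_mul_of_integrable (μ := volume)
    (f := refl Ω δ ν f) (g := φ) (v := EuclideanSpace.single i (1 : ℝ)) (𝕜 := ℝ) ?_ ?_ ?_ ?_ ?_
  · simp only [hd'] at key
    rwa [setIntegral_eq_integral_of_forall_compl_eq_zero fun x hx => by simp [h0' x hx],
      setIntegral_eq_integral_of_forall_compl_eq_zero fun x hx => by simp [h0 x hx]]
  · simp only [hd']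
    exact toI (fun x hx => by simp [h0 x hx])
      (integrable_mul_test (memLp_coord m2 i) hφ.continuous hφc)
  · exact toI (fun x hx => by simp [h0' x hx]) (integrable_mul_test m1 cφ' cφ's)
  · exact toI (fun x hx => by simp [h0 x hx]) (integrable_mul_test m1 hφ.continuous hφc)
  · exact fun x hx => (H.hasFDerivAt_refl hρ hρr h (hφs hx)).differentiableAt
  · exact fun x _ => hφ.differentiable (by simp) x

/-- The weak gradient of the reflection. -/
theorem wg_refl {f : Eu d → ℝ} {g : Eu d → Eu d}
    (hf : MemLp f 2 (volume.restrict Ω)) (hg : MemLp g 2 (volume.restrict Ω)) (h : WG Ω f g) :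
    WG (ball x₀ ρ) (refl Ω δ ν f) (reflGrad Ω δ ν g) := by
  have hr0 := H.pos
  have hL : (0 : ℝ) < L + 2 := by positivity
  -- The size is chosen so that `(L + 2) ε ≤ r / 2`, which keeps `x - z` in the chart for `x` in the
  -- half ball and `z` in the support.
  set ε : ℕ → ℝ := fun n => r / (2 * (L + 2)) * (1 / ((n : ℝ) + 1)) with hε
  have hε0 : ∀ n, 0 < ε n := fun n => by positivity
  have hε1 : ∀ n, (L + 2) * ε n ≤ r / 2 := fun n => by
    have h1 : (1 : ℝ) / ((n : ℝ) + 1) ≤ 1 := by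
      rw [div_le_one (by positivity)]; linarith [n.cast_nonneg (α := ℝ)]
    calc (L + 2) * ε n ≤ (L + 2) * (r / (2 * (L + 2)) * 1) := by
          simp only [hε]; gcongr
      _ = r / 2 := by field_simp
  -- The bump of radius `ε` is centred at `-(L + 1) ε ν`. Thus `x - z` is `x - e` raised by `(L + 1)
  -- ε` along `ν`, with `‖e‖ ≤ ε`, and its height is at most `δ x + L ε - (L + 1) ε < 0` whenever `δ
  -- x ≤ 0`. The mollification only sees `f` inside `Ω` and is differentiable up to the graph.
  choose ρ' hρ' hs using fun n => exists_mollifier ((-((L + 1) * ε n)) • ν : Eu d) (hε0 n)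
  have hz : ∀ n, ∀ z ∈ tsupport (ρ' n), ∃ e : Eu d, ‖e‖ ≤ ε n ∧ z = e - ((L + 1) * ε n) • ν := by
    intro n z hz
    have := hs n hz
    rw [mem_closedBall, dist_eq_norm] at this
    exact ⟨_, this, by rw [neg_smul]; abel⟩
  have hz' : ∀ n, ∀ z ∈ tsupport (ρ' n), ‖z‖ ≤ (L + 2) * ε n := by
    intro n z hz1
    obtain ⟨e, he, rfl⟩ := hz n z hz1
    refine (norm_sub_le _ _).trans ?_
    rw [norm_smul, H.norm_eq, Real.norm_of_nonneg (by have := hε0 n; positivity)]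
    linarith
  have hδ : Tendsto (fun n => (L + 2) * ε n) atTop (𝓝 0) := by
    have := ((tendsto_one_div_add_atTop_nhds_zero_nat (𝕜 := ℝ)).const_mul
      (r / (2 * (L + 2)))).const_mul ((L : ℝ) + 2)
    simpa [hε] using this
  have hin : ∀ n, ∀ x ∈ ball x₀ (r / 2), δ x ≤ 0 → ∀ z ∈ tsupport (ρ' n), x - z ∈ Ω := by
    intro n x hx hx0 z hzs
    have hxz : x - z ∈ ball x₀ r := by
      rw [mem_ball, dist_eq_norm] at *
      calc ‖x - z - x₀‖ = ‖(x - x₀) - z‖ := by congr 1; abel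
        _ ≤ ‖x - x₀‖ + ‖z‖ := norm_sub_le _ _
        _ < r / 2 + r / 2 := add_lt_add_of_lt_of_le hx ((hz' n z hzs).trans (hε1 n))
        _ = r := by ring
    rw [H.mem_iff _ hxz]
    obtain ⟨e, he, rfl⟩ := hz n z hzs
    have e1 : x - (e - ((L + 1) * ε n) • ν) = (x - e) + ((L + 1) * ε n) • ν := by abel
    have hε2 : ε n ≤ r / 2 := by nlinarith [hε1 n, hε0 n, L.coe_nonneg]
    have hxe : x - e ∈ ball x₀ r := by
      rw [mem_ball, dist_eq_norm] at *
      calc ‖x - e - x₀‖ = ‖(x - x₀) - e‖ := by congr 1; abel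
        _ ≤ ‖x - x₀‖ + ‖e‖ := norm_sub_le _ _
        _ < r / 2 + r / 2 := add_lt_add_of_lt_of_le hx (he.trans hε2)
        _ = r := by ring
    rw [e1, H.shift]
    have h3 := H.lip (x - e) hxe x (ball_subset_ball (by linarith) hx)
    have h4 : ‖x - e - x‖ ≤ ε n := by
      rw [show x - e - x = -e by abel, norm_neg]; exact he
    have h5 : δ (x - e) - δ x ≤ L * ε n :=
      (le_abs_self _).trans (h3.trans (by gcongr))
    have := hε0 n
    linarith
  have hF := memLp_indicator H.isOpen.measurableSet hf
  have hG := memLp_indicator H.isOpen.measurableSet hg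
  have tf := tendsto_mol hρ' hδ (fun n z hz => hz' n z (subset_tsupport _ hz)) hF
  have tg := tendsto_mol hρ' hδ (fun n z hz => hz' n z (subset_tsupport _ hz)) hG
  set u := fun n => mol (ρ' n) (Ω.indicator f)
  set w := fun n => mol (ρ' n) (Ω.indicator g)
  have hmem : ∀ {F : Type} [NormedAddCommGroup F] [NormedSpace ℝ F] [CompleteSpace F]
      {k : Eu d → F}, MemLp k 2 (volume.restrict Ω) → ∀ v : Eu d → F, Continuous v →
      l2Sq univ (fun x => v x - Ω.indicator k x) < ⊤ →
      MemLp (fun x => v x - k x) 2 (volume.restrict Ω) ∧ MemLp v 2 (volume.restrict Ω) ∧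
        l2Sq Ω (fun x => v x - k x) ≤ l2Sq univ (fun x => v x - Ω.indicator k x) := by
    intro F _ _ _ k hk v hv hlt
    have hle : l2Sq Ω (fun x => v x - k x) ≤ l2Sq univ (fun x => v x - Ω.indicator k x) := by
      calc l2Sq Ω (fun x => v x - k x) = l2Sq Ω (fun x => v x - Ω.indicator k x) := by
            refine setLIntegral_congr_fun H.isOpen.measurableSet fun x hx => ?_
            simp [hx]
        _ ≤ _ := lintegral_mono_set (subset_univ _)
    have hm : MemLp (fun x => v x - k x) 2 (volume.restrict Ω) := by
      refine ⟨hv.aestronglyMeasurable.sub hk.1, ?_⟩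
      rw [eLpNorm_eq_rpow_l2Sq]
      exact ENNReal.rpow_lt_top_of_nonneg (by norm_num) (hle.trans_lt hlt).ne
    refine ⟨hm, ?_, hle⟩
    have := hm.add hk
    refine this.congr_norm hv.aestronglyMeasurable (Eventually.of_forall fun x => ?_)
    simp
  have hlf : LocallyIntegrable (Ω.indicator f) volume := hF.locallyIntegrable (by norm_num)
  have hlg : LocallyIntegrable (Ω.indicator g) volume := hG.locallyIntegrable (by norm_num)
  have evf := tf.eventually_lt_const (ENNReal.zero_lt_top)
  have evg := tg.eventually_lt_const (ENNReal.zero_lt_top)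
  -- From `N` on the `L²` distances are finite, which places the mollifications in `L²(Ω)`.
  obtain ⟨N, hN⟩ := eventually_atTop.1 (evf.and evg)
  have pf := fun n => hmem hf (u (n + N)) ((hρ' _).continuous_mol hlf) (hN _ (by omega)).1
  have pg := fun n => hmem hg (w (n + N)) ((hρ' _).continuous_mol hlg) (hN _ (by omega)).2
  have wn : ∀ n, WG (ball x₀ ρ) (refl Ω δ ν (u (n + N))) (reflGrad Ω δ ν (w (n + N))) := fun n =>
    H.integral_refl_mul hρ hρr (pf n).2.1 (pg n).2.1 fun x hx hx0 =>
      h.hasFDerivAt_mol H.isOpen.measurableSet hf hg (hρ' _) (hin _ x hx hx0)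
  -- Reflection is linear and bounded in `L²`, so convergence on `Ω` passes to the ball.
  have cf : Tendsto (fun n => l2Sq (ball x₀ ρ)
      (fun x => refl Ω δ ν (u (n + N)) x - refl Ω δ ν f x)) atTop (𝓝 0) := by
    have := ENNReal.Tendsto.const_mul (tf.comp (tendsto_add_atTop_nat N))
      (.inr (ENNReal.coe_ne_top (r := 1 + 4 * (3 + 6 * L) ^ 2)))
    rw [mul_zero] at this
    refine tendsto_of_tendsto_of_tendsto_of_le_of_le tendsto_const_nhds this (fun _ => zero_le)
      fun n => ?_
    simp only [refl_sub]
    refine ((H.memLp_refl hρ hρr (pf n).1).2).trans ?_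
    gcongr
    exact (pf n).2.2
  have cg : Tendsto (fun n => l2Sq (ball x₀ ρ)
      (fun x => reflGrad Ω δ ν (w (n + N)) x - reflGrad Ω δ ν g x)) atTop (𝓝 0) := by
    have := ENNReal.Tendsto.const_mul (tg.comp (tendsto_add_atTop_nat N))
      (.inr (ENNReal.coe_ne_top (r := 1 + 4 * (3 + 6 * L) ^ 2)))
    rw [mul_zero] at this
    refine tendsto_of_tendsto_of_tendsto_of_le_of_le tendsto_const_nhds this (fun _ => zero_le)
      fun n => ?_
    simp only [reflGrad_sub]
    refine ((H.memLp_reflGrad hρ hρr (pg n).1).2).trans ?_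
    gcongr
    exact (pg n).2.2
  intro φ hφ hφc hφs i
  have cφ' := continuous_test_deriv hφ (EuclideanSpace.single i (1 : ℝ))
  have cφ's := hasCompactSupport_test_deriv hφc (EuclideanSpace.single i (1 : ℝ))
  have l1 := tendsto_setIntegral_mul (fun n => (H.memLp_refl hρ hρr (pf n).2.1).1)
    (H.memLp_refl hρ hρr hf).1 cφ' cφ's cf
  have cgi : Tendsto (fun n => l2Sq (ball x₀ ρ)
      (fun x => reflGrad Ω δ ν (w (n + N)) x i - reflGrad Ω δ ν g x i)) atTop (𝓝 0) := by
    refine tendsto_of_tendsto_of_tendsto_of_le_of_le tendsto_const_nhds cg (fun _ => zero_le)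
      fun n => lintegral_mono fun x => ?_
    simp only
    rw [enorm_sq_eq_sum (reflGrad Ω δ ν (w (n + N)) x - reflGrad Ω δ ν g x)]
    exact Finset.single_le_sum (f := fun i => ‖(reflGrad Ω δ ν (w (n + N)) x
      - reflGrad Ω δ ν g x) i‖ₑ ^ 2) (fun _ _ => zero_le) (Finset.mem_univ i)
  have l2 := tendsto_setIntegral_mul
    (fun n => memLp_coord (H.memLp_reflGrad hρ hρr (pg n).2.1).1 i)
    (memLp_coord (H.memLp_reflGrad hρ hρr hg).1 i) hφ.continuous hφc cgi
  refine tendsto_nhds_unique l1 (l2.neg.congr fun n => ?_)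
  exact (wn n φ hφ hφc hφs i).symm

end EpiChart

end FracExt
end
-- The Gagliardo seminorm of the reflected gradient.
noncomputable section
namespace FracExt
open Filter Topology

variable {d : ℕ}

theorem lintegral_lintegral_add_left {α β : Type*} [MeasurableSpace α] [MeasurableSpace β]
    {μ : Measure α} {ν : Measure β} [SFinite μ] [SFinite ν] {g : α → β → ℝ≥0∞}
    (h : α → β → ℝ≥0∞) (hg : AEMeasurable (Function.uncurry g) (μ.prod ν)) :
    ∫⁻ x, ∫⁻ y, (g x y + h x y) ∂ν ∂μ = (∫⁻ x, ∫⁻ y, g x y ∂ν ∂μ) + ∫⁻ x, ∫⁻ y, h x y ∂ν ∂μ := by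
  have h1 : ∀ᵐ x ∂μ, AEMeasurable (fun y => g x y) ν :=
    hg.aestronglyMeasurable.prodMk_left.mono fun x hx => hx.aemeasurable
  refine Eq.trans ?_ (lintegral_add_left' hg.lintegral_prod_right' _)
  refine lintegral_congr_ae ?_
  filter_upwards [h1] with x hx
  exact lintegral_add_left' hx _

theorem gagOn_mono {F : Type*} [NormedAddCommGroup F] (s : ℝ) {A A' B B' : Set (Eu d)}
    (hA : A ⊆ A') (hB : B ⊆ B') (g : Eu d → F) : gagOn s A B g ≤ gagOn s A' B' g :=
  lintegral_mono' (Measure.restrict_mono hA le_rfl) fun _ => lintegral_mono_set hB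

theorem gagOn_comm {F : Type*} [NormedAddCommGroup F] (s : ℝ) {A B : Set (Eu d)} {g : Eu d → F}
    (hA : AEStronglyMeasurable g (volume.restrict A))
    (hB : AEStronglyMeasurable g (volume.restrict B)) : gagOn s A B g = gagOn s B A g := by
  rw [gagOn, lintegral_lintegral_swap (aemeasurable_gagOn s hA hB), gagOn]
  simp only [enorm_sub_rev]

theorem gagOn_congr {F : Type*} [NormedAddCommGroup F] (s : ℝ) {A B : Set (Eu d)}
    {g g' : Eu d → F} (hA : g =ᵐ[volume.restrict A] g') (hB : g =ᵐ[volume.restrict B] g') :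
    gagOn s A B g = gagOn s A B g' := by
  refine lintegral_congr_ae ?_
  filter_upwards [hA] with x hx
  refine lintegral_congr_ae ?_
  filter_upwards [hB] with y hy
  rw [hx, hy]

/-- Splitting the Gagliardo integral along a measurable set. -/
theorem gagOn_split {F : Type*} [NormedAddCommGroup F] (s : ℝ) {B T : Set (Eu d)} {g : Eu d → F}
    (hT : MeasurableSet T) (hB : AEStronglyMeasurable g (volume.restrict B)) :
    gagOn s B B g = gagOn s (B ∩ T) (B ∩ T) g + 2 * gagOn s (B ∩ T) (B \ T) g
      + gagOn s (B \ T) (B \ T) g := by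
  have m1 : AEStronglyMeasurable g (volume.restrict (B ∩ T)) := hB.mono_set inter_subset_left
  have m2 : AEStronglyMeasurable g (volume.restrict (B \ T)) := hB.mono_set sdiff_subset
  have hr : ∀ S : Set (Eu d), AEStronglyMeasurable g (volume.restrict S) →
      gagOn s S B g = gagOn s S (B ∩ T) g + gagOn s S (B \ T) g := by
    intro S hS
    simp only [gagOn]
    rw [← lintegral_add_left' (aemeasurable_gagOn s hS m1).lintegral_prod_right']
    refine lintegral_congr fun x => ?_
    exact (lintegral_inter_add_sdiff _ _ hT).symm
  have hl : gagOn s B B g = gagOn s (B ∩ T) B g + gagOn s (B \ T) B g :=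
    (lintegral_inter_add_sdiff _ _ hT).symm
  rw [hl, hr _ m1, hr _ m2, gagOn_comm s m2 m1]
  ring

theorem div_rpow_le {p : ℝ} (hp : 0 ≤ p) {K : ℝ≥0} (hK : K ≠ 0) {a b : Eu d} (h : ‖a‖ ≤ K * ‖b‖)
    (n : ℝ≥0∞) : n / ‖b‖ₑ ^ p ≤ (K : ℝ≥0∞) ^ p * (n / ‖a‖ₑ ^ p) := by
  have h1 : ‖a‖ₑ ≤ K * ‖b‖ₑ := by
    have h2 : ‖a‖₊ ≤ K * ‖b‖₊ := h
    simp only [enorm_eq_nnnorm]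
    exact_mod_cast ENNReal.coe_le_coe.2 h2
  have hK0 : (K : ℝ≥0∞) ≠ 0 := by exact_mod_cast hK
  have h3 : (K : ℝ≥0∞) ^ p ≠ 0 := (ENNReal.rpow_pos (pos_iff_ne_zero.2 hK0) ENNReal.coe_ne_top).ne'
  have h4 : (K : ℝ≥0∞) ^ p ≠ ⊤ := ENNReal.rpow_ne_top_of_nonneg hp ENNReal.coe_ne_top
  rw [← ENNReal.mul_div_mul_left n (‖b‖ₑ ^ p) h3 h4, ← mul_div_assoc,
    ← ENNReal.mul_rpow_of_nonneg _ _ hp]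
  exact ENNReal.div_le_div_left (ENNReal.rpow_le_rpow h1 hp) _

theorem enorm_sq_le_of_norm_le {F G : Type*} [NormedAddCommGroup F] [NormedAddCommGroup G] {M : ℝ≥0}
    {a : F} {b c : G} (h : ‖a‖ ≤ M * (‖b‖ + ‖c‖)) :
    ‖a‖ₑ ^ 2 ≤ 2 * M ^ 2 * (‖b‖ₑ ^ 2 + ‖c‖ₑ ^ 2) := by
  have h3 : ‖a‖ₑ ≤ M * (‖b‖ₑ + ‖c‖ₑ) := by
    have h4 : ‖a‖₊ ≤ M * (‖b‖₊ + ‖c‖₊) := h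
    simp only [enorm_eq_nnnorm]
    exact_mod_cast ENNReal.coe_le_coe.2 h4
  refine (pow_le_pow_left' h3 2).trans ?_
  rw [mul_pow, mul_comm 2, mul_assoc]
  gcongr
  have := ENNReal.rpow_add_le_mul_rpow_add_rpow ‖b‖ₑ ‖c‖ₑ (p := 2) (by norm_num)
  norm_num at this
  exact this

namespace EpiChart

variable {Ω : Set (Eu d)} {x₀ ν : Eu d} {r : ℝ} {L : ℝ≥0} {δ : Eu d → ℝ}
  (H : EpiChart Ω x₀ ν r L δ) {ρ : ℝ} (hρ : 0 < ρ) (hρr : (1 + 3 * L) * ρ ≤ r / 2)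

include H hρ hρr

/-- Since `comb` fixes the diagonal, `g x` may be written as `comb` of itself, and the difference
becomes `comb` of `g x - g (S₂ y)` and `g x - g (S₃ y)`. The kernel is compared through `‖x - S_c y‖
≤ K‖x - y‖`, and the change of variables `z = S_c y` leads back to `Ω`. -/
theorem gagOn_cross_le {s : ℝ} (hs0 : 0 < s) {g : Eu d → Eu d}
    (hg : AEStronglyMeasurable g (volume.restrict Ω)) :
    gagOn s (ball x₀ ρ ∩ Ω) (ball x₀ ρ \ Ω) (reflGrad Ω δ ν g)
      ≤ 2 * (2 * (3 + 6 * L : ℝ≥0) ^ 2 * ((1 + 3 * L : ℝ≥0) : ℝ≥0∞) ^ ((d : ℝ) + 2 * s))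
        * gagOn s Ω Ω g := by
  classical
  set p : ℝ := (d : ℝ) + 2 * s with hp
  have hp0 : 0 ≤ p := by positivity
  set M : ℝ≥0 := 3 + 6 * L
  set K : ℝ≥0 := 1 + 3 * L with hK
  have hK0 : K ≠ 0 := by positivity
  have hmA : MeasurableSet (ball x₀ ρ ∩ Ω) := measurableSet_ball.inter H.isOpen.measurableSet
  have hmD : MeasurableSet (ball x₀ ρ \ Ω) := measurableSet_ball.diff H.isOpen.measurableSet
  have hfin : 2 * (M : ℝ≥0∞) ^ 2 * (K : ℝ≥0∞) ^ p ≠ ⊤ := by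
    have := ENNReal.rpow_ne_top_of_nonneg hp0 (ENNReal.coe_ne_top (r := K))
    finiteness
  have hinner : ∀ x ∈ ball x₀ ρ ∩ Ω,
      ∫⁻ y in ball x₀ ρ \ Ω, ‖reflGrad Ω δ ν g x - reflGrad Ω δ ν g y‖ₑ ^ 2 / ‖x - y‖ₑ ^ p
        ≤ 2 * (2 * M ^ 2 * (K : ℝ≥0∞) ^ p) * ∫⁻ z in Ω, ‖g x - g z‖ₑ ^ 2 / ‖x - z‖ₑ ^ p := by
    intro x hx
    set h : Eu d → ℝ≥0∞ := fun z => ‖g x - g z‖ₑ ^ 2 / ‖x - z‖ₑ ^ p with hh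
    have mh : AEMeasurable h (volume.restrict Ω) :=
      ((aestronglyMeasurable_const.sub hg).enorm.pow_const 2).div (by fun_prop)
    have xr := H.ball_subset hρ hρr hx.1
    have hpt : ∀ y ∈ ball x₀ ρ \ Ω,
        ‖reflGrad Ω δ ν g x - reflGrad Ω δ ν g y‖ₑ ^ 2 / ‖x - y‖ₑ ^ p
          ≤ 2 * M ^ 2 * (K : ℝ≥0∞) ^ p * (h (shear δ ν 2 y) + h (shear δ ν 3 y)) := by
      intro y hy
      have yr := H.ball_subset hρ hρr hy.1
      have e : reflGrad Ω δ ν g x - reflGrad Ω δ ν g y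
          = comb ν (gradient δ y) (g x - g (shear δ ν 2 y)) (g x - g (shear δ ν 3 y)) := by
        rw [reflGrad, if_pos hx.2, reflGrad, if_neg hy.2, ← comb_sub, comb_self]
      have h1 := enorm_sq_le_of_norm_le
        (norm_comb_le (g x - g (shear δ ν 2 y)) (g x - g (shear δ ν 3 y)) H.norm_eq
          (H.bound_grad y yr))
      rw [← e] at h1
      have d2 : ‖x - shear δ ν 2 y‖ ≤ K * ‖x - y‖ := by
        simpa [hK] using H.norm_sub_shear_le (by norm_num : (0 : ℝ) ≤ 2) (by norm_num) xr yr hx.2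
          hy.2
      have d3 : ‖x - shear δ ν 3 y‖ ≤ K * ‖x - y‖ := by
        simpa [hK] using H.norm_sub_shear_le (by norm_num : (0 : ℝ) ≤ 3) le_rfl xr yr hx.2 hy.2
      calc _ ≤ (2 * (M : ℝ≥0∞) ^ 2 * (‖g x - g (shear δ ν 2 y)‖ₑ ^ 2
              + ‖g x - g (shear δ ν 3 y)‖ₑ ^ 2)) / ‖x - y‖ₑ ^ p := ENNReal.div_le_div_right h1 _
        _ = 2 * (M : ℝ≥0∞) ^ 2 * (‖g x - g (shear δ ν 2 y)‖ₑ ^ 2 / ‖x - y‖ₑ ^ p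
              + ‖g x - g (shear δ ν 3 y)‖ₑ ^ 2 / ‖x - y‖ₑ ^ p) := by
            rw [mul_div_assoc, ENNReal.add_div]
        _ ≤ 2 * (M : ℝ≥0∞) ^ 2 * ((K : ℝ≥0∞) ^ p * h (shear δ ν 2 y)
              + (K : ℝ≥0∞) ^ p * h (shear δ ν 3 y)) := by
            gcongr
            · exact div_rpow_le hp0 hK0 d2 _
            · exact div_rpow_le hp0 hK0 d3 _
        _ = _ := by ring
    calc _ ≤ ∫⁻ y in ball x₀ ρ \ Ω,
            2 * M ^ 2 * (K : ℝ≥0∞) ^ p * (h (shear δ ν 2 y) + h (shear δ ν 3 y)) :=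
          setLIntegral_mono' hmD hpt
      _ = 2 * M ^ 2 * (K : ℝ≥0∞) ^ p * ((∫⁻ y in ball x₀ ρ \ Ω, h (shear δ ν 2 y))
            + ∫⁻ y in ball x₀ ρ \ Ω, h (shear δ ν 3 y)) := by
          rw [lintegral_const_mul' _ _ hfin, lintegral_add_left']
          have hm := H.aestronglyMeasurable_shear hρ hρr le_rfl (by norm_num) hg
          have hc := H.continuous_shear 2
          exact ((aestronglyMeasurable_const.sub hm).enorm.pow_const 2).div (by fun_prop)
      _ ≤ 2 * M ^ 2 * (K : ℝ≥0∞) ^ p * ((∫⁻ z in Ω, h z) + ∫⁻ z in Ω, h z) := by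
          gcongr 2 * M ^ 2 * (K : ℝ≥0∞) ^ p * ?_
          exact add_le_add (H.lintegral_shear_le hρ hρr le_rfl (by norm_num) mh)
            (H.lintegral_shear_le hρ hρr (by norm_num) le_rfl mh)
      _ = _ := by ring
  calc _ ≤ ∫⁻ x in ball x₀ ρ ∩ Ω,
          2 * (2 * M ^ 2 * (K : ℝ≥0∞) ^ p) * ∫⁻ z in Ω, ‖g x - g z‖ₑ ^ 2 / ‖x - z‖ₑ ^ p :=
        setLIntegral_mono' hmA hinner
    _ ≤ ∫⁻ x in Ω,
          2 * (2 * M ^ 2 * (K : ℝ≥0∞) ^ p) * ∫⁻ z in Ω, ‖g x - g z‖ₑ ^ 2 / ‖x - z‖ₑ ^ p :=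
        lintegral_mono_set inter_subset_right
    _ = _ := by
        rw [lintegral_const_mul' _ _ (ENNReal.mul_ne_top (by norm_num) hfin)]
        rfl

theorem lintegral_shear_shear_le (s : ℝ) {c : ℝ} (hc : 2 ≤ c) (hc3 : c ≤ 3) {g : Eu d → Eu d}
    (hg : AEStronglyMeasurable g (volume.restrict Ω)) :
    ∫⁻ x in ball x₀ ρ \ Ω, ∫⁻ y in ball x₀ ρ \ Ω,
      ‖g (shear δ ν c x) - g (shear δ ν c y)‖ₑ ^ 2
        / ‖shear δ ν c x - shear δ ν c y‖ₑ ^ ((d : ℝ) + 2 * s) ≤ gagOn s Ω Ω g := by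
  have m := aemeasurable_gagOn s hg hg
  refine le_trans (lintegral_mono fun x => ?_)
    (H.lintegral_shear_le hρ hρr hc hc3 m.lintegral_prod_right')
  exact H.lintegral_shear_le hρ hρr hc hc3
    (h := fun z => ‖g (shear δ ν c x) - g z‖ₑ ^ 2 / ‖shear δ ν c x - z‖ₑ ^ ((d : ℝ) + 2 * s))
    (((aestronglyMeasurable_const.sub hg).enorm.pow_const 2).div (by fun_prop))

/-- The difference splits into `comb`, with `∇δ(y)` frozen, of the increments of `g ∘ S_c`, and the
increment of `∇δ` times the values at `x`. The first is pulled back to `Ω × Ω`; the second gains `‖x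
- y‖²` after squaring, and the integrable kernel remains. -/
theorem gagOn_outer_le {s : ℝ} (hs0 : 0 < s) {g : Eu d → Eu d}
    (hg : AEStronglyMeasurable g (volume.restrict Ω)) :
    gagOn s (ball x₀ ρ \ Ω) (ball x₀ ρ \ Ω) (reflGrad Ω δ ν g)
      ≤ 8 * ((3 + 6 * L : ℝ≥0) ^ 2 * ((1 + 3 * L : ℝ≥0) : ℝ≥0∞) ^ ((d : ℝ) + 2 * s))
          * gagOn s Ω Ω g
        + 8 * (6 * L : ℝ≥0) ^ 2 * (∫⁻ z : Eu d, kern s z) * l2Sq Ω g := by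
  classical
  set p : ℝ := (d : ℝ) + 2 * s with hp
  have hp0 : 0 ≤ p := by positivity
  set M : ℝ≥0 := 3 + 6 * L
  set N : ℝ≥0 := 6 * L with hN
  set K : ℝ≥0 := 1 + 3 * L with hK
  set D := ball x₀ ρ \ Ω with hD
  have hK0 : K ≠ 0 := by positivity
  have hmD : MeasurableSet D := measurableSet_ball.diff H.isOpen.measurableSet
  have hfin : 4 * (M : ℝ≥0∞) ^ 2 * (K : ℝ≥0∞) ^ p ≠ ⊤ := by
    have := ENNReal.rpow_ne_top_of_nonneg hp0 (ENNReal.coe_ne_top (r := K))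
    finiteness
  -- Points of the small ball are at distance at most `1`, so that `min 1 (‖x - y‖ₑ ^ 2)` is `‖x -
  -- y‖ₑ ^ 2`.
  have hρr2 : 2 * ρ ≤ 1 := by
    have h1 : 0 ≤ 3 * L * ρ := by positivity
    linarith [H.le_one]
  let T : ℝ → Eu d → Eu d → ℝ≥0∞ := fun c x y => ‖g (shear δ ν c x) - g (shear δ ν c y)‖ₑ ^ 2
        / ‖shear δ ν c x - shear δ ν c y‖ₑ ^ p
  let W : Eu d → ℝ≥0∞ := fun x => ‖g (shear δ ν 2 x)‖ₑ ^ 2 + ‖g (shear δ ν 3 x)‖ₑ ^ 2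
  have hpt : ∀ x ∈ D, ∀ y ∈ D,
      ‖reflGrad Ω δ ν g x - reflGrad Ω δ ν g y‖ₑ ^ 2 / ‖x - y‖ₑ ^ p
        ≤ 4 * M ^ 2 * (K : ℝ≥0∞) ^ p * (T 2 x y + T 3 x y)
          + 4 * (N : ℝ≥0∞) ^ 2 * W x * kern s (x - y) := by
    intro x hx y hy
    have xr := H.ball_subset hρ hρr hx.1
    have yr := H.ball_subset hρ hρr hy.1
    set a := g (shear δ ν 2 x)
    set b := g (shear δ ν 3 x)
    set a' := g (shear δ ν 2 y)
    set b' := g (shear δ ν 3 y)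
    have e : reflGrad Ω δ ν g x - reflGrad Ω δ ν g y = comb ν (gradient δ y) (a - a') (b - b')
        + (6 * ⟪ν, a - b⟫) • (gradient δ x - gradient δ y) := by
      rw [reflGrad, if_neg hx.2, reflGrad, if_neg hy.2, ← comb_sub, smul_sub]
      simp only [comb, a, b, a', b']
      abel
    have h1 := enorm_sq_le_of_norm_le (norm_comb_le (a - a') (b - b') H.norm_eq
      (H.bound_grad y yr))
    have hxy : ‖x - y‖ ≤ 1 := by
      have h3 : dist x y ≤ dist x x₀ + dist y x₀ := dist_triangle_right _ _ _
      rw [dist_eq_norm] at h3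
      linarith [mem_ball.1 hx.1, mem_ball.1 hy.1]
    have h2 : ‖(6 * ⟪ν, a - b⟫) • (gradient δ x - gradient δ y)‖ₑ ^ 2
        ≤ 2 * N ^ 2 * W x * min 1 (‖x - y‖ₑ ^ 2) := by
      -- The Lipschitz factor `‖x - y‖` is attached to `a` and `b`, which gives the shape that
      -- `enorm_sq_le_of_norm_le` squares.
      have n1 : ‖(6 * ⟪ν, a - b⟫) • (gradient δ x - gradient δ y)‖
          ≤ N * (‖‖x - y‖ • a‖ + ‖‖x - y‖ • b‖) := by
        rw [norm_smul, norm_mul, Real.norm_of_nonneg (by norm_num : (0 : ℝ) ≤ 6), norm_smul,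
          norm_smul, norm_norm]
        have i1 : ‖⟪ν, a - b⟫‖ ≤ ‖a‖ + ‖b‖ := by
          refine (norm_inner_le_norm _ _).trans ?_
          rw [H.norm_eq, one_mul]
          exact norm_sub_le _ _
        calc 6 * ‖⟪ν, a - b⟫‖ * ‖gradient δ x - gradient δ y‖
            ≤ 6 * (‖a‖ + ‖b‖) * (L * ‖x - y‖) := by
              gcongr
              exact H.lip_grad x xr y yr
          _ = _ := by rw [hN]; push_cast; ring
      refine (enorm_sq_le_of_norm_le n1).trans (le_of_eq ?_)
      have hle : ‖x - y‖ₑ ^ 2 ≤ 1 := by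
        refine pow_le_one' ?_ 2
        rw [← ofReal_norm]
        exact ENNReal.ofReal_le_one.2 hxy
      rw [min_eq_right hle]
      simp only [enorm_smul, enorm_norm, mul_pow, W, a, b]
      ring
    have d2 : ‖shear δ ν 2 x - shear δ ν 2 y‖ ≤ K * ‖x - y‖ := by
      simpa [hK] using H.norm_shear_sub_le (by norm_num : (0 : ℝ) ≤ 2) (by norm_num) xr yr
    have d3 : ‖shear δ ν 3 x - shear δ ν 3 y‖ ≤ K * ‖x - y‖ := by
      simpa [hK] using H.norm_shear_sub_le (by norm_num : (0 : ℝ) ≤ 3) le_rfl xr yr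
    rw [e]
    calc _ ≤ (2 * (‖comb ν (gradient δ y) (a - a') (b - b')‖ₑ ^ 2
            + ‖(6 * ⟪ν, a - b⟫) • (gradient δ x - gradient δ y)‖ₑ ^ 2)) / ‖x - y‖ₑ ^ p :=
          ENNReal.div_le_div_right (enorm_add_sq_le _ _) _
      _ ≤ (2 * (2 * M ^ 2 * (‖a - a'‖ₑ ^ 2 + ‖b - b'‖ₑ ^ 2)
            + 2 * N ^ 2 * W x * min 1 (‖x - y‖ₑ ^ 2))) / ‖x - y‖ₑ ^ p := by
          gcongr ?_ / _
          gcongr 2 * (?_ + ?_)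
      _ = 4 * M ^ 2 * (‖a - a'‖ₑ ^ 2 / ‖x - y‖ₑ ^ p + ‖b - b'‖ₑ ^ 2 / ‖x - y‖ₑ ^ p)
            + 4 * N ^ 2 * W x * kern s (x - y) := by
          rw [kern, ← hp]
          simp only [div_eq_mul_inv]
          ring
      _ ≤ 4 * M ^ 2 * ((K : ℝ≥0∞) ^ p * T 2 x y + (K : ℝ≥0∞) ^ p * T 3 x y)
            + 4 * N ^ 2 * W x * kern s (x - y) := by
          refine add_le_add ?_ le_rfl
          gcongr
          · exact div_rpow_le hp0 hK0 d2 _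
          · exact div_rpow_le hp0 hK0 d3 _
      _ = _ := by ring
  have hgc : ∀ c : ℝ, 2 ≤ c → c ≤ 3 →
      AEStronglyMeasurable (fun x => g (shear δ ν c x)) (volume.restrict D) := fun c hc hc3 =>
    H.aestronglyMeasurable_shear hρ hρr hc hc3 hg
  have mT : ∀ c : ℝ, 2 ≤ c → c ≤ 3 → AEMeasurable (Function.uncurry (T c))
      ((volume.restrict D).prod (volume.restrict D)) := by
    intro c hc hc3
    have h1 := ((hgc c hc hc3).comp_fst (ν := volume.restrict D)).sub
      ((hgc c hc hc3).comp_snd (μ := volume.restrict D))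
    have h2 := H.continuous_shear c
    exact (h1.enorm.pow_const 2).div (by fun_prop)
  have mW : AEMeasurable W (volume.restrict D) :=
    ((hgc 2 le_rfl (by norm_num)).enorm.pow_const 2).add
      ((hgc 3 (by norm_num) le_rfl).enorm.pow_const 2)
  have iW : ∫⁻ x in D, W x ≤ 2 * l2Sq Ω g := by
    have n2 := hg.enorm.pow_const 2
    rw [lintegral_add_left' ((hgc 2 le_rfl (by norm_num)).enorm.pow_const 2), two_mul]
    exact add_le_add (H.lintegral_shear_le hρ hρr le_rfl (by norm_num) n2)
      (H.lintegral_shear_le hρ hρr (by norm_num) le_rfl n2)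
  calc gagOn s D D (reflGrad Ω δ ν g)
      ≤ ∫⁻ x in D, ∫⁻ y in D, (4 * M ^ 2 * (K : ℝ≥0∞) ^ p * (T 2 x y + T 3 x y)
          + 4 * (N : ℝ≥0∞) ^ 2 * W x * kern s (x - y)) :=
        setLIntegral_mono' hmD fun x hx => setLIntegral_mono' hmD fun y hy => hpt x hx y hy
    _ = (∫⁻ x in D, ∫⁻ y in D, 4 * M ^ 2 * (K : ℝ≥0∞) ^ p * (T 2 x y + T 3 x y))
          + ∫⁻ x in D, ∫⁻ y in D, 4 * (N : ℝ≥0∞) ^ 2 * W x * kern s (x - y) :=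
        lintegral_lintegral_add_left _
          (((mT 2 le_rfl (by norm_num)).add (mT 3 (by norm_num) le_rfl)).const_mul _)
    _ ≤ 4 * M ^ 2 * (K : ℝ≥0∞) ^ p * (gagOn s Ω Ω g + gagOn s Ω Ω g)
          + 4 * (N : ℝ≥0∞) ^ 2 * (2 * l2Sq Ω g) * ∫⁻ z : Eu d, kern s z := by
        refine add_le_add ?_ ?_
        · simp only [lintegral_const_mul' _ _ hfin]
          gcongr 4 * M ^ 2 * (K : ℝ≥0∞) ^ p * ?_
          rw [lintegral_lintegral_add_left _ (mT 2 le_rfl (by norm_num))]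
          exact add_le_add (H.lintegral_shear_shear_le hρ hρr s le_rfl (by norm_num) hg)
            (H.lintegral_shear_shear_le hρ hρr s (by norm_num) le_rfl hg)
        · have hk : ∀ x, ∫⁻ y in D, 4 * (N : ℝ≥0∞) ^ 2 * W x * kern s (x - y)
              ≤ 4 * (N : ℝ≥0∞) ^ 2 * W x * ∫⁻ z : Eu d, kern s z := fun x => by
            rw [lintegral_const_mul _ (f := fun y => kern s (x - y))
              ((measurable_kern s).comp (measurable_const.sub measurable_id))]
            gcongr 4 * (N : ℝ≥0∞) ^ 2 * W x * ?_
            refine (setLIntegral_le_lintegral _ _).trans (le_of_eq ?_)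
            exact lintegral_sub_left_eq_self (fun z => kern s z) x
          refine (lintegral_mono hk).trans ?_
          rw [lintegral_mul_const'' _ (mW.const_mul _), lintegral_const_mul' _ _ (by finiteness)]
          gcongr
    _ = _ := by ring

/-- The Gagliardo bound for the gradient of the reflection. -/
theorem gagOn_reflGrad_le (hd : 1 ≤ d) {s : ℝ} (hs0 : 0 < s) (hs1 : s < 1) :
    ∃ C : ℝ≥0, ∀ g : Eu d → Eu d, MemLp g 2 (volume.restrict Ω) →
      gagOn s (ball x₀ ρ) (ball x₀ ρ) (reflGrad Ω δ ν g) ≤ C * (l2Sq Ω g + gagOn s Ω Ω g) := by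
  have hker := (lintegral_kernel_lt_top hd hs0 hs1).ne
  obtain ⟨k, hk⟩ : ∃ k : ℝ≥0, ∫⁻ z : Eu d, kern s z = k :=
    ⟨_, (ENNReal.coe_toNNReal hker).symm⟩
  have hp0 : 0 ≤ (d : ℝ) + 2 * s := by positivity
  obtain ⟨q, hq⟩ : ∃ q : ℝ≥0, ((1 + 3 * L : ℝ≥0) : ℝ≥0∞) ^ ((d : ℝ) + 2 * s) = q :=
    ⟨_, (ENNReal.coe_toNNReal (ENNReal.rpow_ne_top_of_nonneg hp0 ENNReal.coe_ne_top)).symm⟩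
  -- The inside pairs give `1`. The cross term, counted twice, and the outside pairs each give `8(3
  -- + 6L)² q`. The last summand is the `L²` term from the variation of `∇δ`.
  refine ⟨(1 + 16 * (3 + 6 * L) ^ 2 * q) + 8 * (6 * L) ^ 2 * k, fun g hg => ?_⟩
  have h1 := H.gagOn_cross_le hρ hρr hs0 hg.1
  have h2 := H.gagOn_outer_le hρ hρr hs0 hg.1
  have h3 : gagOn s (ball x₀ ρ ∩ Ω) (ball x₀ ρ ∩ Ω) (reflGrad Ω δ ν g) ≤ gagOn s Ω Ω g := by
    have e : reflGrad Ω δ ν g =ᵐ[volume.restrict (ball x₀ ρ ∩ Ω)] g := by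
      refine (ae_restrict_iff' (measurableSet_ball.inter H.isOpen.measurableSet)).2
        (Eventually.of_forall fun x hx => ?_)
      simp [reflGrad, hx.2]
    rw [gagOn_congr s e e]
    exact gagOn_mono s inter_subset_right inter_subset_right g
  rw [hq] at h1 h2
  rw [hk] at h2
  rw [gagOn_split s H.isOpen.measurableSet (H.memLp_reflGrad hρ hρr hg).1.1]
  set X := gagOn s Ω Ω g
  set Y := l2Sq Ω g
  calc _ ≤ X + 2 * (2 * (2 * (3 + 6 * L : ℝ≥0) ^ 2 * (q : ℝ≥0∞)) * X)
        + (8 * ((3 + 6 * L : ℝ≥0) ^ 2 * (q : ℝ≥0∞)) * X + 8 * (6 * L : ℝ≥0) ^ 2 * k * Y) := by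
        gcongr
    _ = ((1 + 16 * (3 + 6 * L) ^ 2 * q : ℝ≥0) : ℝ≥0∞) * X
        + ((8 * (6 * L) ^ 2 * k : ℝ≥0) : ℝ≥0∞) * Y := by push_cast; ring
    _ ≤ (((1 + 16 * (3 + 6 * L) ^ 2 * q) + 8 * (6 * L) ^ 2 * k : ℝ≥0) : ℝ≥0∞) * X
        + (((1 + 16 * (3 + 6 * L) ^ 2 * q) + 8 * (6 * L) ^ 2 * k : ℝ≥0) : ℝ≥0∞) * Y := by
        refine add_le_add ?_ ?_
        · gcongr ?_ * X
          exact ENNReal.coe_le_coe.2 le_self_add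
        · gcongr ?_ * Y
          exact ENNReal.coe_le_coe.2 le_add_self
    _ = _ := by ring

end EpiChart

end FracExt
end
-- Local extension operators.
noncomputable section
namespace FracExt
open Filter Topology

variable {d : ℕ}

/-- A local extension operator `T` from `Ω` to the open set `U`, with `D` acting on gradients. -/
structure LocExt (s : ℝ) (Ω U : Set (Eu d)) (T : (Eu d → ℝ) → Eu d → ℝ)
    (D : (Eu d → Eu d) → Eu d → Eu d) (C : ℝ≥0) : Prop where
  isOpen : IsOpen U
  map_add : ∀ f g x, T (fun y => f y + g y) x = T f x + T g x
  map_smul : ∀ (c : ℝ) f x, T (fun y => c * f y) x = c * T f x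
  apply_of_mem : ∀ f, ∀ x ∈ Ω, T f x = f x
  memLp : ∀ f, MemLp f 2 (volume.restrict Ω) → MemLp (T f) 2 (volume.restrict U)
  memLp_grad : ∀ g, MemLp g 2 (volume.restrict Ω) → MemLp (D g) 2 (volume.restrict U)
  l2Sq_le : ∀ f, MemLp f 2 (volume.restrict Ω) → l2Sq U (T f) ≤ C * l2Sq Ω f
  l2Sq_grad_le : ∀ g, MemLp g 2 (volume.restrict Ω) → l2Sq U (D g) ≤ C * l2Sq Ω g
  gagOn_le : ∀ g, MemLp g 2 (volume.restrict Ω) →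
    gagOn s U U (D g) ≤ C * (l2Sq Ω g + gagOn s Ω Ω g)
  wg : ∀ f g, MemLp f 2 (volume.restrict Ω) → MemLp g 2 (volume.restrict Ω) → WG Ω f g →
    WG U (T f) (D g)

theorem locExt_self (s : ℝ) {Ω : Set (Eu d)} (hΩ : IsOpen Ω) :
    LocExt s Ω Ω (fun f => f) (fun g => g) 1 where
  isOpen := hΩ
  map_add _ _ _ := rfl
  map_smul _ _ _ := rfl
  apply_of_mem _ _ _ := rfl
  memLp _ h := h
  memLp_grad _ h := h
  l2Sq_le _ _ := by simp
  l2Sq_grad_le _ _ := by simp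
  gagOn_le _ _ := by simp
  wg _ _ _ _ h := h

theorem EpiChart.exists_locExt (hd : 1 ≤ d) {s : ℝ} (hs0 : 0 < s) (hs1 : s < 1)
    {Ω : Set (Eu d)} {x₀ ν : Eu d} {r : ℝ} {L : ℝ≥0} {δ : Eu d → ℝ} (H : EpiChart Ω x₀ ν r L δ)
    {ρ : ℝ} (hρ : 0 < ρ) (hρr : (1 + 3 * L) * ρ ≤ r / 2) :
    ∃ C, LocExt s Ω (ball x₀ ρ) (refl Ω δ ν) (reflGrad Ω δ ν) C := by
  obtain ⟨C, hC⟩ := H.gagOn_reflGrad_le hρ hρr hd hs0 hs1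
  refine ⟨C + (1 + 4 * (3 + 6 * L) ^ 2), isOpen_ball, fun f g x => ?_, fun c f x => ?_,
    fun f x hx => by simp [refl, hx], fun f hf => (H.memLp_refl hρ hρr hf).1,
    fun g hg => (H.memLp_reflGrad hρ hρr hg).1, fun f hf => ?_, fun g hg => ?_, fun g hg => ?_,
    fun f g hf hg h => H.wg_refl hρ hρr hf hg h⟩
  · unfold refl; split_ifs <;> ring
  · unfold refl; split_ifs <;> ring
  · refine (H.memLp_refl hρ hρr hf).2.trans ?_
    gcongr ?_ * _
    exact ENNReal.coe_le_coe.2 le_add_self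
  · refine (H.memLp_reflGrad hρ hρr hg).2.trans ?_
    gcongr ?_ * _
    exact ENNReal.coe_le_coe.2 le_add_self
  · refine (hC g hg).trans ?_
    gcongr ?_ * _
    exact ENNReal.coe_le_coe.2 le_self_add

/-- Every point of `closure Ω` has a small neighbourhood with a local extension operator. -/
theorem exists_locExt (hd : 1 ≤ d) {s : ℝ} (hs0 : 0 < s) (hs1 : s < 1) {Ω V : Set (Eu d)}
    (hΩ : IsOpen Ω) (hΩb : Bornology.IsBounded Ω) (hΩ2 : HasC2Boundary Ω) (hV : IsOpen V)
    (hΩV : closure Ω ⊆ V) {x : Eu d} (hx : x ∈ closure Ω) :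
    ∃ U T D C, LocExt s Ω U T D C ∧ x ∈ U ∧ U ⊆ V ∧ Bornology.IsBounded U := by
  by_cases hxΩ : x ∈ Ω
  · exact ⟨Ω, _, _, _, locExt_self s hΩ, hxΩ, subset_closure.trans hΩV, hΩb⟩
  have hxf : x ∈ frontier Ω := by
    rw [hΩ.frontier_eq]; exact ⟨hx, hxΩ⟩
  obtain ⟨ν, r, L, δ, H⟩ := exists_epiChart hΩ hΩ2 hxf
  obtain ⟨R, hR, hRV⟩ := Metric.isOpen_iff.1 hV x (hΩV hx)
  have hr := H.pos
  have hL : 0 < 1 + 3 * (L : ℝ) := by positivity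
  -- The first bound keeps the ball in `V`, the second is the smallness demanded by the chart.
  set ρ := min R (r / 2 / (1 + 3 * L)) with hρ
  have hρ0 : 0 < ρ := lt_min hR (by positivity)
  have hρr : (1 + 3 * L) * ρ ≤ r / 2 := by
    have : ρ ≤ r / 2 / (1 + 3 * L) := min_le_right _ _
    rwa [le_div_iff₀ hL, mul_comm] at this
  obtain ⟨C, hC⟩ := H.exists_locExt hd hs0 hs1 hρ0 hρr
  exact ⟨_, _, _, C, hC, mem_ball_self hρ0, (ball_subset_ball (min_le_left _ _)).trans hRV,
    isBounded_ball⟩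

/-! ### The Poincaré inequality on connected domains. -/

/-- The Poincaré-type inequality on `A × B` for functions with a weak gradient on `Ω`. -/
def PoincareRel (Ω A B : Set (Eu d)) : Prop :=
  ∃ C : ℝ≥0, ∀ (f : Eu d → ℝ) (g : Eu d → Eu d), MemLp f 2 (volume.restrict Ω) →
    MemLp g 2 (volume.restrict Ω) → WG Ω f g →
    ∫⁻ x in A, ∫⁻ y in B, ‖f x - f y‖ₑ ^ 2 ≤ C * l2Sq Ω g

namespace PoincareRel

variable {Ω A A' B B' D : Set (Eu d)}

theorem mono (h : PoincareRel Ω A B) (hA : A' ⊆ A) (hB : B' ⊆ B) : PoincareRel Ω A' B' := by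
  obtain ⟨C, hC⟩ := h
  refine ⟨C, fun f g hf hg hw => le_trans ?_ (hC f g hf hg hw)⟩
  exact lintegral_mono' (Measure.restrict_mono hA le_rfl) fun _ => lintegral_mono_set hB

theorem symm (h : PoincareRel Ω A B) (hA : A ⊆ Ω) (hB : B ⊆ Ω) : PoincareRel Ω B A := by
  obtain ⟨C, hC⟩ := h
  refine ⟨C, fun f g hf hg hw => le_trans (le_of_eq ?_) (hC f g hf hg hw)⟩
  have m : AEMeasurable (fun p : Eu d × Eu d => ‖f p.1 - f p.2‖ₑ ^ 2)
      ((volume.restrict B).prod (volume.restrict A)) :=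
    (((hf.1.mono_set hB).comp_fst).sub ((hf.1.mono_set hA).comp_snd)).enorm.pow_const 2
  rw [lintegral_lintegral_swap m]
  simp only [enorm_sub_rev]

/-- An intermediate point `y ∈ B` is inserted in `f x - f z`, and the result is averaged over `B`.
This is why `B` must have positive finite volume. -/
theorem trans (h₁ : PoincareRel Ω A B) (h₂ : PoincareRel Ω B D) (hB : B ⊆ Ω) (hD : D ⊆ Ω)
    (hAv : volume A ≠ ⊤) (hBv : volume B ≠ ⊤) (hB0 : volume B ≠ 0) (hDv : volume D ≠ ⊤) :
    PoincareRel Ω A D := by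
  obtain ⟨C₁, hC₁⟩ := h₁
  obtain ⟨C₂, hC₂⟩ := h₂.symm hB hD
  lift volume A to ℝ≥0 using hAv with a ha
  lift volume D to ℝ≥0 using hDv with e he
  have hBi : (volume B)⁻¹ ≠ ⊤ := ENNReal.inv_ne_top.2 hB0
  obtain ⟨b, hb⟩ : ∃ b : ℝ≥0, (volume B)⁻¹ = b := ⟨_, (ENNReal.coe_toNNReal hBi).symm⟩
  refine ⟨b * (2 * (e * C₁ + a * C₂)), fun f g hf hg hw => ?_⟩
  have i1 := hC₁ f g hf hg hw
  have i2 := hC₂ f g hf hg hw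
  have mB : ∀ x, AEMeasurable (fun y => ‖f x - f y‖ₑ ^ 2) (volume.restrict B) := fun x =>
    ((aestronglyMeasurable_const.sub (hf.1.mono_set hB)).enorm.pow_const 2)
  have key : volume B * ∫⁻ x in A, ∫⁻ z in D, ‖f x - f z‖ₑ ^ 2
      ≤ 2 * (e * (C₁ * l2Sq Ω g) + a * (C₂ * l2Sq Ω g)) := by
    calc volume B * ∫⁻ x in A, ∫⁻ z in D, ‖f x - f z‖ₑ ^ 2
        = ∫⁻ x in A, ∫⁻ z in D, ∫⁻ _y in B, ‖f x - f z‖ₑ ^ 2 := by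
          rw [← lintegral_const_mul' _ _ hBv]
          refine lintegral_congr fun x => ?_
          rw [← lintegral_const_mul' _ _ hBv]
          refine lintegral_congr fun z => ?_
          rw [setLIntegral_const, mul_comm]
      _ ≤ ∫⁻ x in A, ∫⁻ z in D, ∫⁻ y in B, 2 * (‖f x - f y‖ₑ ^ 2 + ‖f z - f y‖ₑ ^ 2) := by
          refine lintegral_mono fun x => lintegral_mono fun z => lintegral_mono fun y => ?_
          have := enorm_sub_sq_le (f x - f y) (f z - f y)
          rwa [sub_sub_sub_cancel_right] at this
      _ = ∫⁻ x in A, ∫⁻ z in D, 2 * ((∫⁻ y in B, ‖f x - f y‖ₑ ^ 2)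
            + ∫⁻ y in B, ‖f z - f y‖ₑ ^ 2) := by
          refine lintegral_congr fun x => lintegral_congr fun z => ?_
          rw [lintegral_const_mul' _ _ (by norm_num), lintegral_add_left' (mB x)]
      _ = 2 * (e * (∫⁻ x in A, ∫⁻ y in B, ‖f x - f y‖ₑ ^ 2)
            + a * ∫⁻ z in D, ∫⁻ y in B, ‖f z - f y‖ₑ ^ 2) := by
          have : ∀ x, ∫⁻ z in D, 2 * ((∫⁻ y in B, ‖f x - f y‖ₑ ^ 2)
              + ∫⁻ y in B, ‖f z - f y‖ₑ ^ 2)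
              = 2 * (e * (∫⁻ y in B, ‖f x - f y‖ₑ ^ 2)
                + ∫⁻ z in D, ∫⁻ y in B, ‖f z - f y‖ₑ ^ 2) := fun x => by
            rw [lintegral_const_mul' _ _ (by norm_num), lintegral_add_left' aemeasurable_const,
              setLIntegral_const, ← he, mul_comm (e : ℝ≥0∞)]
          simp only [this]
          rw [lintegral_const_mul' _ _ (by norm_num), lintegral_add_right' _ aemeasurable_const,
            setLIntegral_const, lintegral_const_mul' _ _ ENNReal.coe_ne_top, ← ha,
            mul_comm (a : ℝ≥0∞)]
      _ ≤ _ := by gcongr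
  calc ∫⁻ x in A, ∫⁻ z in D, ‖f x - f z‖ₑ ^ 2
      = (volume B)⁻¹ * (volume B * ∫⁻ x in A, ∫⁻ z in D, ‖f x - f z‖ₑ ^ 2) := by
        rw [← mul_assoc, ENNReal.inv_mul_cancel hB0 hBv, one_mul]
    _ ≤ (volume B)⁻¹ * (2 * (e * (C₁ * l2Sq Ω g) + a * (C₂ * l2Sq Ω g))) := by gcongr
    _ = _ := by rw [hb]; push_cast; ring

end PoincareRel

/-- The local Poincaré inequality near a point covered by a local extension operator. -/
theorem LocExt.poincareRel {s : ℝ} {Ω U : Set (Eu d)} {T : (Eu d → ℝ) → Eu d → ℝ}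
    {D : (Eu d → Eu d) → Eu d → Eu d} {C : ℝ≥0} (h : LocExt s Ω U T D C) (hΩ : IsOpen Ω)
    {x₀ : Eu d} (hx₀ : x₀ ∈ U) :
    ∃ ρ > 0, PoincareRel Ω (ball x₀ ρ ∩ Ω) (ball x₀ ρ ∩ Ω) := by
  -- With `ρ = R / 4`, a segment from a point of the `ρ`-ball with direction shorter than `2ρ`,
  -- thickened by `ρ / 2`, stays within `7ρ/2 < R` of the centre.
  obtain ⟨R, hR, hRU⟩ := Metric.isOpen_iff.1 h.isOpen x₀ hx₀
  set ρ := R / 4 with hρ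
  have hρ0 : 0 < ρ := by positivity
  have hBU : ball x₀ ρ ⊆ U := (ball_subset_ball (by linarith)).trans hRU
  set κ : ℝ≥0∞ := ENNReal.ofReal (2 * ρ) ^ 2 * volume (ball (0 : Eu d) (2 * ρ)) with hκ
  have hκt : κ ≠ ⊤ := ENNReal.mul_ne_top (by finiteness) measure_ball_lt_top.ne
  refine ⟨ρ, hρ0, κ.toNNReal * C, fun f g hf hg hw => ?_⟩
  rw [ENNReal.coe_mul, ENNReal.coe_toNNReal hκt, mul_assoc]
  have hu := h.memLp f hf
  have hv := h.memLp_grad g hg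
  -- Segments between points of `ball x₀ ρ ∩ Ω` may leave `Ω`, so `f` is replaced by its local
  -- extension, for which the translation estimate holds across the boundary.
  set w := U.indicator (T f) with hw'
  have hwm : AEStronglyMeasurable w volume := (memLp_indicator h.isOpen.measurableSet hu).1
  have hwf : ∀ x ∈ ball x₀ ρ ∩ Ω, f x = w x := fun x hx => by
    rw [hw', indicator_of_mem (hBU hx.1), h.apply_of_mem f x hx.2]
  have hm : MeasurableSet (ball x₀ ρ ∩ Ω) := measurableSet_ball.inter hΩ.measurableSet
  have mm : AEMeasurable (fun p : Eu d × Eu d => ‖w p.1 - w (p.1 + p.2)‖ₑ ^ 2)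
      ((volume.restrict (ball x₀ ρ)).prod (volume.restrict (ball 0 (2 * ρ)))) := by
    have := ((hwm.comp_fst).sub (aestronglyMeasurable_comp_add hwm)).enorm.pow_const 2
    rw [Measure.prod_restrict]
    exact this.mono_measure Measure.restrict_le_self
  have hinner : ∀ x ∈ ball x₀ ρ, ∫⁻ y in ball x₀ ρ, ‖w x - w y‖ₑ ^ 2
      ≤ ∫⁻ z in ball (0 : Eu d) (2 * ρ), ‖w x - w (x + z)‖ₑ ^ 2 := by
    intro x hx
    rw [← lintegral_indicator measurableSet_ball, ← lintegral_indicator measurableSet_ball,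
      ← lintegral_add_left_eq_self _ x]
    refine lintegral_mono fun z => ?_
    by_cases hz : x + z ∈ ball x₀ ρ
    · have : z ∈ ball (0 : Eu d) (2 * ρ) := by
        rw [mem_ball_zero_iff]
        have h1 := dist_triangle_right (x + z) x x₀
        rw [dist_self_add_left] at h1
        linarith [mem_ball.1 hz, mem_ball.1 hx]
      rw [indicator_of_mem hz, indicator_of_mem this]
    · rw [indicator_of_notMem hz]; exact zero_le
  calc ∫⁻ x in ball x₀ ρ ∩ Ω, ∫⁻ y in ball x₀ ρ ∩ Ω, ‖f x - f y‖ₑ ^ 2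
      = ∫⁻ x in ball x₀ ρ ∩ Ω, ∫⁻ y in ball x₀ ρ ∩ Ω, ‖w x - w y‖ₑ ^ 2 := by
        refine setLIntegral_congr_fun hm fun x hx => setLIntegral_congr_fun hm fun y hy => ?_
        simp only [hwf x hx, hwf y hy]
    _ ≤ ∫⁻ x in ball x₀ ρ, ∫⁻ y in ball x₀ ρ, ‖w x - w y‖ₑ ^ 2 :=
        lintegral_mono' (Measure.restrict_mono inter_subset_left le_rfl) fun _ =>
          lintegral_mono_set inter_subset_left
    _ ≤ ∫⁻ x in ball x₀ ρ, ∫⁻ z in ball (0 : Eu d) (2 * ρ), ‖w x - w (x + z)‖ₑ ^ 2 :=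
        setLIntegral_mono' measurableSet_ball hinner
    _ = ∫⁻ z in ball (0 : Eu d) (2 * ρ), ∫⁻ x in ball x₀ ρ, ‖w x - w (x + z)‖ₑ ^ 2 :=
        lintegral_lintegral_swap mm
    _ ≤ ∫⁻ z in ball (0 : Eu d) (2 * ρ), ENNReal.ofReal (2 * ρ) ^ 2 * l2Sq U (D g) := by
        refine setLIntegral_mono' measurableSet_ball fun z hz => ?_
        rw [mem_ball_zero_iff] at hz
        have hsub : ∀ x ∈ ball x₀ ρ, ∀ t ∈ Icc (0 : ℝ) 1, closedBall (x + t • z) (ρ / 2) ⊆ U := by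
          intro x hx t ht
          refine (closedBall_subset_ball' ?_ : _ ⊆ ball x₀ R).trans hRU
          have h1 := dist_triangle (x + t • z) x x₀
          rw [dist_self_add_left, norm_smul, Real.norm_of_nonneg ht.1] at h1
          have h2 : t * ‖z‖ ≤ 1 * ‖z‖ := by gcongr; exact ht.2
          linarith [mem_ball.1 hx]
        have key := (h.wg f g hf hg hw).translation_le h.isOpen (measurableSet_ball (x := x₀)
          (ε := ρ)) hu hv (by positivity : 0 < ρ / 2) hsub
        calc ∫⁻ x in ball x₀ ρ, ‖w x - w (x + z)‖ₑ ^ 2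
            = l2Sq (ball x₀ ρ) (fun x => T f (x + z) - T f x) := by
              refine setLIntegral_congr_fun measurableSet_ball fun x hx => ?_
              have hxz : x + z ∈ U := by
                refine hsub x hx 1 (by simp) ?_
                rw [one_smul]
                exact mem_closedBall_self (by positivity)
              simp only [hw', indicator_of_mem (hBU hx), indicator_of_mem hxz]
              rw [enorm_sub_rev]
          _ ≤ ‖z‖ₑ ^ 2 * l2Sq U (D g) := key
          _ ≤ _ := by
              gcongr
              rw [← ofReal_norm]
              exact ENNReal.ofReal_le_ofReal hz.le
    _ = κ * l2Sq U (D g) := by rw [setLIntegral_const, hκ]; ring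
    _ ≤ _ := by gcongr; exact h.l2Sq_grad_le g hg

/-- Chaining local Poincaré inequalities over a connected set. -/
theorem poincareRel_of_isConnected {Ω : Set (Eu d)} (hΩ : IsOpen Ω) (hΩb : Bornology.IsBounded Ω)
    (hc : IsConnected Ω)
    (hloc : ∀ x ∈ closure Ω, ∃ ρ > 0, PoincareRel Ω (ball x ρ ∩ Ω) (ball x ρ ∩ Ω)) :
    PoincareRel Ω Ω Ω := by
  have hfin : ∀ A ⊆ Ω, volume A ≠ ⊤ := fun A hA => (hΩb.subset hA).measure_lt_top.ne
  -- Two points are related when some open neighbourhoods of them in `Ω` satisfy the inequality.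
  -- Nearby points are related, and transitivity holds because the two neighbourhoods of the middle
  -- point overlap in a nonempty open set, which has positive volume.
  let R : Eu d → Eu d → Prop := fun x y => ∃ A B : Set (Eu d), IsOpen A ∧ IsOpen B ∧ A ⊆ Ω ∧ B ⊆ Ω ∧
    x ∈ A ∧ y ∈ B ∧ PoincareRel Ω A B
  have hR : ∀ x ∈ Ω, ∀ y ∈ Ω, R x y := by
    intro x hx y hy
    refine hc.isPreconnected.induction₂ R (fun x hx => ?_) (fun x y z _ _ _ h1 h2 => ?_)
      (fun x y _ _ h => ?_) hx hy
    · obtain ⟨ρ, hρ, hP⟩ := hloc x (subset_closure hx)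
      filter_upwards [inter_mem_nhdsWithin Ω (ball_mem_nhds x hρ)] with y hy
      exact ⟨ball x ρ ∩ Ω, ball x ρ ∩ Ω, isOpen_ball.inter hΩ, isOpen_ball.inter hΩ,
        inter_subset_right, inter_subset_right, ⟨mem_ball_self hρ, hx⟩, ⟨hy.2, hy.1⟩, hP⟩
    · obtain ⟨A, B, hA, hB, hAΩ, hBΩ, hxA, hyB, hP⟩ := h1
      obtain ⟨B', D, hB', hD, hB'Ω, hDΩ, hyB', hzD, hP'⟩ := h2
      have hne : volume (B ∩ B') ≠ 0 := ((hB.inter hB').measure_pos _ ⟨y, hyB, hyB'⟩).ne'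
      exact ⟨A, D, hA, hD, hAΩ, hDΩ, hxA, hzD,
        (hP.mono Subset.rfl inter_subset_left).trans (hP'.mono inter_subset_right Subset.rfl)
          (inter_subset_left.trans hBΩ) hDΩ (hfin _ hAΩ) (hfin _ (inter_subset_left.trans hBΩ))
          hne (hfin _ hDΩ)⟩
    · obtain ⟨A, B, hA, hB, hAΩ, hBΩ, hxA, hyB, hP⟩ := h
      exact ⟨B, A, hB, hA, hBΩ, hAΩ, hyB, hxA, hP.symm hAΩ hBΩ⟩
  choose! ρ hρ hP using hloc
  obtain ⟨t, ht, hcov⟩ := hΩb.isCompact_closure.elim_nhds_subcover (fun x => ball x (ρ x))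
    (fun x hx => ball_mem_nhds x (hρ x hx))
  -- The balls of the cover may be centred on the boundary, but each meets `Ω`. The chain goes from
  -- the first ball through small open sets around points of `Ω` in the two balls to the second
  -- ball.
  have hpair : ∀ x ∈ t, ∀ y ∈ t, PoincareRel Ω (ball x (ρ x) ∩ Ω) (ball y (ρ y) ∩ Ω) := by
    intro x hx y hy
    have hne : ∀ z ∈ t, ∃ z', z' ∈ ball z (ρ z) ∩ Ω := fun z hz => by
      obtain ⟨z', h1, h2⟩ := mem_closure_iff_nhds.1 (ht z hz) _ (ball_mem_nhds z (hρ z (ht z hz)))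
      exact ⟨z', h1, h2⟩
    obtain ⟨x', hx'⟩ := hne x hx
    obtain ⟨y', hy'⟩ := hne y hy
    obtain ⟨A, B, hA, hB, hAΩ, hBΩ, hxA, hyB, hAB⟩ := hR x' hx'.2 y' hy'.2
    have n1 : volume (ball x (ρ x) ∩ Ω ∩ A) ≠ 0 :=
      (((isOpen_ball.inter hΩ).inter hA).measure_pos _ ⟨x', hx', hxA⟩).ne'
    have n2 : volume (ball y (ρ y) ∩ Ω ∩ B) ≠ 0 :=
      (((isOpen_ball.inter hΩ).inter hB).measure_pos _ ⟨y', hy', hyB⟩).ne'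
    have s1 : ball x (ρ x) ∩ Ω ∩ A ⊆ Ω := inter_subset_right.trans hAΩ
    have s2 : ball y (ρ y) ∩ Ω ∩ B ⊆ Ω := inter_subset_right.trans hBΩ
    have p1 : PoincareRel Ω (ball x (ρ x) ∩ Ω) (ball y (ρ y) ∩ Ω ∩ B) :=
      ((hP x (ht x hx)).mono Subset.rfl inter_subset_left).trans
        (hAB.mono inter_subset_right inter_subset_right) s1 s2
        (hfin _ inter_subset_right) (hfin _ s1) n1 (hfin _ s2)
    exact p1.trans ((hP y (ht y hy)).mono inter_subset_left Subset.rfl) s2 inter_subset_right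
      (hfin _ inter_subset_right) (hfin _ s2) n2 (hfin _ inter_subset_right)
  choose! C hC using hpair
  refine ⟨∑ x ∈ t, ∑ y ∈ t, C x y, fun f g hf hg hw => ?_⟩
  have hΩt : Ω ⊆ ⋃ x ∈ t, ball x (ρ x) ∩ Ω := fun z hz => by
    obtain ⟨x, hx, hzx⟩ := mem_iUnion₂.1 (hcov (subset_closure hz))
    exact mem_iUnion₂.2 ⟨x, hx, hzx, hz⟩
  have hsum : ∀ k : Eu d → ℝ≥0∞, ∫⁻ x in Ω, k x ≤ ∑ i ∈ t, ∫⁻ x in ball i (ρ i) ∩ Ω, k x := by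
    intro k
    have hle : volume.restrict Ω ≤ ∑ i ∈ t, volume.restrict (ball i (ρ i) ∩ Ω) := by
      refine (Measure.restrict_mono hΩt le_rfl).trans ?_
      refine Measure.le_iff.2 fun S hS => ?_
      rw [Measure.restrict_apply hS, Measure.finsetSum_apply]
      have : S ∩ ⋃ x ∈ t, ball x (ρ x) ∩ Ω = ⋃ x ∈ t, S ∩ (ball x (ρ x) ∩ Ω) := by
        simp only [inter_iUnion]
      rw [this]
      refine (measure_biUnion_finset_le _ _).trans (le_of_eq ?_)
      exact Finset.sum_congr rfl fun i _ => (Measure.restrict_apply hS).symm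
    refine (lintegral_mono' hle le_rfl).trans (le_of_eq ?_)
    rw [lintegral_finsetSum_measure]
  have m : ∀ A ⊆ Ω, ∀ B ⊆ Ω, AEMeasurable (fun p : Eu d × Eu d => ‖f p.1 - f p.2‖ₑ ^ 2)
      ((volume.restrict A).prod (volume.restrict B)) := fun A hA B hB =>
    (((hf.1.mono_set hA).comp_fst).sub ((hf.1.mono_set hB).comp_snd)).enorm.pow_const 2
  calc ∫⁻ x in Ω, ∫⁻ y in Ω, ‖f x - f y‖ₑ ^ 2
      ≤ ∑ i ∈ t, ∫⁻ x in ball i (ρ i) ∩ Ω, ∫⁻ y in Ω, ‖f x - f y‖ₑ ^ 2 := hsum _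
    _ ≤ ∑ i ∈ t, ∫⁻ x in ball i (ρ i) ∩ Ω, ∑ j ∈ t, ∫⁻ y in ball j (ρ j) ∩ Ω, ‖f x - f y‖ₑ ^ 2 :=
        Finset.sum_le_sum fun i _ => lintegral_mono fun x => hsum _
    _ = ∑ i ∈ t, ∑ j ∈ t, ∫⁻ x in ball i (ρ i) ∩ Ω, ∫⁻ y in ball j (ρ j) ∩ Ω,
          ‖f x - f y‖ₑ ^ 2 := by
        refine Finset.sum_congr rfl fun i _ => ?_
        exact lintegral_finsetSum' _ fun j _ =>
          (m _ inter_subset_right _ inter_subset_right).lintegral_prod_right'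
    _ ≤ ∑ i ∈ t, ∑ j ∈ t, C i j * l2Sq Ω g :=
        Finset.sum_le_sum fun i hi => Finset.sum_le_sum fun j hj => hC i hi j hj f g hf hg hw
    _ = _ := by
        push_cast
        simp only [Finset.sum_mul]

/-- The Poincaré inequality for functions of mean zero. -/
theorem PoincareRel.l2Sq_le {Ω : Set (Eu d)} (hΩv : volume Ω ≠ ⊤) (hΩ0 : volume Ω ≠ 0)
    (h : PoincareRel Ω Ω Ω) :
    ∃ C : ℝ≥0, ∀ (f : Eu d → ℝ) (g : Eu d → Eu d), MemLp f 2 (volume.restrict Ω) →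
      MemLp g 2 (volume.restrict Ω) → WG Ω f g → ∫ x in Ω, f x = 0 →
      l2Sq Ω f ≤ C * l2Sq Ω g := by
  obtain ⟨C, hC⟩ := h
  have hvi : (volume Ω)⁻¹ ≠ ⊤ := ENNReal.inv_ne_top.2 hΩ0
  obtain ⟨b, hb⟩ : ∃ b : ℝ≥0, (volume Ω)⁻¹ = b := ⟨_, (ENNReal.coe_toNNReal hvi).symm⟩
  refine ⟨b * C, fun f g hf hg hw h0 => ?_⟩
  have : IsFiniteMeasure (volume.restrict Ω) := ⟨by simpa using hΩv.lt_top⟩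
  have hi : Integrable f (volume.restrict Ω) := hf.integrable (by norm_num)
  -- For mean zero, `f x` is the average over `y` of `f x - f y`, and Jensen's inequality bounds its
  -- square.
  have hpt : ∀ x, ‖f x‖ₑ ^ 2 ≤ (volume Ω)⁻¹ * ∫⁻ y in Ω, ‖f x - f y‖ₑ ^ 2 := by
    intro x
    have e : ∫ y in Ω, (f x - f y) = volume.real Ω * f x := by
      rw [integral_sub (integrable_const _) hi, h0, setIntegral_const, sub_zero, smul_eq_mul]
    have e1 : ‖f x‖ₑ ≤ ∫⁻ y in Ω, (volume Ω)⁻¹ * ‖f x - f y‖ₑ := by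
      have h1 := enorm_integral_le_lintegral_enorm (μ := volume.restrict Ω) (fun y => f x - f y)
      rw [e, enorm_mul, Real.enorm_of_nonneg measureReal_nonneg, ofReal_measureReal hΩv] at h1
      rw [lintegral_const_mul' _ _ hvi]
      calc ‖f x‖ₑ = (volume Ω)⁻¹ * (volume Ω * ‖f x‖ₑ) := by
            rw [← mul_assoc, ENNReal.inv_mul_cancel hΩ0 hΩv, one_mul]
        _ ≤ _ := by gcongr
    refine (pow_le_pow_left' e1 2).trans ?_
    rw [← lintegral_const_mul' _ _ hvi]
    refine lintegral_mul_sq_le aemeasurable_const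
      ((aestronglyMeasurable_const.sub hf.1).enorm) ?_
    rw [setLIntegral_const, ENNReal.inv_mul_cancel hΩ0 hΩv]
  calc l2Sq Ω f ≤ ∫⁻ x in Ω, (volume Ω)⁻¹ * ∫⁻ y in Ω, ‖f x - f y‖ₑ ^ 2 := lintegral_mono hpt
    _ = b * ∫⁻ x in Ω, ∫⁻ y in Ω, ‖f x - f y‖ₑ ^ 2 := by
        rw [lintegral_const_mul' _ _ hvi, hb]
    _ ≤ b * (C * l2Sq Ω g) := by gcongr; exact hC f g hf hg hw
    _ = _ := by push_cast; ring

end FracExt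
end
-- Gluing by a partition of unity.
noncomputable section
namespace FracExt
open Filter Topology

variable {d : ℕ}

/-- A bounded linear operator `T` from functions on `Ω` to functions on the whole space, together
with a formula `G f g` for the gradient of `T f` in terms of `f` and its gradient `g`. -/
structure BddOp (s : ℝ) (Ω : Set (Eu d)) (T : (Eu d → ℝ) → Eu d → ℝ)
    (G : (Eu d → ℝ) → (Eu d → Eu d) → Eu d → Eu d) (C : ℝ≥0) : Prop where
  map_add : ∀ f g x, T (fun y => f y + g y) x = T f x + T g x
  map_smul : ∀ (c : ℝ) f x, T (fun y => c * f y) x = c * T f x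
  memLp : ∀ f, MemLp f 2 (volume.restrict Ω) → MemLp (T f) 2 (volume.restrict univ)
  memLp_grad : ∀ f g, MemLp f 2 (volume.restrict Ω) → MemLp g 2 (volume.restrict Ω) →
    MemLp (G f g) 2 (volume.restrict univ)
  l2Sq_le : ∀ f, MemLp f 2 (volume.restrict Ω) → l2Sq univ (T f) ≤ C * l2Sq Ω f
  l2Sq_grad_le : ∀ f g, MemLp f 2 (volume.restrict Ω) → MemLp g 2 (volume.restrict Ω) →
    l2Sq univ (G f g) ≤ C * (l2Sq Ω f + l2Sq Ω g)
  gagOn_le : ∀ f g, MemLp f 2 (volume.restrict Ω) → MemLp g 2 (volume.restrict Ω) → WG Ω f g →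
    gagOn s univ univ (G f g) ≤ C * (l2Sq Ω f + l2Sq Ω g + gagOn s Ω Ω g)
  wg : ∀ f g, MemLp f 2 (volume.restrict Ω) → MemLp g 2 (volume.restrict Ω) → WG Ω f g →
    WG univ (T f) (G f g)

theorem LocExt.exists_bddOp (hd : 1 ≤ d) {s : ℝ} (hs0 : 0 < s) (hs1 : s < 1) {Ω U : Set (Eu d)}
    {T : (Eu d → ℝ) → Eu d → ℝ} {D : (Eu d → Eu d) → Eu d → Eu d} {C : ℝ≥0}
    (h : LocExt s Ω U T D C) {χ : Eu d → ℝ} (hχ : ContDiff ℝ ∞ χ) (hc : HasCompactSupport χ)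
    (hs : tsupport χ ⊆ U) :
    ∃ C', BddOp s Ω (fun f x => χ x * T f x)
      (fun f g x => χ x • D g x + T f x • gradient χ x) C' := by
  obtain ⟨A, hA⟩ := cutoff_bounds h.isOpen hχ hc hs
  obtain ⟨B, hB⟩ := WG.cutoff_gagOn_le hd hs0 hs1 h.isOpen hχ hc hs
  have hzero : MemLp (0 : Eu d → Eu d) 2 (volume.restrict U) := MemLp.zero
  have hAC : A * C ≤ (A + 2 * B) * C := mul_le_mul_left le_self_add C
  -- The factor `2` in `2 * B` is there because the Gagliardo bound meets `‖g‖²` twice, from the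
  -- `L²` and from the seminorm estimate of `D g`.
  refine ⟨(A + 2 * B) * C, ?_, ?_, ?_, ?_, ?_, ?_, ?_, ?_⟩
  · intro f g x
    rw [h.map_add]; ring
  · intro c f x
    rw [h.map_smul]; ring
  · exact fun f hf => (hA _ _ (h.memLp f hf) hzero).1
  · exact fun f g hf hg => (hA _ _ (h.memLp f hf) (h.memLp_grad g hg)).2.1
  · intro f hf
    calc _ ≤ A * l2Sq U (T f) := (hA _ _ (h.memLp f hf) hzero).2.2.1
      _ ≤ A * (C * l2Sq Ω f) := mul_le_mul_right (h.l2Sq_le f hf) _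
      _ = (A * C : ℝ≥0) * l2Sq Ω f := by push_cast; ring
      _ ≤ _ := mul_le_mul_left (ENNReal.coe_le_coe.2 hAC) _
  · intro f g hf hg
    calc _ ≤ A * (l2Sq U (T f) + l2Sq U (D g)) :=
          (hA _ _ (h.memLp f hf) (h.memLp_grad g hg)).2.2.2
      _ ≤ A * (C * l2Sq Ω f + C * l2Sq Ω g) :=
          mul_le_mul_right (add_le_add (h.l2Sq_le f hf) (h.l2Sq_grad_le g hg)) _
      _ = (A * C : ℝ≥0) * (l2Sq Ω f + l2Sq Ω g) := by push_cast; ring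
      _ ≤ _ := mul_le_mul_left (ENNReal.coe_le_coe.2 hAC) _
  · intro f g hf hg hw
    calc _ ≤ B * (l2Sq U (T f) + l2Sq U (D g) + gagOn s U U (D g)) :=
          hB _ _ (h.memLp f hf) (h.memLp_grad g hg) (h.wg f g hf hg hw)
      _ ≤ B * (C * l2Sq Ω f + C * l2Sq Ω g + C * (l2Sq Ω g + gagOn s Ω Ω g)) :=
          mul_le_mul_right (add_le_add (add_le_add (h.l2Sq_le f hf) (h.l2Sq_grad_le g hg))
            (h.gagOn_le g hg)) _
      -- Nonnegative slack is added so that the total is exactly the common constant times the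
      -- right-hand side.
      _ ≤ B * (C * l2Sq Ω f + C * l2Sq Ω g + C * (l2Sq Ω g + gagOn s Ω Ω g))
          + (B * C * (l2Sq Ω f + gagOn s Ω Ω g) +
            A * C * (l2Sq Ω f + l2Sq Ω g + gagOn s Ω Ω g)) := le_self_add
      _ = _ := by push_cast; ring
  · exact fun f g hf hg hw => (h.wg f g hf hg hw).cutoff hχ hs (h.memLp f hf) (h.memLp_grad g hg)

theorem BddOp.zero (s : ℝ) (Ω : Set (Eu d)) : BddOp s Ω (fun _ _ => 0) (fun _ _ _ => 0) 0 where
  map_add := by simp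
  map_smul := by simp
  memLp _ _ := MemLp.zero
  memLp_grad _ _ _ _ := MemLp.zero
  l2Sq_le := by simp [l2Sq]
  l2Sq_grad_le := by simp [l2Sq]
  gagOn_le := by simp [gagOn]
  wg := by intro f g _ _ _ φ _ _ _ i; simp

theorem l2Sq_add_le {F : Type*} [NormedAddCommGroup F] {U : Set (Eu d)} {f g : Eu d → F}
    (hf : AEStronglyMeasurable f (volume.restrict U)) :
    l2Sq U (fun x => f x + g x) ≤ 2 * (l2Sq U f + l2Sq U g) := by
  unfold l2Sq
  rw [← lintegral_add_left' (hf.enorm.pow_const 2), ← lintegral_const_mul' _ _ (by norm_num)]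
  exact lintegral_mono fun x => enorm_add_sq_le _ _

theorem WG.add {U : Set (Eu d)} {f₁ f₂ : Eu d → ℝ} {g₁ g₂ : Eu d → Eu d}
    (hf₁ : MemLp f₁ 2 (volume.restrict U)) (hf₂ : MemLp f₂ 2 (volume.restrict U))
    (hg₁ : MemLp g₁ 2 (volume.restrict U)) (hg₂ : MemLp g₂ 2 (volume.restrict U))
    (h₁ : WG U f₁ g₁) (h₂ : WG U f₂ g₂) :
    WG U (fun x => f₁ x + f₂ x) (fun x => g₁ x + g₂ x) := by
  intro φ hφ hc hs i
  have hd := continuous_test_deriv hφ (EuclideanSpace.single i 1)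
  have hdc := hasCompactSupport_test_deriv hc (EuclideanSpace.single i (1 : ℝ))
  simp only [PiLp.add_apply, add_mul]
  rw [integral_add (integrable_mul_test hf₁ hd hdc) (integrable_mul_test hf₂ hd hdc),
    integral_add (integrable_mul_test (memLp_coord hg₁ i) hφ.continuous hc)
    (integrable_mul_test (memLp_coord hg₂ i) hφ.continuous hc), h₁ φ hφ hc hs i, h₂ φ hφ hc hs i]
  ring

theorem BddOp.add {s : ℝ} {Ω : Set (Eu d)} {T₁ T₂ : (Eu d → ℝ) → Eu d → ℝ}
    {G₁ G₂ : (Eu d → ℝ) → (Eu d → Eu d) → Eu d → Eu d} {C₁ C₂ : ℝ≥0} (h₁ : BddOp s Ω T₁ G₁ C₁)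
    (h₂ : BddOp s Ω T₂ G₂ C₂) :
    BddOp s Ω (fun f x => T₁ f x + T₂ f x) (fun f g x => G₁ f g x + G₂ f g x)
      (2 * (C₁ + C₂)) where
  map_add f g x := by rw [h₁.map_add, h₂.map_add]; ring
  map_smul c f x := by rw [h₁.map_smul, h₂.map_smul]; ring
  memLp f hf := (h₁.memLp f hf).add (h₂.memLp f hf)
  memLp_grad f g hf hg := (h₁.memLp_grad f g hf hg).add (h₂.memLp_grad f g hf hg)
  l2Sq_le f hf := by
    refine (l2Sq_add_le (h₁.memLp f hf).1).trans ((mul_le_mul_right (add_le_add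
      (h₁.l2Sq_le f hf) (h₂.l2Sq_le f hf)) _).trans_eq ?_)
    push_cast; ring
  l2Sq_grad_le f g hf hg := by
    refine (l2Sq_add_le (h₁.memLp_grad f g hf hg).1).trans ((mul_le_mul_right (add_le_add
      (h₁.l2Sq_grad_le f g hf hg) (h₂.l2Sq_grad_le f g hf hg)) _).trans_eq ?_)
    push_cast; ring
  gagOn_le f g hf hg hw := by
    have m := (h₁.memLp_grad f g hf hg).1
    refine (gagOn_add_le s m m).trans ((mul_le_mul_right (add_le_add
      (h₁.gagOn_le f g hf hg hw) (h₂.gagOn_le f g hf hg hw)) _).trans_eq ?_)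
    push_cast; ring
  wg f g hf hg hw := (h₁.wg f g hf hg hw).add (h₁.memLp f hf) (h₂.memLp f hf)
    (h₁.memLp_grad f g hf hg) (h₂.memLp_grad f g hf hg) (h₂.wg f g hf hg hw)

theorem BddOp.exists_sum {s : ℝ} {Ω : Set (Eu d)} {ι : Type*} (t : Finset ι)
    {T : ι → (Eu d → ℝ) → Eu d → ℝ} {G : ι → (Eu d → ℝ) → (Eu d → Eu d) → Eu d → Eu d}
    (h : ∀ i, ∃ C, BddOp s Ω (T i) (G i) C) :
    ∃ C, BddOp s Ω (fun f x => ∑ i ∈ t, T i f x) (fun f g x => ∑ i ∈ t, G i f g x) C := by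
  classical
  induction t using Finset.induction_on with
  | empty => exact ⟨0, by simpa using BddOp.zero s Ω⟩
  | insert i t hi ih =>
    obtain ⟨C₁, h₁⟩ := h i
    obtain ⟨C₂, h₂⟩ := ih
    simp only [Finset.sum_insert hi]
    exact ⟨_, h₁.add h₂⟩

/-- The extension operator on functions, before passing to classes. -/
theorem exists_bddOp (hd : 1 ≤ d) {s : ℝ} (hs0 : 0 < s) (hs1 : s < 1) {Ω V : Set (Eu d)}
    (hΩ : IsOpen Ω) (hΩb : Bornology.IsBounded Ω) (hΩ2 : HasC2Boundary Ω) (hV : IsOpen V)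
    (hΩV : closure Ω ⊆ V) :
    ∃ T G C, BddOp s Ω T G C ∧ (∀ f, ∀ x ∈ Ω, T f x = f x) ∧
      ∃ K : Set (Eu d), IsCompact K ∧ K ⊆ V ∧ ∀ f, ∀ x ∉ K, T f x = 0 := by
  choose! U T D C hE hxU hUV hUb using
    fun x (hx : x ∈ closure Ω) => exists_locExt hd hs0 hs1 hΩ hΩb hΩ2 hV hΩV hx
  obtain ⟨t, ht, hcov⟩ := hΩb.isCompact_closure.elim_nhds_subcover U
    fun x hx => (hE x hx).isOpen.mem_nhds (hxU x hx)
  have htU : ∀ i : t, LocExt s Ω (U i) (T i) (D i) (C i) := fun i => hE i (ht i i.2)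
  -- The functions sum to one on `closure Ω`, where each local operator reproduces `f` at points of
  -- `Ω`. So does the glued one, and its support lies in the union of the supports of the `χ i`,
  -- whatever `f` is.
  obtain ⟨χ, hχ⟩ := SmoothPartitionOfUnity.exists_isSubordinate (modelWithCornersSelf ℝ (Eu d))
    (isClosed_closure (s := Ω)) (fun i : t => U i) (fun i => (htU i).isOpen)
    (hcov.trans fun x hx => by
      obtain ⟨i, hi, hx⟩ := mem_iUnion₂.1 hx
      exact mem_iUnion.2 ⟨⟨i, hi⟩, hx⟩)
  have hsm : ∀ i, ContDiff ℝ ∞ (χ i) := fun i => contMDiff_iff_contDiff.1 (χ i).contMDiff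
  have hcs : ∀ i, HasCompactSupport (χ i) := fun i =>
    isCompact_of_isClosed_isBounded (isClosed_tsupport _) ((hUb i (ht i i.2)).subset (hχ i))
  obtain ⟨C', hC'⟩ := BddOp.exists_sum (s := s) (Ω := Ω) Finset.univ fun i =>
    (htU i).exists_bddOp hd hs0 hs1 (hsm i) (hcs i) (hχ i)
  refine ⟨_, _, C', hC', fun f x hx => ?_, ⋃ i, tsupport (χ i), isCompact_iUnion hcs,
    iUnion_subset fun i => (hχ i).trans (hUV i (ht i i.2)), fun f x hx => ?_⟩
  · have h1 := χ.sum_eq_one (subset_closure hx)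
    rw [finsum_eq_sum_of_fintype] at h1
    simp only [(htU _).apply_of_mem f x hx, ← Finset.sum_mul, h1, one_mul]
  · refine Finset.sum_eq_zero fun i _ => ?_
    rw [image_eq_zero_of_notMem_tsupport fun hi => hx (mem_iUnion.2 ⟨i, hi⟩), zero_mul]

/-! ### From functions to classes, and from squared norms to norms. -/

namespace BddOp

variable {s : ℝ} {Ω : Set (Eu d)} {T : (Eu d → ℝ) → Eu d → ℝ}
  {G : (Eu d → ℝ) → (Eu d → Eu d) → Eu d → Eu d} {C : ℝ≥0} (h : BddOp s Ω T G C)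
include h

/-- By linearity the `L²` bound applies to the difference, written `f + (-1) f'`, whose norm is
zero. Thus the operator respects equality a.e. and is well defined and linear on classes. -/
theorem congr {f f' : Eu d → ℝ} (hf : MemLp f 2 (volume.restrict Ω))
    (hff' : f =ᵐ[volume.restrict Ω] f') : T f =ᵐ[volume.restrict univ] T f' := by
  have hf' : MemLp f' 2 (volume.restrict Ω) := hf.ae_eq hff'
  have hm : MemLp (fun x => f x + -1 * f' x) 2 (volume.restrict Ω) :=
    hf.add (hf'.const_mul (-1))
  have h0 : l2Sq Ω (fun x => f x + -1 * f' x) = 0 := by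
    unfold l2Sq
    rw [lintegral_congr_ae (g := fun _ => 0), lintegral_zero]
    filter_upwards [hff'] with x hx
    simp [hx]
  have h1 : l2Sq univ (T fun x => f x + -1 * f' x) = 0 := by
    have := h.l2Sq_le _ hm
    rwa [h0, mul_zero, nonpos_iff_eq_zero] at this
  have h2 := (lintegral_eq_zero_iff' ((h.memLp _ hm).1.enorm.pow_const 2)).1 h1
  filter_upwards [h2] with x hx
  rw [h.map_add, h.map_smul] at hx
  have : T f x + -1 * T f' x = 0 := by simpa using hx
  linarith

theorem eLpNorm_le {f : Eu d → ℝ} (hf : MemLp f 2 (volume.restrict Ω)) :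
    eLpNorm (T f) 2 (volume.restrict univ) ≤
      (C ^ (1 / 2 : ℝ) : ℝ≥0) * eLpNorm f 2 (volume.restrict Ω) := by
  rw [eLpNorm_eq_rpow_l2Sq, eLpNorm_eq_rpow_l2Sq, ENNReal.coe_rpow_of_nonneg _ (by norm_num),
    ← ENNReal.mul_rpow_of_nonneg _ _ (by norm_num)]
  exact ENNReal.rpow_le_rpow (h.l2Sq_le f hf) (by norm_num)

theorem eLpNorm_grad_le {f : Eu d → ℝ} {g : Eu d → Eu d} (hf : MemLp f 2 (volume.restrict Ω))
    (hg : MemLp g 2 (volume.restrict Ω)) :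
    eLpNorm (G f g) 2 (volume.restrict univ) ≤ (C ^ (1 / 2 : ℝ) : ℝ≥0) *
      (eLpNorm f 2 (volume.restrict Ω) + eLpNorm g 2 (volume.restrict Ω)) := by
  simp only [eLpNorm_eq_rpow_l2Sq]
  refine (ENNReal.rpow_le_rpow (h.l2Sq_grad_le f g hf hg) (by norm_num : (0 : ℝ) ≤ 1 / 2)).trans ?_
  rw [ENNReal.coe_rpow_of_nonneg _ (by norm_num), ENNReal.mul_rpow_of_nonneg _ _ (by norm_num)]
  exact mul_le_mul_right (ENNReal.rpow_add_le_add_rpow _ _ (by norm_num) (by norm_num)) _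

theorem gagliardoSq_rpow_le {f : Eu d → ℝ} {g : Eu d → Eu d} (hf : MemLp f 2 (volume.restrict Ω))
    (hg : MemLp g 2 (volume.restrict Ω)) (hw : WG Ω f g) :
    gagliardoSq s univ (G f g) ^ (1 / 2 : ℝ) ≤ (C ^ (1 / 2 : ℝ) : ℝ≥0) *
      (eLpNorm f 2 (volume.restrict Ω) + hsNorm s Ω g) := by
  rw [hsNorm, eLpNorm_eq_rpow_l2Sq, eLpNorm_eq_rpow_l2Sq]
  refine (ENNReal.rpow_le_rpow (h.gagOn_le f g hf hg hw) (by norm_num : (0 : ℝ) ≤ 1 / 2)).trans ?_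
  rw [ENNReal.coe_rpow_of_nonneg _ (by norm_num), ENNReal.mul_rpow_of_nonneg _ _ (by norm_num),
    add_comm (gagliardoSq s Ω g ^ (1 / 2 : ℝ)), ← add_assoc]
  refine mul_le_mul_right ((ENNReal.rpow_add_le_add_rpow _ _ (by norm_num) (by norm_num)).trans
    (add_le_add ?_ le_rfl)) _
  exact ENNReal.rpow_add_le_add_rpow _ _ (by norm_num) (by norm_num)

end BddOp

/-- Membership in `H1s` provides a weak gradient, so the choice in `weakGrad` is genuine and not the
default zero. -/
theorem isWeakGradient_weakGrad {s : ℝ} {Ω : Set (Eu d)} (f : H1s s Ω) :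
    IsWeakGradient Ω f.1 (weakGrad Ω f.1) := by
  obtain ⟨f, g, hg, -⟩ := f
  have : ∃ g, IsWeakGradient Ω f g := ⟨g, hg⟩
  simp only [weakGrad, dif_pos this]
  exact this.choose_spec

theorem gagliardoSq_weakGrad_lt_top {s : ℝ} {Ω : Set (Eu d)} (hΩ : IsOpen Ω) (f : H1s s Ω) :
    gagliardoSq s Ω (weakGrad Ω f.1) < ⊤ := by
  obtain ⟨g, hg, hgs⟩ := f.2
  have e := (isWeakGradient_weakGrad f).ae_eq hΩ hg
  exact (gagOn_congr s e e).trans_lt hgs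

theorem l2Sq_lt_top {F : Type*} [NormedAddCommGroup F] {U : Set (Eu d)} {f : Eu d → F}
    (hf : MemLp f 2 (volume.restrict U)) : l2Sq U f < ⊤ := by
  rw [l2Sq_eq]
  exact ENNReal.pow_lt_top hf.2

namespace BddOp

variable {s : ℝ} {Ω : Set (Eu d)} {T : (Eu d → ℝ) → Eu d → ℝ}
  {G : (Eu d → ℝ) → (Eu d → Eu d) → Eu d → Eu d} {C : ℝ≥0} (h : BddOp s Ω T G C)

theorem isWeakGradient_toLp (f : H1s s Ω) :
    IsWeakGradient univ ((h.memLp f.1 (Lp.memLp f.1)).toLp) (G f.1 (weakGrad Ω f.1)) := by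
  have hw := isWeakGradient_weakGrad f
  have hf := Lp.memLp f.1
  refine ⟨h.memLp_grad _ _ hf hw.1, fun φ hφ hc hs i => ?_⟩
  rw [← h.wg _ _ hf hw.1 hw.2 φ hφ hc hs i]
  refine integral_congr_ae ?_
  filter_upwards [(h.memLp _ hf).coeFn_toLp] with x hx
  rw [hx]

/-- The operator induced on classes. -/
def toLin (hΩ : IsOpen Ω) : H1s s Ω →ₗ[ℝ] H1s s (univ : Set (Eu d)) where
  toFun f := ⟨(h.memLp f.1 (Lp.memLp f.1)).toLp, G f.1 (weakGrad Ω f.1), h.isWeakGradient_toLp f,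
    by
      have hw := isWeakGradient_weakGrad f
      have hf := Lp.memLp f.1
      exact (h.gagOn_le _ _ hf hw.1 hw.2).trans_lt (ENNReal.mul_lt_top ENNReal.coe_lt_top
        (ENNReal.add_lt_top.2 ⟨ENNReal.add_lt_top.2 ⟨l2Sq_lt_top hf, l2Sq_lt_top hw.1⟩,
          gagliardoSq_weakGrad_lt_top hΩ f⟩))⟩
  map_add' f g := by
    refine Subtype.ext ?_
    have hf := Lp.memLp f.1
    have hg := Lp.memLp g.1
    refine Eq.trans ?_ (MemLp.toLp_add (h.memLp _ hf) (h.memLp _ hg))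
    refine (MemLp.toLp_eq_toLp_iff (h.memLp _ (Lp.memLp (f + g).1)) _).2 ?_
    -- The chosen representative of the sum agrees only a.e. with the sum of the representatives,
    -- and `congr` absorbs the discrepancy.
    filter_upwards [h.congr (Lp.memLp _) (Lp.coeFn_add f.1 g.1)] with x hx
    exact hx.trans (h.map_add f.1 g.1 x)
  map_smul' c f := by
    refine Subtype.ext ?_
    have hf := Lp.memLp f.1
    refine Eq.trans ?_ (MemLp.toLp_const_smul c (h.memLp _ hf))
    refine (MemLp.toLp_eq_toLp_iff (h.memLp _ (Lp.memLp (c • f).1)) _).2 ?_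
    filter_upwards [h.congr (Lp.memLp _) (Lp.coeFn_smul c f.1)] with x hx
    exact hx.trans (h.map_smul c f.1 x)

theorem coeFn_toLin (hΩ : IsOpen Ω) (f : H1s s Ω) : ∀ᵐ x, (h.toLin hΩ f).1 x = T f.1 x := by
  have := (ae_restrict_iff' MeasurableSet.univ).1 (h.memLp f.1 (Lp.memLp f.1)).coeFn_toLp
  exact this.mono fun x hx => hx (mem_univ x)

theorem eLpNorm_toLin (hΩ : IsOpen Ω) (f : H1s s Ω) :
    eLpNorm (h.toLin hΩ f).1 2 (volume.restrict univ) = eLpNorm (T f.1) 2 (volume.restrict univ) :=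
  eLpNorm_congr_ae (h.memLp f.1 (Lp.memLp f.1)).coeFn_toLp

/-- Uniqueness of the weak gradient identifies the chosen gradient of the extension with the
explicit formula `G`, for which the bounds were proved. -/
theorem weakGrad_toLin (hΩ : IsOpen Ω) (f : H1s s Ω) :
    weakGrad univ (h.toLin hΩ f).1 =ᵐ[volume.restrict univ] G f.1 (weakGrad Ω f.1) :=
  (isWeakGradient_weakGrad _).ae_eq isOpen_univ (h.isWeakGradient_toLp f)

theorem h1Norm_toLin_le (hΩ : IsOpen Ω) (f : H1s s Ω) :
    h1Norm univ (h.toLin hΩ f).1 ≤ (2 * C ^ (1 / 2 : ℝ) : ℝ≥0) * h1Norm Ω f.1 := by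
  have hw := isWeakGradient_weakGrad f
  have hf := Lp.memLp f.1
  rw [h1Norm, h.eLpNorm_toLin hΩ, eLpNorm_congr_ae (h.weakGrad_toLin hΩ f), h1Norm]
  set a := eLpNorm f.1 2 (volume.restrict Ω)
  set b := eLpNorm (weakGrad Ω f.1) 2 (volume.restrict Ω)
  set M : ℝ≥0 := C ^ (1 / 2 : ℝ)
  calc _ ≤ M * a + M * (a + b) := add_le_add (h.eLpNorm_le hf) (h.eLpNorm_grad_le hf hw.1)
    _ ≤ M * a + M * (a + b) + M * b := le_self_add
    _ = _ := by push_cast; ring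

theorem hsNorm_toLin_le (hΩ : IsOpen Ω) (f : H1s s Ω) :
    hsNorm s univ (weakGrad univ (h.toLin hΩ f).1) ≤ (2 * C ^ (1 / 2 : ℝ) : ℝ≥0) *
      (eLpNorm f.1 2 (volume.restrict Ω) + hsNorm s Ω (weakGrad Ω f.1)) := by
  have hw := isWeakGradient_weakGrad f
  have hf := Lp.memLp f.1
  have e := h.weakGrad_toLin hΩ f
  have e1 : gagliardoSq s univ (weakGrad univ (h.toLin hΩ f).1)
      = gagliardoSq s univ (G f.1 (weakGrad Ω f.1)) := gagOn_congr s e e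
  rw [hsNorm, e1, eLpNorm_congr_ae e]
  set a := eLpNorm f.1 2 (volume.restrict Ω)
  set M : ℝ≥0 := C ^ (1 / 2 : ℝ)
  calc _ ≤ M * (a + hsNorm s Ω (weakGrad Ω f.1)) +
        M * (a + eLpNorm (weakGrad Ω f.1) 2 (volume.restrict Ω)) :=
      add_le_add (h.gagliardoSq_rpow_le hf hw.1 hw.2) (h.eLpNorm_grad_le hf hw.1)
    _ ≤ M * (a + hsNorm s Ω (weakGrad Ω f.1)) + M * (a + hsNorm s Ω (weakGrad Ω f.1)) :=
      add_le_add le_rfl (mul_le_mul_right (add_le_add le_rfl le_add_self) _)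
    _ = _ := by push_cast; ring

theorem h1sNorm_toLin_le (hΩ : IsOpen Ω) (f : H1s s Ω) :
    h1sNorm s univ (h.toLin hΩ f).1 ≤ (3 * C ^ (1 / 2 : ℝ) : ℝ≥0) * h1sNorm s Ω f.1 := by
  rw [h1sNorm, h.eLpNorm_toLin hΩ, h1sNorm]
  set a := eLpNorm f.1 2 (volume.restrict Ω)
  set b := hsNorm s Ω (weakGrad Ω f.1)
  set M : ℝ≥0 := C ^ (1 / 2 : ℝ)
  calc _ ≤ M * a + (2 * M : ℝ≥0) * (a + b) :=
        add_le_add (h.eLpNorm_le (Lp.memLp f.1)) (h.hsNorm_toLin_le hΩ f)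
    _ ≤ M * a + (2 * M : ℝ≥0) * (a + b) + M * b := le_self_add
    _ = _ := by push_cast; ring

end BddOp

/-- The Poincaré inequality for functions of mean zero in `H^{1+s}` of a connected `C²` domain. -/
theorem exists_poincare (hd : 1 ≤ d) {s : ℝ} (hs0 : 0 < s) (hs1 : s < 1) {Ω : Set (Eu d)}
    (hΩ : IsOpen Ω) (hΩb : Bornology.IsBounded Ω) (hΩ2 : HasC2Boundary Ω) (hc : IsConnected Ω) :
    ∃ P : ℝ≥0, ∀ f : H1s s Ω, ∫ x in Ω, f.1 x = 0 →
      eLpNorm f.1 2 (volume.restrict Ω) ≤ P * hsNorm s Ω (weakGrad Ω f.1) := by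
  have hP := poincareRel_of_isConnected hΩ hΩb hc fun x hx => by
    obtain ⟨U, T, D, C, hE, hxU, -⟩ := exists_locExt hd hs0 hs1 hΩ hΩb hΩ2 isOpen_univ
      (subset_univ _) hx
    exact hE.poincareRel hΩ hxU
  obtain ⟨C, hC⟩ := hP.l2Sq_le hΩb.measure_lt_top.ne (hΩ.measure_pos _ hc.nonempty).ne'
  refine ⟨C ^ (1 / 2 : ℝ), fun f h0 => ?_⟩
  have hw := isWeakGradient_weakGrad f
  refine le_trans ?_ (mul_le_mul_right le_add_self _)
  rw [eLpNorm_eq_rpow_l2Sq, eLpNorm_eq_rpow_l2Sq, ENNReal.coe_rpow_of_nonneg _ (by norm_num),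
    ← ENNReal.mul_rpow_of_nonneg _ _ (by norm_num)]
  exact ENNReal.rpow_le_rpow (hC _ _ (Lp.memLp f.1) hw.1 hw.2 h0) (by norm_num)

end FracExt
end
-- The extension theorem.
open FracExt in
theorem mainTheorem3 (d : ℕ) (hd : 1 ≤ d) (s : ℝ) (hs0 : 0 < s) (hs1 : s < 1 / 2)
    (Ω : Set (Eu d)) (hΩ : IsOpen Ω) (hΩb : Bornology.IsBounded Ω) (hΩ2 : HasC2Boundary Ω)
    (V : Set (Eu d)) (hV : IsOpen V) (hVb : Bornology.IsBounded V) (hΩV : closure Ω ⊆ V) :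
    ∃ (E : H1s s Ω →ₗ[ℝ] H1s s (univ : Set (Eu d))) (C : ℝ≥0),
      -- `E` is bounded from `H^{1+s}(Ω)` to `H^{1+s}(ℝ^d)`
      (∀ f : H1s s Ω, h1sNorm s univ (E f).1 ≤ C * h1sNorm s Ω f.1) ∧
      -- `E f = f` a.e. in `Ω`
      (∀ f : H1s s Ω, ∀ᵐ x ∂(volume : Measure (Eu d)),
        x ∈ Ω → (E f).1 x = f.1 x) ∧
      -- the (essential) support of `E f` is a compact subset of `V`
      (∀ f : H1s s Ω, ∃ K : Set (Eu d), IsCompact K ∧ K ⊆ V ∧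
        ∀ᵐ x ∂(volume : Measure (Eu d)), x ∉ K → (E f).1 x = 0) ∧
      -- the `H^1` bound
      (∀ f : H1s s Ω, h1Norm univ (E f).1 ≤ C * h1Norm Ω f.1) ∧
      -- the `H^s` bound for the gradient
      (∀ f : H1s s Ω, hsNorm s univ (weakGrad (univ : Set (Eu d)) (E f).1) ≤
        C * (eLpNorm f.1 2 (volume.restrict Ω) + hsNorm s Ω (weakGrad Ω f.1))) ∧
      -- on a connected `Ω`, the `H^s` bound by the gradient alone for functions of mean zero
      (IsConnected Ω → ∀ f : H1s s Ω, (∫ x in Ω, f.1 x) = 0 →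
        hsNorm s univ (weakGrad (univ : Set (Eu d)) (E f).1) ≤
          C * hsNorm s Ω (weakGrad Ω f.1)) := by
  have hs1' : s < 1 := by linarith
  obtain ⟨T, G, C, h, hT, K, hK, hKV, hTK⟩ := exists_bddOp hd hs0 hs1' hΩ hΩb hΩ2 hV hΩV
  -- A single constant must be fixed whether or not `Ω` is connected, hence the dummy value `0` in
  -- the disconnected case.
  obtain ⟨P, hP⟩ : ∃ P : ℝ≥0, IsConnected Ω → ∀ f : H1s s Ω, (∫ x in Ω, f.1 x) = 0 →
      eLpNorm f.1 2 (volume.restrict Ω) ≤ P * hsNorm s Ω (weakGrad Ω f.1) := by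
    by_cases hc : IsConnected Ω
    · obtain ⟨P, hP⟩ := exists_poincare hd hs0 hs1' hΩ hΩb hΩ2 hc
      exact ⟨P, fun _ => hP⟩
    · exact ⟨0, fun h => absurd h hc⟩
  set M : ℝ≥0 := C ^ (1 / 2 : ℝ) with hM
  -- The constant `3M(P + 1)` dominates `3M` for the full norm, `2M` for the `H¹` and gradient
  -- bounds, and `2M(P + 1)`, which arises when the Poincaré inequality absorbs `‖f‖`.
  have h2 : 2 * M ≤ 3 * M * (P + 1) :=
    (mul_le_mul_left (by norm_num : (2 : ℝ≥0) ≤ 3) M).trans (le_mul_of_one_le_right' le_add_self)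
  have h3 : 3 * M ≤ 3 * M * (P + 1) := le_mul_of_one_le_right' le_add_self
  refine ⟨h.toLin hΩ, 3 * M * (P + 1), fun f => ?_, fun f => ?_, fun f => ⟨K, hK, hKV, ?_⟩,
    fun f => ?_, fun f => ?_, fun hc f hf => ?_⟩
  · exact (h.h1sNorm_toLin_le hΩ f).trans (mul_le_mul_left (ENNReal.coe_le_coe.2 h3) _)
  · filter_upwards [h.coeFn_toLin hΩ f] with x hx hxΩ
    rw [hx, hT _ x hxΩ]
  · filter_upwards [h.coeFn_toLin hΩ f] with x hx hxK
    rw [hx, hTK _ x hxK]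
  · exact (h.h1Norm_toLin_le hΩ f).trans (mul_le_mul_left (ENNReal.coe_le_coe.2 h2) _)
  · exact (h.hsNorm_toLin_le hΩ f).trans (mul_le_mul_left (ENNReal.coe_le_coe.2 h2) _)
  · calc _ ≤ (2 * M : ℝ≥0) * (eLpNorm f.1 2 (volume.restrict Ω) + hsNorm s Ω (weakGrad Ω f.1)) :=
          h.hsNorm_toLin_le hΩ f
      _ ≤ (2 * M : ℝ≥0) * (P * hsNorm s Ω (weakGrad Ω f.1) + hsNorm s Ω (weakGrad Ω f.1)) :=
          mul_le_mul_right (add_le_add (hP hc f hf) le_rfl) _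
      _ = (2 * M * (P + 1) : ℝ≥0) * hsNorm s Ω (weakGrad Ω f.1) := by push_cast; ring
      _ ≤ _ := mul_le_mul_left (ENNReal.coe_le_coe.2 (mul_le_mul_left
          (mul_le_mul_left (by norm_num) M) _)) _
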